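/- Work over $\mathbb{Q}$. Let $\mathfrak{Lie}$ be the Lie operad and $\mathsf{Cat}\mathfrak{Lie}$ the associated PROP: the $\mathbb{Q}$-linear category with objects $n\in\mathbb{N}$ and $$\mathsf{Cat}\mathfrak{Lie}(m,n)=\bigoplus_{f:\{1,\dots,m\}\twoheadrightarrow\{1,\dots,n\}}\ \bigotimes_{i=1}^n\mathfrak{Lie}(f^{-1}(i)),$$ composition being induced by operadic composition, with symmetric monoidal structure $\boxplus$ given on objects by addition. Equivalently, $\mathsf{Cat}\mathfrak{Lie}(m,n)$ is the subspace of $L_m^{\otimes n}$, where $L_m$ is the free Lie algebra on $x_1,\dots,x_m$, spanned by the tensor products of Lie monomials in which each $x_j$ occurs exactly once, and composition is substitution. Left (right) modules are the $\mathbb{Q}$-linear functors from $\mathsf{Cat}\mathfrak{Lie}$ (from $\mathsf{Cat}\mathfrak{Lie}^{op}$) to $\mathbb{Q}$-vector spaces; a bimodule $B$ has terms $B(m,n)$, is a right module in $m$ and a left module in $n$. Define: (a) $\delta\mathsf{Cat}\mathfrak{Lie}(m,n)=\mathsf{Cat}\mathfrak{Lie}(m,n+1)$, a bimodule by composition, where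 $\psi\in\mathsf{Cat}\mathfrak{Lie}(n,p)$ acts on the left through $\psi\boxplus\mathrm{id}_1$. (b) $\delta^{(1)}\mathsf{Cat}\mathfrak{Lie}(m,n)\subseteq\delta\mathsf{Cat}\mathfrak{Lie}(m,n)$, the part given by the $f:\{1,\dots,m\}\twoheadrightarrow\{1,\dots,n+1\}$ with $|f^{-1}(n+1)|=1$; and $\pi:\delta\mathsf{Cat}\mathfrak{Lie}\to\delta^{(1)}\mathsf{Cat}\mathfrak{Lie}$, the retraction given as follows. Let $L$ be the free Lie algebra on a space $V$ and $T$ the tensor algebra on $V$, so that $L\subset T^+\cong T\otimes V$, with $T^+$ the augmentation ideal; $T$ acts on the right of $L^{\otimes n}$, extending the action $z\mapsto z\cdot X$ of $X\in L$ by the tensor power of the right adjoint representation. Then $\pi$ is the multilinear part of $L^{\otimes n}\otimes L\subset L^{\otimes n}\otimes T\otimes V\to L^{\otimes n}\otimes V$. That is, $\pi(z\otimes x)=z\otimes x$ for $x$ a generator and $\pi(z\otimes[X,Y])=\pi(z\cdot X\otimes Y)-\pi(z\cdot Y\otimes X)$. There is a unique bimodule structure on $\delta^{(1)}\mathsf{Cat}\mathfrak{Lie}$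 for which $\pi$ is a morphism of bimodules; this structure is used. (c) $\mu(n)=\sum_{i=1}^n x_1\otimes\dots\otimes[x_i,x_{n+1}]\otimes\dots\otimes x_n\in\mathsf{Cat}\mathfrak{Lie}(n+1,n)$. Composition with $\mu(n)$ gives morphisms of bimodules $\widetilde\mu:\delta\mathsf{Cat}\mathfrak{Lie}\to\mathsf{Cat}\mathfrak{Lie}$ and, by restriction, $\widetilde\mu^{(1)}:\delta^{(1)}\mathsf{Cat}\mathfrak{Lie}\to\mathsf{Cat}\mathfrak{Lie}$. (d) $\mathbb{C}\mathfrak{Lie}$, the complex of bimodules $\delta^{(1)}\mathsf{Cat}\mathfrak{Lie}\xrightarrow{\widetilde\mu^{(1)}}\mathsf{Cat}\mathfrak{Lie}$, concentrated in homological degrees $1$ and $0$. (e) $\mathsf{CE}_{\mathfrak{Lie}}$, the universal Chevalley–Eilenberg complex, a complex of bimodules: its term of homological degree $t$ is $(m,n)\mapsto\bigoplus_{S_1\sqcup S_2=\{1,\dots,m\}}\mathsf{Cat}\mathfrak{Lie}(S_1,n)\otimes(\Lambda^t\mathfrak{Lie})(S_2)$ ($\Lambda^t$ for the convolution product), i.e.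 the part of $L_m^{\otimes n}\otimes\Lambda^tL_m$ in which each $x_j$ occurs exactly once. The right structure is given by substitution, the left one by the operation of $\mathsf{Cat}\mathfrak{Lie}$ on $L_m^{\otimes\bullet}$, and the differential is the Chevalley–Eilenberg differential of $L_m$ with coefficients in the right module $L_m^{\otimes n}$; in particular $d(z\otimes X)=z\cdot X$ and $d(z\otimes X\wedge Y)=z\cdot X\otimes Y-z\cdot Y\otimes X-z\otimes[X,Y]$. **Theorem.** As bimodules, $(\mathsf{CE}_{\mathfrak{Lie}})_0=\mathsf{Cat}\mathfrak{Lie}$ (by $z\otimes1\mapsto z$) and $(\mathsf{CE}_{\mathfrak{Lie}})_1=\delta\mathsf{Cat}\mathfrak{Lie}$ (by $z\otimes X\mapsto z\otimes X$); the differential $(\mathsf{CE}_{\mathfrak{Lie}})_1\to(\mathsf{CE}_{\mathfrak{Lie}})_0$ corresponds to $\widetilde\mu$, and $\widetilde\mu=\widetilde\mu^{(1)}\circ\pi$. There is a unique morphism of complexes of bimodules $$\mathsf{CE}_{\mathfrak{Lie}}\to\mathbb{C}\mathfrak{Lie}$$ which is the identity in degree $0$ and $\pi$ in degree $1$ (and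 zero in degrees $\ge2$). It is surjective, and it is a weak equivalence: for all $m,n$ it is a quasi-isomorphism on the values at $(m,n)$. Moreover, for all $t$ and $n$, the right $\mathsf{Cat}\mathfrak{Lie}$-module $(\mathsf{CE}_{\mathfrak{Lie}})_t(-,n)$ is projective. -/

import Mathlib

open CategoryTheory
open scoped TensorProduct

noncomputable section

namespace LiePROP

section TensorPowers

variable {g g' g'' : Type} [LieRing g''] [LieAlgebra ℚ g''] [LieRing g'] [LieAlgebra ℚ g']
  [LieRing g] [LieAlgebra ℚ g]

/-- The tensor power `g^{⊗ n}`. -/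
abbrev TPow (n : ℕ) (g : Type) [LieRing g] [LieAlgebra ℚ g] : Type := ⨂[ℚ] (_ : Fin n), g

/-- The map `g^{⊗ n} → g'^{⊗ n}` induced by a morphism of Lie algebras. -/
def tpMap (n : ℕ) (h : g →ₗ⁅ℚ⁆ g') : TPow n g →ₗ[ℚ] TPow n g' :=
  PiTensorProduct.map fun _ => h.toLinearMap

@[simp] lemma tpMap_tprod (n : ℕ) (h : g →ₗ⁅ℚ⁆ g') (v : Fin n → g) :
    tpMap n h (PiTensorProduct.tprod ℚ v) = PiTensorProduct.tprod ℚ (fun i => h (v i)) :=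
  PiTensorProduct.map_tprod _ _

/-- The linear isomorphism `g^{⊗ n} ⊗ g ≅ g^{⊗ (n+1)}` (the extra factor is put last). -/
def snocE (n : ℕ) : TPow n g ⊗[ℚ] g ≃ₗ[ℚ] TPow (n + 1) g :=
  (TensorProduct.congr (LinearEquiv.refl ℚ _)
    (PiTensorProduct.subsingletonEquiv (R := ℚ) (s := fun _ : Fin 1 => g) 0).symm) ≪≫ₗ
    TensorPower.mulEquiv

@[simp] lemma snocE_tprod (n : ℕ) (v : Fin n → g) (x : g) :
    snocE n (PiTensorProduct.tprod ℚ v ⊗ₜ[ℚ] x) =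
      PiTensorProduct.tprod ℚ (Fin.snoc v x : Fin (n + 1) → g) := by
  rw [snocE, LinearEquiv.trans_apply, TensorProduct.congr_tmul,
    PiTensorProduct.subsingletonEquiv_symm_apply']
  refine (TensorPower.tprod_mul_tprod ℚ v (fun _ : Fin 1 => x)).trans ?_
  rw [Fin.append_right_eq_snoc]

lemma snocE_map (n : ℕ) (h : g →ₗ⁅ℚ⁆ g') (z : TPow n g) (x : g) :
    tpMap (n + 1) h (snocE n (z ⊗ₜ x)) = snocE n (tpMap n h z ⊗ₜ h x) := by
  induction z using PiTensorProduct.induction_on with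
  | smul_tprod r v =>
    simp only [map_smul, ← TensorProduct.smul_tmul', snocE_tprod, tpMap_tprod]
    congr 2
    funext i
    refine Fin.lastCases ?_ (fun j => ?_) i <;> simp
  | add a b ha hb => simp only [TensorProduct.add_tmul, map_add, ha, hb]

/-- `rbr x` is the right adjoint action `y ↦ [y, x]`. -/
def rbr : g →ₗ[ℚ] Module.End ℚ g := (LieAlgebra.ad ℚ g : g →ₗ[ℚ] Module.End ℚ g).flip

@[simp] lemma rbr_apply (x y : g) : rbr x y = ⁅y, x⁆ := rfl

/-- The right action of `g` on `g^{⊗ n}`, the `n`-fold tensor product of the right adjoint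
representation: `(v₁ ⊗ ⋯ ⊗ vₙ) · x = ∑ᵢ v₁ ⊗ ⋯ ⊗ [vᵢ, x] ⊗ ⋯ ⊗ vₙ`. -/
def adAct (n : ℕ) : g →ₗ[ℚ] Module.End ℚ (TPow n g) :=
  ∑ i : Fin n, ((PiTensorProduct.mapMultilinear ℚ (fun _ : Fin n => g)
    (fun _ : Fin n => g)).toLinearMap (fun _ => LinearMap.id) i) ∘ₗ rbr

/-- Applying an endomorphism to the `i`-th tensor factor. -/
def atFactor (n : ℕ) (i : Fin n) (D : Module.End ℚ g) : Module.End ℚ (TPow n g) :=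
  PiTensorProduct.map (Function.update (fun _ => LinearMap.id) i D)

lemma adAct_eq (n : ℕ) (x : g) : adAct n x = ∑ i, atFactor n i (rbr x) := by
  simp only [adAct, LinearMap.sum_apply]
  rfl

lemma atFactor_tprod (n : ℕ) (i : Fin n) (D : Module.End ℚ g) (v : Fin n → g) :
    atFactor n i D (PiTensorProduct.tprod ℚ v) =
      PiTensorProduct.tprod ℚ (Function.update v i (D (v i))) := by
  rw [atFactor, PiTensorProduct.map_tprod]
  congr 1
  funext j
  rcases eq_or_ne j i with rfl | h
  · simp
  · simp [h]

lemma adAct_tprod (n : ℕ) (x : g) (v : Fin n → g) :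
    adAct n x (PiTensorProduct.tprod ℚ v) =
      ∑ i, PiTensorProduct.tprod ℚ (Function.update v i ⁅v i, x⁆) := by
  rw [adAct_eq, LinearMap.sum_apply]
  exact Finset.sum_congr rfl fun i _ => atFactor_tprod n i _ v

lemma adAct_lie (n : ℕ) (x y : g) (z : TPow n g) :
    adAct n ⁅x, y⁆ z = adAct n y (adAct n x z) - adAct n x (adAct n y z) := by
  have key : adAct n ⁅x, y⁆ = adAct n y * adAct n x - adAct n x * adAct n y := by
    have hc : ∀ i j : Fin n, i ≠ j → ∀ D D' : Module.End ℚ g,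
        atFactor n i D * atFactor n j D' = atFactor n j D' * atFactor n i D := by
      intro i j hij D D'
      refine PiTensorProduct.ext (MultilinearMap.ext fun v => ?_)
      simp [atFactor_tprod, hij, hij.symm, Function.update_comm hij]
    have hs : ∀ i : Fin n, ∀ D D' : Module.End ℚ g,
        atFactor n i D * atFactor n i D' = atFactor n i (D * D') := by
      intro i D D'
      refine PiTensorProduct.ext (MultilinearMap.ext fun v => ?_)
      simp [atFactor_tprod]
    have hsub : ∀ i : Fin n, ∀ D D' : Module.End ℚ g,
        atFactor n i (D - D') = atFactor n i D - atFactor n i D' := by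
      intro i D D'
      refine PiTensorProduct.ext (MultilinearMap.ext fun v => ?_)
      simp [atFactor_tprod, MultilinearMap.map_update_sub]
    have hb : rbr ⁅x, y⁆ = rbr y * rbr x - rbr x * (rbr y : Module.End ℚ g) := by
      ext u
      simp [rbr]
      rw [← lie_skew y x, lie_neg, leibniz_lie u x y, ← lie_skew y ⁅u, x⁆]
      abel
    simp only [adAct_eq, Finset.sum_mul_sum, hb, hsub]
    rw [Finset.sum_comm (f := fun i j => atFactor n i (rbr x) * atFactor n j (rbr y)),
      ← Finset.sum_sub_distrib]
    refine Finset.sum_congr rfl fun i _ => ?_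
    rw [← Finset.sum_sub_distrib, Finset.sum_eq_single i]
    · rw [hs, hs]
    · intro j _ hj
      rw [hc i j hj.symm, sub_self]
    · simp
  rw [key]; rfl

lemma adAct_map (n : ℕ) (h : g →ₗ⁅ℚ⁆ g') (x : g) (z : TPow n g) :
    tpMap n h (adAct n x z) = adAct n (h x) (tpMap n h z) := by
  induction z using PiTensorProduct.induction_on with
  | smul_tprod r v =>
    simp only [map_smul, adAct_tprod, map_sum, tpMap_tprod]
    congr 1
    refine Finset.sum_congr rfl fun i _ => ?_
    congr 1
    funext j
    rcases eq_or_ne j i with rfl | hj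
    · simp
    · simp [hj]
  | add a b ha hb => simp only [map_add, ha, hb]

lemma tpMap_comp (n : ℕ) (h : g →ₗ⁅ℚ⁆ g') (h' : g' →ₗ⁅ℚ⁆ g'') (z : TPow n g) :
    tpMap n h' (tpMap n h z) = tpMap n (h'.comp h) z := by
  induction z using PiTensorProduct.induction_on with
  | smul_tprod r v => simp only [map_smul, tpMap_tprod]; rfl
  | add a b ha hb => simp only [map_add, ha, hb]

/-! ### The Chevalley–Eilenberg differential -/

/-- The space `g^{⊗ n} ⊗ Λ^* g` underlying the Chevalley–Eilenberg complex of `g` with coefficients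
in `g^{⊗ n}`. -/
abbrev CESp (n : ℕ) (g : Type) [LieRing g] [LieAlgebra ℚ g] : Type :=
  TPow n g ⊗[ℚ] ExteriorAlgebra ℚ g

/-- The map `g^{⊗ n} ⊗ Λ^* g → g'^{⊗ n} ⊗ Λ^* g'` induced by a morphism of Lie algebras. -/
def ceMap (n : ℕ) (h : g →ₗ⁅ℚ⁆ g') : CESp n g →ₗ[ℚ] CESp n g' :=
  TensorProduct.map (tpMap n h) (ExteriorAlgebra.map h.toLinearMap).toLinearMap

@[simp] lemma ceMap_tmul (n : ℕ) (h : g →ₗ⁅ℚ⁆ g') (z : TPow n g) (ω : ExteriorAlgebra ℚ g) :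
    ceMap n h (z ⊗ₜ ω) = tpMap n h z ⊗ₜ ExteriorAlgebra.map h.toLinearMap ω := rfl

/-- The right adjoint action of `x` on `Λ^* g`: the derivation determined by
`(u ∧ ω) · x = [u, x] ∧ ω + u ∧ (ω · x)` and `1 · x = 0`. -/
def extAct (x : g) : ExteriorAlgebra ℚ g →ₗ[ℚ] ExteriorAlgebra ℚ g :=
  CliffordAlgebra.foldr' (0 : QuadraticForm ℚ g)
    (LinearMap.mk₂ ℚ
      (fun (u : g) (p : ExteriorAlgebra ℚ g × ExteriorAlgebra ℚ g) =>
        ExteriorAlgebra.ι ℚ ⁅u, x⁆ * p.1 + ExteriorAlgebra.ι ℚ u * p.2)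
      (by intros; simp only [add_lie, map_add, add_mul]; abel)
      (by intros; simp only [smul_lie, map_smul, smul_mul_assoc, smul_add])
      (by intros; simp only [Prod.fst_add, Prod.snd_add, mul_add]; abel)
      (by intros; simp only [Prod.smul_fst, Prod.smul_snd, mul_smul_comm, smul_add]))
    (by
      rintro u ω h
      have h1 := ExteriorAlgebra.ι_add_mul_swap (R := ℚ) ⁅u, x⁆ u
      have h2 := ExteriorAlgebra.ι_sq_zero (R := ℚ) u
      change ExteriorAlgebra.ι ℚ ⁅u, x⁆ * (ExteriorAlgebra.ι ℚ u * ω) + ExteriorAlgebra.ι ℚ u *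
        (ExteriorAlgebra.ι ℚ ⁅u, x⁆ * ω + ExteriorAlgebra.ι ℚ u * _) = _
      rw [mul_add, ← mul_assoc, ← mul_assoc, ← mul_assoc, h2, zero_mul, add_zero, ← add_mul, h1]
      simp only [zero_mul, zero_apply, zero_smul])
    0

@[simp] lemma extAct_one (x : g) : extAct x 1 = 0 := by
  rw [extAct, ← map_one (algebraMap ℚ (ExteriorAlgebra ℚ g)), CliffordAlgebra.foldr'_algebraMap,
    smul_zero]

lemma extAct_ι_mul (x u : g) (ω : ExteriorAlgebra ℚ g) :
    extAct x (ExteriorAlgebra.ι ℚ u * ω) =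
      ExteriorAlgebra.ι ℚ ⁅u, x⁆ * ω + ExteriorAlgebra.ι ℚ u * extAct x ω :=
  CliffordAlgebra.foldr'_ι_mul _ _ _ _ _ _

lemma ext_induction {P : ExteriorAlgebra ℚ g → Prop} (hs : ∀ (r : ℚ) ω, P ω → P (r • ω))
    (h1 : P 1) (ha : ∀ ω ω', P ω → P ω' → P (ω + ω'))
    (hm : ∀ u ω, P ω → P (ExteriorAlgebra.ι ℚ u * ω)) (ω) : P ω := by
  refine CliffordAlgebra.left_induction (P := P) (Q := (0 : QuadraticForm ℚ g)) (fun r => ?_) ha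
    (fun ω u h => hm u ω h) ω
  rw [Algebra.algebraMap_eq_smul_one]
  exact hs r 1 h1

lemma extAct_add (x y : g) (ω : ExteriorAlgebra ℚ g) :
    extAct (x + y) ω = extAct x ω + extAct y ω := by
  induction ω using ext_induction with
  | hs r ω h => simp only [map_smul, h, smul_add]
  | h1 => simp
  | ha a b ha hb => simp only [map_add, ha, hb]; abel
  | hm u ω h => simp only [extAct_ι_mul, h, lie_add, map_add, add_mul, mul_add]; abel

lemma extAct_smul (c : ℚ) (x : g) (ω : ExteriorAlgebra ℚ g) :
    extAct (c • x) ω = c • extAct x ω := by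
  induction ω using ext_induction with
  | hs r ω h => simp only [map_smul, h, smul_comm c r]
  | h1 => simp
  | ha a b ha hb => simp only [map_add, ha, hb, smul_add]
  | hm u ω h =>
    simp only [extAct_ι_mul, h, lie_smul, map_smul, smul_add, smul_mul_assoc, mul_smul_comm]

lemma extAct_lie (x y : g) (ω : ExteriorAlgebra ℚ g) :
    extAct ⁅x, y⁆ ω = extAct y (extAct x ω) - extAct x (extAct y ω) := by
  induction ω using ext_induction with
  | hs r ω h => simp only [map_smul, h, smul_sub]
  | h1 => simp
  | ha a b ha hb => simp only [map_add, ha, hb]; abel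
  | hm u ω h =>
    have hj : ⁅u, ⁅x, y⁆⁆ = ⁅⁅u, x⁆, y⁆ - ⁅⁅u, y⁆, x⁆ := by
      rw [leibniz_lie u x y, ← lie_skew ⁅u, y⁆ x]; abel
    simp only [extAct_ι_mul, h, hj, map_add, map_sub, sub_mul, mul_sub]
    abel

/-- Exterior multiplication by `x` on the `Λ^*` factor. -/
def wedge (n : ℕ) (x : g) : CESp n g →ₗ[ℚ] CESp n g :=
  LinearMap.lTensor _ (LinearMap.mulLeft ℚ (ExteriorAlgebra.ι ℚ x))

@[simp] lemma wedge_tmul (n : ℕ) (x : g) (z : TPow n g) (ω : ExteriorAlgebra ℚ g) :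
    wedge n x (z ⊗ₜ ω) = z ⊗ₜ (ExteriorAlgebra.ι ℚ x * ω) := rfl

/-- The (diagonal) right adjoint action of `x` on `g^{⊗ n} ⊗ Λ^* g`. -/
def diagAct (n : ℕ) (x : g) : CESp n g →ₗ[ℚ] CESp n g :=
  LinearMap.rTensor _ (adAct n x) + LinearMap.lTensor _ (extAct x)

@[simp] lemma diagAct_tmul (n : ℕ) (x : g) (z : TPow n g) (ω : ExteriorAlgebra ℚ g) :
    diagAct n x (z ⊗ₜ ω) = adAct n x z ⊗ₜ ω + z ⊗ₜ extAct x ω := rfl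

lemma ce_induction (n : ℕ) {P : CESp n g → Prop} (ha : ∀ a b, P a → P b → P (a + b))
    (h1 : ∀ z, P (z ⊗ₜ 1)) (hw : ∀ u k, P k → P (wedge n u k)) (k) : P k := by
  induction k using TensorProduct.induction_on with
  | zero => simpa using h1 0
  | add a b h h' => exact ha a b h h'
  | tmul z ω =>
    induction ω using ext_induction generalizing z with
    | hs r ω h => rw [← TensorProduct.smul_tmul]; exact h _
    | h1 => exact h1 z
    | ha a b h h' => rw [TensorProduct.tmul_add]; exact ha _ _ (h z) (h' z)
    | hm u ω h => exact hw u _ (h z)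

lemma diagAct_wedge (n : ℕ) (x u : g) (k : CESp n g) :
    diagAct n x (wedge n u k) = wedge n ⁅u, x⁆ k + wedge n u (diagAct n x k) := by
  induction k using TensorProduct.induction_on with
  | zero => simp
  | add a b h h' => simp only [map_add, h, h']; abel
  | tmul z ω =>
    simp only [wedge_tmul, diagAct_tmul, extAct_ι_mul, TensorProduct.tmul_add, map_add]
    abel

lemma wedge_self (n : ℕ) (u : g) (k : CESp n g) : wedge n u (wedge n u k) = 0 := by
  induction k using TensorProduct.induction_on with
  | zero => simp
  | add a b h h' => simp only [map_add, h, h', add_zero]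
  | tmul z ω => simp [← mul_assoc]

lemma wedge_add (n : ℕ) (x y : g) (k : CESp n g) :
    wedge n (x + y) k = wedge n x k + wedge n y k := by
  induction k using TensorProduct.induction_on with
  | zero => simp
  | add a b h h' => simp only [map_add, h, h']; abel
  | tmul z ω => simp [add_mul, TensorProduct.tmul_add]

lemma wedge_smul (n : ℕ) (c : ℚ) (x : g) (k : CESp n g) : wedge n (c • x) k = c • wedge n x k := by
  induction k using TensorProduct.induction_on with
  | zero => simp
  | add a b h h' => simp only [map_add, h, h', smul_add]
  | tmul z ω => simp

lemma diagAct_add (n : ℕ) (x y : g) (k : CESp n g) :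
    diagAct n (x + y) k = diagAct n x k + diagAct n y k := by
  induction k using TensorProduct.induction_on with
  | zero => simp
  | add a b h h' => simp only [map_add, h, h']; abel
  | tmul z ω =>
    simp only [diagAct_tmul, map_add, LinearMap.add_apply, extAct_add, TensorProduct.tmul_add,
      TensorProduct.add_tmul]
    abel

lemma diagAct_smul (n : ℕ) (c : ℚ) (x : g) (k : CESp n g) :
    diagAct n (c • x) k = c • diagAct n x k := by
  induction k using TensorProduct.induction_on with
  | zero => simp
  | add a b h h' => simp only [map_add, h, h', smul_add]
  | tmul z ω =>
    simp only [diagAct_tmul, map_smul, LinearMap.smul_apply, extAct_smul, TensorProduct.tmul_smul,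
      TensorProduct.smul_tmul', smul_add]

lemma diagAct_lie (n : ℕ) (x y : g) (k : CESp n g) :
    diagAct n ⁅x, y⁆ k = diagAct n y (diagAct n x k) - diagAct n x (diagAct n y k) := by
  induction k using TensorProduct.induction_on with
  | zero => simp
  | add a b h h' => simp only [map_add, h, h']; abel
  | tmul z ω =>
    simp only [diagAct_tmul, map_add, extAct_lie, adAct_lie, TensorProduct.tmul_sub,
      TensorProduct.sub_tmul]
    abel

/-- The auxiliary recursion defining the differential `ceD`. -/
def ceDAux (n : ℕ) : ExteriorAlgebra ℚ g →ₗ[ℚ] TPow n g →ₗ[ℚ] CESp n g :=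
  CliffordAlgebra.foldr' (0 : QuadraticForm ℚ g)
    (LinearMap.mk₂ ℚ
      (fun (u : g) (p : ExteriorAlgebra ℚ g × (TPow n g →ₗ[ℚ] CESp n g)) =>
        diagAct n u ∘ₗ (TensorProduct.mk ℚ (TPow n g) (ExteriorAlgebra ℚ g)).flip p.1 -
          wedge n u ∘ₗ p.2)
      (by
        intros; ext1; apply MultilinearMap.ext; intro
        simp [diagAct_add, wedge_add, -diagAct_tmul]; abel)
      (by
        intros; ext1; apply MultilinearMap.ext; intro
        simp [diagAct_smul, wedge_smul, smul_sub, -diagAct_tmul])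
      (by
        intros; ext1; apply MultilinearMap.ext; intro
        simp [-diagAct_tmul]; abel)
      (by
        intros; ext1; apply MultilinearMap.ext; intro
        simp [-diagAct_tmul, smul_sub]))
    (by
      intro u ω h
      refine LinearMap.ext fun z => ?_
      change diagAct n u (wedge n u (z ⊗ₜ ω)) - wedge n u (diagAct n u (z ⊗ₜ ω) -
        wedge n u (h z)) = _
      rw [diagAct_wedge, map_sub, wedge_self, lie_self]
      have h0 : wedge n (0 : g) (z ⊗ₜ[ℚ] ω) = 0 := by simp
      rw [h0]
      simp)
    0

lemma ceDAux_ι_mul (n : ℕ) (x : g) (ω : ExteriorAlgebra ℚ g) :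
    ceDAux n (ExteriorAlgebra.ι ℚ x * ω) =
      diagAct n x ∘ₗ (TensorProduct.mk ℚ (TPow n g) (ExteriorAlgebra ℚ g)).flip ω -
        wedge n x ∘ₗ ceDAux n ω :=
  CliffordAlgebra.foldr'_ι_mul _ _ _ _ _ _

/-- The Chevalley–Eilenberg differential on `g^{⊗ n} ⊗ Λ^* g`, where `g^{⊗ n}` is the right
`g`-module given by the tensor power of the right adjoint representation.  It is the linear map
determined by `d (z ⊗ 1) = 0` and `d (x ∧ k) = k · x - x ∧ d k`, where `k · x` is the right adjoint
action on `g^{⊗ n} ⊗ Λ^* g`. -/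
def ceD (n : ℕ) : CESp n g →ₗ[ℚ] CESp n g := TensorProduct.lift (ceDAux n).flip

lemma ceD_one (n : ℕ) (z : TPow n g) : ceD n (z ⊗ₜ 1) = 0 := by
  rw [ceD, TensorProduct.lift.tmul, LinearMap.flip_apply, ceDAux,
    ← map_one (algebraMap ℚ (ExteriorAlgebra ℚ g)), CliffordAlgebra.foldr'_algebraMap]
  simp

lemma ceD_wedge (n : ℕ) (x : g) (k : CESp n g) :
    ceD n (wedge n x k) = diagAct n x k - wedge n x (ceD n k) := by
  induction k using TensorProduct.induction_on with
  | zero => simp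
  | add a b h h' => simp only [map_add, h, h']; abel
  | tmul z ω =>
    exact DFunLike.congr_fun (ceDAux_ι_mul n x ω) z

/-- The differential in degree one. -/
lemma ceD_deg_one (n : ℕ) (z : TPow n g) (x : g) :
    ceD n (z ⊗ₜ ExteriorAlgebra.ι ℚ x) = adAct n x z ⊗ₜ 1 := by
  have h := ceD_wedge n x (z ⊗ₜ 1)
  rw [ceD_one] at h
  simpa using h

/-- The differential in degree two. -/
lemma ceD_deg_two (n : ℕ) (z : TPow n g) (x y : g) :
    ceD n (z ⊗ₜ (ExteriorAlgebra.ι ℚ x * ExteriorAlgebra.ι ℚ y)) =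
      adAct n x z ⊗ₜ ExteriorAlgebra.ι ℚ y - adAct n y z ⊗ₜ ExteriorAlgebra.ι ℚ x -
        z ⊗ₜ ExteriorAlgebra.ι ℚ ⁅x, y⁆ := by
  have h := ceD_wedge n x (z ⊗ₜ ExteriorAlgebra.ι ℚ y)
  have h2 := extAct_ι_mul x y 1
  rw [mul_one, mul_one, extAct_one, mul_zero, add_zero] at h2
  rw [ceD_deg_one, wedge_tmul, wedge_tmul, diagAct_tmul, mul_one, h2, ← lie_skew y x, map_neg,
    TensorProduct.tmul_neg] at h
  rw [h]; abel

lemma ceD_diagAct (n : ℕ) (x : g) (k : CESp n g) :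
    ceD n (diagAct n x k) = diagAct n x (ceD n k) := by
  induction k using ce_induction with
  | ha a b h h' => simp only [map_add, h, h']
  | h1 z => simp [ceD_one]
  | hw u k h =>
    rw [diagAct_wedge, map_add, ceD_wedge, ceD_wedge, ceD_wedge, h, map_sub, diagAct_wedge,
      diagAct_lie]
    abel

lemma ceD_ceD (n : ℕ) (k : CESp n g) : ceD n (ceD n k) = 0 := by
  induction k using ce_induction with
  | ha a b h h' => simp only [map_add, h, h', add_zero]
  | h1 z => simp [ceD_one]
  | hw u k h => rw [ceD_wedge, map_sub, ceD_wedge, ceD_diagAct, h, map_zero, sub_zero, sub_self]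

lemma extAct_map (h : g →ₗ⁅ℚ⁆ g') (x : g) (ω : ExteriorAlgebra ℚ g) :
    ExteriorAlgebra.map h.toLinearMap (extAct x ω) =
      extAct (h x) (ExteriorAlgebra.map h.toLinearMap ω) := by
  induction ω using ext_induction with
  | hs r ω h => simp only [map_smul, h]
  | h1 => simp
  | ha a b ha hb => simp only [map_add, ha, hb]
  | hm u ω ih =>
    simp only [extAct_ι_mul, map_add, map_mul, ExteriorAlgebra.map_apply_ι, ih]
    simp

lemma ceMap_wedge (n : ℕ) (h : g →ₗ⁅ℚ⁆ g') (x : g) (k : CESp n g) :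
    ceMap n h (wedge n x k) = wedge n (h x) (ceMap n h k) := by
  induction k using TensorProduct.induction_on with
  | zero => simp
  | add a b h h' => simp only [map_add, h, h']
  | tmul z ω => simp

lemma ceMap_diagAct (n : ℕ) (h : g →ₗ⁅ℚ⁆ g') (x : g) (k : CESp n g) :
    ceMap n h (diagAct n x k) = diagAct n (h x) (ceMap n h k) := by
  induction k using TensorProduct.induction_on with
  | zero => simp
  | add a b h h' => simp only [map_add, h, h']
  | tmul z ω => simp [adAct_map, extAct_map]

lemma ceMap_ceD (n : ℕ) (h : g →ₗ⁅ℚ⁆ g') (k : CESp n g) :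
    ceMap n h (ceD n k) = ceD n (ceMap n h k) := by
  induction k using ce_induction with
  | ha a b h h' => simp only [map_add, h, h']
  | h1 z => simp [ceD_one]
  | hw u k ih => rw [ceD_wedge, map_sub, ceMap_wedge, ceMap_wedge, ceD_wedge, ceMap_diagAct, ih]

lemma ceMap_comp (n : ℕ) (h : g →ₗ⁅ℚ⁆ g') (h' : g' →ₗ⁅ℚ⁆ g'') (k : CESp n g) :
    ceMap n h' (ceMap n h k) = ceMap n (h'.comp h) k := by
  induction k using ce_induction with
  | ha a b h h' => simp only [map_add, h, h']
  | h1 z => simp [tpMap_comp]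
  | hw u k ih => simp only [ceMap_wedge, ih]; rfl

end TensorPowers

section Evaluation

variable {A g g' : Type} [LieRing g'] [LieAlgebra ℚ g'] [LieRing g] [LieAlgebra ℚ g]

/-- The morphism from the free Lie algebra which sends the letter `a` to `v a`. -/
def ev (v : A → g) : FreeLieAlgebra ℚ A →ₗ⁅ℚ⁆ g := FreeLieAlgebra.lift ℚ v

@[simp] lemma ev_of (v : A → g) (a : A) : ev v (FreeLieAlgebra.of ℚ a) = v a :=
  FreeLieAlgebra.lift_of_apply _ _

lemma comp_ev (h : g →ₗ⁅ℚ⁆ g') (v : A → g) : h.comp (ev v) = ev (fun a => h (v a)) :=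
  FreeLieAlgebra.hom_ext (fun a => by simp)

lemma ev_self : ev (FreeLieAlgebra.of ℚ : A → _) = LieHom.id :=
  FreeLieAlgebra.hom_ext (fun a => by simp)

end Evaluation

section MultilinearParts

open Finset

/-- `LieMon S x`: the element `x` of the free Lie algebra on the alphabet `A` is a bracket monomial
in which each letter of `S` occurs exactly once, and no other letter occurs. -/
inductive LieMon {A : Type} [DecidableEq A] : Finset A → FreeLieAlgebra ℚ A → Prop
  | of (a : A) : LieMon {a} (FreeLieAlgebra.of ℚ a)
  | lie {S T : Finset A} {x y : FreeLieAlgebra ℚ A} (hx : LieMon S x) (hy : LieMon T y)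
      (h : Disjoint S T) : LieMon (S ∪ T) ⁅x, y⁆

/-- The value `𝔏𝔦𝔢(S)` of the Lie operad on a finite set `S` of letters: the multilinear part (every
letter of `S` occurs exactly once) of the free Lie algebra on `S`, seen inside the free Lie algebra
on a larger alphabet `A`.  It vanishes for `S = ∅`. -/
def lieOp {A : Type} [DecidableEq A] (S : Finset A) : Submodule ℚ (FreeLieAlgebra ℚ A) :=
  Submodule.span ℚ {x | LieMon S x}

/-- `B` is an ordered partition of `S` into (possibly empty) blocks `B i`.  Such data amounts to a map
`f` from `S` to the index set, with `B i = f⁻¹(i)`. -/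
structure IsPart {ι A : Type} [Fintype ι] [DecidableEq A] (B : ι → Finset A) (S : Finset A) :
    Prop where
  disj : ∀ i j, i ≠ j → Disjoint (B i) (B j)
  cover : Finset.univ.biUnion B = S

/-- `⨁_f ⨂ᵢ 𝔏𝔦𝔢(f⁻¹(i))`, the sum being over the maps `f : S → {1, …, n}` (only surjections
contribute, since `𝔏𝔦𝔢(∅) = 0`), realized as the multilinear part with respect to `S` of the `n`-th
tensor power of the free Lie algebra.  For `S` the whole alphabet `{1, …, m}` these are the morphisms
`m ⟶ n` of the PROP associated with the Lie operad. -/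
def catLieSub {A : Type} [DecidableEq A] (n : ℕ) (S : Finset A) :
    Submodule ℚ (TPow n (FreeLieAlgebra ℚ A)) :=
  Submodule.span ℚ {z | ∃ B : Fin n → Finset A, IsPart B S ∧ ∃ w : Fin n → FreeLieAlgebra ℚ A,
    (∀ i, w i ∈ lieOp (B i)) ∧ z = PiTensorProduct.tprod ℚ w}

/-- `(Λ^t 𝔏𝔦𝔢)(S)`: the exterior power is formed with respect to the convolution product, and is
realized as the multilinear part with respect to `S` of the exterior power `Λ^t` of the free Lie
algebra. -/
def extLieSub {A : Type} [DecidableEq A] (t : ℕ) (S : Finset A) :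
    Submodule ℚ (ExteriorAlgebra ℚ (FreeLieAlgebra ℚ A)) :=
  Submodule.span ℚ {ω | ∃ B : Fin t → Finset A, IsPart B S ∧ ∃ u : Fin t → FreeLieAlgebra ℚ A,
    (∀ i, u i ∈ lieOp (B i)) ∧ ω = ExteriorAlgebra.ιMulti ℚ t u}

/-- `(𝐂𝐚𝐭𝔏𝔦𝔢(-, n) ⊙ Λ^t 𝔏𝔦𝔢)(S) = ⨁_{S₁ ⨿ S₂ = S} 𝐂𝐚𝐭𝔏𝔦𝔢(S₁, n) ⊗ (Λ^t 𝔏𝔦𝔢)(S₂)`, the degree `t` term of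
the universal Chevalley–Eilenberg complex, realized as the multilinear part with respect to `S` of
`L^{⊗ n} ⊗ Λ^t L` for `L` the free Lie algebra. -/
def ceSub {A : Type} [DecidableEq A] (t n : ℕ) (S : Finset A) :
    Submodule ℚ (CESp n (FreeLieAlgebra ℚ A)) :=
  Submodule.span ℚ {k | ∃ S₁ S₂ : Finset A, Disjoint S₁ S₂ ∧ S₁ ∪ S₂ = S ∧
    ∃ z ∈ catLieSub n S₁, ∃ ω ∈ extLieSub t S₂, k = z ⊗ₜ ω}

/-- The part of `⨁_f ⨂_{i ≤ n+1} 𝔏𝔦𝔢(f⁻¹(i))` given by the `f` such that `f⁻¹(n+1)` has exactly one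
element. -/
def deltaOneSub {A : Type} [DecidableEq A] (n : ℕ) (S : Finset A) :
    Submodule ℚ (TPow (n + 1) (FreeLieAlgebra ℚ A)) :=
  Submodule.span ℚ {z | ∃ B : Fin (n + 1) → Finset A, IsPart B S ∧ (B (Fin.last n)).card = 1 ∧
    ∃ w : Fin (n + 1) → FreeLieAlgebra ℚ A,
      (∀ i, w i ∈ lieOp (B i)) ∧ z = PiTensorProduct.tprod ℚ w}

variable {A A' : Type} [DecidableEq A] [DecidableEq A']
variable {g g' : Type} [LieRing g'] [LieAlgebra ℚ g'] [LieRing g] [LieAlgebra ℚ g]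

lemma deltaOneSub_le (n : ℕ) (S : Finset A) : deltaOneSub n S ≤ catLieSub (n + 1) S :=
  Submodule.span_mono fun _ ⟨B, hB, _, w, hw, hz⟩ => ⟨B, hB, w, hw, hz⟩

section Partitions

variable {ι : Type} [Fintype ι]

lemma IsPart.mem {B : ι → Finset A} {S : Finset A} (h : IsPart B S) (a : A) :
    a ∈ S ↔ ∃ i, a ∈ B i := by
  rw [← h.cover]; simp

lemma IsPart.eq {B : ι → Finset A} {S : Finset A} (h : IsPart B S) {a : A} {i j : ι}
    (hi : a ∈ B i) (hj : a ∈ B j) : i = j := by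
  by_contra hne
  exact Finset.disjoint_left.1 (h.disj i j hne) hi hj

lemma isPart_iff {B : ι → Finset A} {S : Finset A} :
    IsPart B S ↔ (∀ a, a ∈ S ↔ ∃ i, a ∈ B i) ∧ ∀ i j a, a ∈ B i → a ∈ B j → i = j := by
  refine ⟨fun h => ⟨h.mem, fun i j a => h.eq⟩, fun h => ⟨fun i j hij => ?_, ?_⟩⟩
  · exact Finset.disjoint_left.2 fun a ha hb => hij (h.2 i j a ha hb)
  · ext a; simp [h.1 a]

lemma IsPart.update [DecidableEq ι] {B : ι → Finset A} {S T : Finset A} (h : IsPart B S)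
    (hST : Disjoint S T) (i : ι) : IsPart (Function.update B i (B i ∪ T)) (S ∪ T) := by
  rw [isPart_iff] at h ⊢
  have hd : ∀ j a, a ∈ Function.update B i (B i ∪ T) j ↔ a ∈ B j ∨ (j = i ∧ a ∈ T) := by
    intro j a
    rcases eq_or_ne j i with rfl | hj
    · simp
    · simp [hj]
  rw [Finset.disjoint_left] at hST
  refine ⟨fun a => ?_, fun j k a => ?_⟩
  · simp only [hd, Finset.mem_union, h.1 a]
    grind
  · simp only [hd]
    have := h.2 j k a
    have h1 := h.1 a
    grind

lemma IsPart.biUnion {B : ι → Finset A} {S : Finset A} (h : IsPart B S) {C : A → Finset A'}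
    (hC : ∀ a b, a ≠ b → Disjoint (C a) (C b)) :
    IsPart (fun i => (B i).biUnion C) (S.biUnion C) := by
  rw [isPart_iff] at h ⊢
  refine ⟨fun a => ?_, fun j k a => ?_⟩
  · simp only [Finset.mem_biUnion, h.1]
    grind
  · simp only [Finset.mem_biUnion]
    rintro ⟨b, hb, hab⟩ ⟨c, hc, hac⟩
    by_cases hbc : b = c
    · subst hbc; exact h.2 j k b hb hc
    · exact absurd hac (Finset.disjoint_left.1 (hC b c hbc) hab)

lemma disjoint_biUnion' {S T : Finset A} (h : Disjoint S T) {C : A → Finset A'}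
    (hC : ∀ a b, a ≠ b → Disjoint (C a) (C b)) : Disjoint (S.biUnion C) (T.biUnion C) := by
  rw [Finset.disjoint_left] at h ⊢
  simp only [Finset.mem_biUnion]
  rintro a ⟨b, hb, hab⟩ ⟨c, hc, hac⟩
  by_cases hbc : b = c
  · subst hbc; exact h hb hc
  · exact absurd hac (Finset.disjoint_left.1 (hC b c hbc) hab)

end Partitions

/-! ### Evaluation of multilinear elements -/

/-- `Φ` is linear in each of the variables indexed by `S` and independent of the others. -/
structure MLOn {Y : Type} [AddCommGroup Y] [Module ℚ Y] (S : Finset A) (Φ : (A → g) → Y) :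
    Prop where
  add : ∀ v, ∀ a ∈ S, ∀ x y, Φ (Function.update v a (x + y)) =
    Φ (Function.update v a x) + Φ (Function.update v a y)
  smul : ∀ v, ∀ a ∈ S, ∀ (c : ℚ) x, Φ (Function.update v a (c • x)) =
    c • Φ (Function.update v a x)
  const : ∀ v, ∀ a ∉ S, ∀ x, Φ (Function.update v a x) = Φ v

section MLOn

variable {X Y Z : Type} [AddCommGroup X] [Module ℚ X] [AddCommGroup Y] [Module ℚ Y]
  [AddCommGroup Z] [Module ℚ Z]

lemma MLOn.bilin {S T : Finset A} (hST : Disjoint S T) (b : X →ₗ[ℚ] Y →ₗ[ℚ] Z)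
    {Φ : (A → g) → X} {Ψ : (A → g) → Y} (hΦ : MLOn S Φ) (hΨ : MLOn T Ψ) :
    MLOn (S ∪ T) (fun v => b (Φ v) (Ψ v)) := by
  rw [Finset.disjoint_left] at hST
  refine ⟨fun v a ha x y => ?_, fun v a ha c x => ?_, fun v a ha x => ?_⟩
  · rcases Finset.mem_union.1 ha with h | h
    · simp only [hΦ.add v a h, hΨ.const v a (hST h), map_add, LinearMap.add_apply]
    · have h' : a ∉ S := fun h' => hST h' h
      simp only [hΨ.add v a h, hΦ.const v a h', map_add]
  · rcases Finset.mem_union.1 ha with h | h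
    · simp only [hΦ.smul v a h, hΨ.const v a (hST h), map_smul, LinearMap.smul_apply]
    · have h' : a ∉ S := fun h' => hST h' h
      simp only [hΨ.smul v a h, hΦ.const v a h', map_smul]
  · rw [Finset.mem_union, not_or] at ha
    simp only [hΦ.const v a ha.1, hΨ.const v a ha.2]

lemma MLOn.multi {ι : Type} [Fintype ι] [DecidableEq ι] {B : ι → Finset A} {S : Finset A}
    (hB : IsPart B S) (F : MultilinearMap ℚ (fun _ : ι => X) Y) {Φ : ι → (A → g) → X}
    (hΦ : ∀ i, MLOn (B i) (Φ i)) : MLOn S (fun v => F (fun i => Φ i v)) := by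
  have key : ∀ v a i x, a ∈ B i → (fun j => Φ j (Function.update v a x)) =
      Function.update (fun j => Φ j v) i (Φ i (Function.update v a x)) := by
    intro v a i x ha
    funext j
    rcases eq_or_ne j i with rfl | hj
    · simp
    · simp only [Function.update_of_ne hj]
      exact (hΦ j).const v a (fun h => hj (hB.eq h ha)) x
  refine ⟨fun v a ha x y => ?_, fun v a ha c x => ?_, fun v a ha x => ?_⟩
  · obtain ⟨i, hi⟩ := (hB.mem a).1 ha
    simp only [key v a i _ hi, (hΦ i).add v a hi, F.map_update_add]
  · obtain ⟨i, hi⟩ := (hB.mem a).1 ha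
    simp only [key v a i _ hi, (hΦ i).smul v a hi, F.map_update_smul]
  · congr 1
    funext j
    exact (hΦ j).const v a (fun h => ha ((hB.mem a).2 ⟨j, h⟩)) x

lemma MLOn.zero (S : Finset A) : MLOn S (fun _ : A → g => (0 : Y)) :=
  ⟨by simp, by simp, by simp⟩

lemma MLOn.of_span {S : Finset A} {s : Set X} {Φ : (A → g) → X →ₗ[ℚ] Y}
    (h : ∀ ξ ∈ s, MLOn S (fun v => Φ v ξ)) {ξ : X} (hξ : ξ ∈ Submodule.span ℚ s) :
    MLOn S (fun v => Φ v ξ) := by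
  induction hξ using Submodule.span_induction with
  | mem ξ hξ => exact h ξ hξ
  | zero => simpa using MLOn.zero (g := g) (Y := Y) S
  | add ξ η _ _ h1 h2 =>
    refine ⟨fun v a ha x y => ?_, fun v a ha c x => ?_, fun v a ha x => ?_⟩
    · simp only [map_add, h1.add v a ha, h2.add v a ha]; abel
    · simp only [map_add, h1.smul v a ha, h2.smul v a ha, smul_add]
    · simp only [map_add, h1.const v a ha, h2.const v a ha]
  | smul r ξ _ h1 =>
    refine ⟨fun v a ha x y => ?_, fun v a ha c x => ?_, fun v a ha x => ?_⟩
    · simp only [map_smul, h1.add v a ha, smul_add]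
    · simp only [map_smul, h1.smul v a ha, smul_comm r c]
    · simp only [map_smul, h1.const v a ha]

lemma mlOn_lieOp {S : Finset A} {w : FreeLieAlgebra ℚ A} (hw : w ∈ lieOp S) :
    MLOn S (fun v : A → g => ev v w) := by
  refine MLOn.of_span (Φ := fun v : A → g => (ev v).toLinearMap) (fun ξ hξ => ?_) hw
  clear hw
  change LieMon S ξ at hξ
  induction hξ with
  | of a =>
    refine ⟨fun v b hb x y => ?_, fun v b hb c x => ?_, fun v b hb x => ?_⟩
    · obtain rfl := Finset.mem_singleton.1 hb; simp
    · obtain rfl := Finset.mem_singleton.1 hb; simp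
    · have : a ≠ b := fun h => hb (by simp [h])
      simp [this]
  | lie hx hy h hx' hy' =>
    have := MLOn.bilin h (LieModule.toEnd ℚ g g : g →ₗ[ℚ] Module.End ℚ g) hx' hy'
    simpa using this

lemma mlOn_catLieSub (n : ℕ) {S : Finset A} {ξ : TPow n (FreeLieAlgebra ℚ A)}
    (hξ : ξ ∈ catLieSub n S) : MLOn S (fun v : A → g => tpMap n (ev v) ξ) := by
  refine MLOn.of_span (Φ := fun v : A → g => tpMap n (ev v)) ?_ hξ
  rintro _ ⟨B, hB, w, hw, rfl⟩
  simp only [tpMap_tprod]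
  exact MLOn.multi hB (PiTensorProduct.tprod ℚ) (fun i => mlOn_lieOp (hw i))

lemma mlOn_ceSub (t n : ℕ) {S : Finset A} {ξ : CESp n (FreeLieAlgebra ℚ A)}
    (hξ : ξ ∈ ceSub t n S) : MLOn S (fun v : A → g => ceMap n (ev v) ξ) := by
  refine MLOn.of_span (Φ := fun v : A → g => ceMap n (ev v)) ?_ hξ
  rintro _ ⟨S₁, S₂, hd, rfl, z, hz, ω, hω, rfl⟩
  simp only [ceMap_tmul]
  refine MLOn.bilin hd (TensorProduct.mk ℚ (TPow n g) (ExteriorAlgebra ℚ g)) (mlOn_catLieSub n hz) ?_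
  refine MLOn.of_span (Φ := fun v : A → g => (ExteriorAlgebra.map (ev v).toLinearMap).toLinearMap)
    ?_ hω
  rintro _ ⟨B, hB, u, hu, rfl⟩
  simp only [AlgHom.toLinearMap_apply, ExteriorAlgebra.map_apply_ιMulti]
  exact MLOn.multi hB (ExteriorAlgebra.ιMulti ℚ t).toMultilinearMap (fun i => mlOn_lieOp (hu i))

/-- Linearized substitution: if `v ↦ Φ v ξ` is multilinear for all `ξ` in `P`, this is the bilinear map
`P × g^{⊗ m} → Y` which sends `(ξ, v₁ ⊗ ⋯ ⊗ vₘ)` to `Φ v ξ`. -/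
def substGen {m : ℕ} (P : Submodule ℚ X) (Φ : (Fin m → g) → X →ₗ[ℚ] Y)
    (h : ∀ ξ ∈ P, MLOn Finset.univ (fun v => Φ v ξ)) : P →ₗ[ℚ] TPow m g →ₗ[ℚ] Y where
  toFun ξ := PiTensorProduct.lift
    { toFun := fun v => Φ v ξ
      map_update_add' := by
        intro inst v i x y
        obtain rfl : inst = instDecidableEqFin m := Subsingleton.elim _ _
        exact (h ξ.1 ξ.2).add v i (Finset.mem_univ i) x y
      map_update_smul' := by
        intro inst v i c x
        obtain rfl : inst = instDecidableEqFin m := Subsingleton.elim _ _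
        exact (h ξ.1 ξ.2).smul v i (Finset.mem_univ i) c x }
  map_add' ξ η := PiTensorProduct.ext (MultilinearMap.ext fun v => by simp)
  map_smul' c ξ := PiTensorProduct.ext (MultilinearMap.ext fun v => by simp)

@[simp] lemma substGen_tprod {m : ℕ} (P : Submodule ℚ X) (Φ : (Fin m → g) → X →ₗ[ℚ] Y)
    (h : ∀ ξ ∈ P, MLOn Finset.univ (fun v => Φ v ξ)) (ξ : P) (v : Fin m → g) :
    substGen P Φ h ξ (PiTensorProduct.tprod ℚ v) = Φ v ξ :=
  PiTensorProduct.lift.tprod _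

end MLOn

end MultilinearParts


section Closure

open Finset

variable {A A' : Type} [DecidableEq A] [DecidableEq A']
variable {g g' : Type} [LieRing g'] [LieAlgebra ℚ g'] [LieRing g] [LieAlgebra ℚ g]

lemma lie_mem_lieOp {S T : Finset A} (h : Disjoint S T) {x y : FreeLieAlgebra ℚ A}
    (hx : x ∈ lieOp S) (hy : y ∈ lieOp T) : ⁅x, y⁆ ∈ lieOp (S ∪ T) := by
  induction hx using Submodule.span_induction with
  | zero => simp
  | add a b _ _ ha hb => rw [add_lie]; exact add_mem ha hb
  | smul r a _ ha => rw [smul_lie]; exact Submodule.smul_mem _ r ha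
  | mem x hx =>
    induction hy using Submodule.span_induction with
    | zero => simp
    | add a b _ _ ha hb => rw [lie_add]; exact add_mem ha hb
    | smul r a _ ha => rw [lie_smul]; exact Submodule.smul_mem _ r ha
    | mem y hy => exact Submodule.subset_span (LieMon.lie hx hy h)

lemma of_mem_lieOp (a : A) : FreeLieAlgebra.of ℚ a ∈ lieOp ({a} : Finset A) :=
  Submodule.subset_span (LieMon.of a)

lemma LieMon.nonempty {S : Finset A} {x : FreeLieAlgebra ℚ A} (h : LieMon S x) : S.Nonempty := by
  induction h with
  | of a => simp
  | lie _ _ _ h _ => exact h.mono subset_union_left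

lemma LieMon.eq_of {S : Finset A} {x : FreeLieAlgebra ℚ A} (h : LieMon S x) (hS : S.card = 1) :
    ∃ a, S = {a} ∧ x = FreeLieAlgebra.of ℚ a := by
  cases h with
  | of a => exact ⟨a, rfl, rfl⟩
  | lie hx hy h =>
    have h1 := hx.nonempty.card_pos
    have h2 := hy.nonempty.card_pos
    rw [card_union_of_disjoint h] at hS
    omega

lemma ev_mem {C : A → Finset A'} (hC : ∀ a b, a ≠ b → Disjoint (C a) (C b))
    {v : A → FreeLieAlgebra ℚ A'} (hv : ∀ a, v a ∈ lieOp (C a)) {S : Finset A}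
    {w : FreeLieAlgebra ℚ A} (hw : w ∈ lieOp S) : ev v w ∈ lieOp (S.biUnion C) := by
  induction hw using Submodule.span_induction with
  | zero => simp
  | add a b _ _ ha hb => rw [map_add]; exact add_mem ha hb
  | smul r a _ ha => rw [map_smul]; exact Submodule.smul_mem _ r ha
  | mem x hx =>
    change LieMon S x at hx
    induction hx with
    | of a => simpa using hv a
    | lie _ _ h hx hy =>
      rw [union_biUnion, LieHom.map_lie]
      exact lie_mem_lieOp (disjoint_biUnion' h hC) hx hy

lemma tpMap_ev_mem (n : ℕ) {C : A → Finset A'} (hC : ∀ a b, a ≠ b → Disjoint (C a) (C b))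
    {v : A → FreeLieAlgebra ℚ A'} (hv : ∀ a, v a ∈ lieOp (C a)) {S : Finset A}
    {z : TPow n (FreeLieAlgebra ℚ A)} (hz : z ∈ catLieSub n S) :
    tpMap n (ev v) z ∈ catLieSub n (S.biUnion C) := by
  induction hz using Submodule.span_induction with
  | zero => simp
  | add a b _ _ ha hb => rw [map_add]; exact add_mem ha hb
  | smul r a _ ha => rw [map_smul]; exact Submodule.smul_mem _ r ha
  | mem z hz =>
    obtain ⟨B, hB, w, hw, rfl⟩ := hz
    rw [tpMap_tprod]
    exact Submodule.subset_span ⟨_, hB.biUnion hC, _, fun i => ev_mem hC hv (hw i), rfl⟩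

lemma ext_ev_mem (t : ℕ) {C : A → Finset A'} (hC : ∀ a b, a ≠ b → Disjoint (C a) (C b))
    {v : A → FreeLieAlgebra ℚ A'} (hv : ∀ a, v a ∈ lieOp (C a)) {S : Finset A}
    {ω : ExteriorAlgebra ℚ (FreeLieAlgebra ℚ A)} (hω : ω ∈ extLieSub t S) :
    ExteriorAlgebra.map (ev v).toLinearMap ω ∈ extLieSub t (S.biUnion C) := by
  induction hω using Submodule.span_induction with
  | zero => simp
  | add a b _ _ ha hb => rw [map_add]; exact add_mem ha hb
  | smul r a _ ha => rw [map_smul]; exact Submodule.smul_mem _ r ha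
  | mem z hz =>
    obtain ⟨B, hB, w, hw, rfl⟩ := hz
    rw [ExteriorAlgebra.map_apply_ιMulti]
    exact Submodule.subset_span ⟨_, hB.biUnion hC, _, fun i => ev_mem hC hv (hw i), rfl⟩

lemma tmul_mem_ceSub {t n : ℕ} {S T : Finset A} (h : Disjoint S T)
    {z : TPow n (FreeLieAlgebra ℚ A)} (hz : z ∈ catLieSub n S)
    {ω : ExteriorAlgebra ℚ (FreeLieAlgebra ℚ A)} (hω : ω ∈ extLieSub t T) :
    z ⊗ₜ ω ∈ ceSub t n (S ∪ T) :=
  Submodule.subset_span ⟨S, T, h, rfl, z, hz, ω, hω, rfl⟩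

lemma ceMap_ev_mem (t n : ℕ) {C : A → Finset A'} (hC : ∀ a b, a ≠ b → Disjoint (C a) (C b))
    {v : A → FreeLieAlgebra ℚ A'} (hv : ∀ a, v a ∈ lieOp (C a)) {S : Finset A}
    {k : CESp n (FreeLieAlgebra ℚ A)} (hk : k ∈ ceSub t n S) :
    ceMap n (ev v) k ∈ ceSub t n (S.biUnion C) := by
  induction hk using Submodule.span_induction with
  | zero => simp
  | add a b _ _ ha hb => rw [map_add]; exact add_mem ha hb
  | smul r a _ ha => rw [map_smul]; exact Submodule.smul_mem _ r ha
  | mem z hz =>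
    obtain ⟨S₁, S₂, hd, rfl, z, hz, ω, hω, rfl⟩ := hz
    rw [ceMap_tmul, union_biUnion]
    exact tmul_mem_ceSub (disjoint_biUnion' hd hC) (tpMap_ev_mem n hC hv hz)
      (ext_ev_mem t hC hv hω)

/-! ### The PROP associated with the Lie operad -/

/-- The morphisms `m ⟶ n` of the PROP associated with the Lie operad. -/
abbrev CL (m n : ℕ) : Type := ↥(catLieSub n (Finset.univ : Finset (Fin m)))

/-- The operation `g^{⊗ m} → g^{⊗ n}`, on any Lie algebra `g`, given by a morphism `ψ : m ⟶ n` of the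
PROP: `v₁ ⊗ ⋯ ⊗ vₘ` is sent to the result of the substitution of `v₁, …, vₘ` for the letters
of `ψ`. -/
def act {m n : ℕ} : CL m n →ₗ[ℚ] TPow m g →ₗ[ℚ] TPow n g :=
  substGen _ (fun v => tpMap n (ev v)) (fun _ h => mlOn_catLieSub n h)

@[simp] lemma act_tprod {m n : ℕ} (ψ : CL m n) (v : Fin m → g) :
    act ψ (PiTensorProduct.tprod ℚ v) = tpMap n (ev v) ψ.1 := substGen_tprod _ _ _ _ _

lemma act_map {m n : ℕ} (ψ : CL m n) (h : g →ₗ⁅ℚ⁆ g') (z : TPow m g) :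
    tpMap n h (act ψ z) = act ψ (tpMap m h z) := by
  have : tpMap n h ∘ₗ act ψ = act ψ ∘ₗ tpMap m h := by
    refine PiTensorProduct.ext (MultilinearMap.ext fun v => ?_)
    simp [tpMap_comp, comp_ev]
  exact DFunLike.congr_fun this z

lemma act_mem {m n : ℕ} (ψ : CL m n) {S : Finset A} {z : TPow m (FreeLieAlgebra ℚ A)}
    (hz : z ∈ catLieSub m S) : act ψ z ∈ catLieSub n S := by
  induction hz using Submodule.span_induction with
  | zero => simp
  | add a b _ _ ha hb => rw [map_add]; exact add_mem ha hb
  | smul r a _ ha => rw [map_smul]; exact Submodule.smul_mem _ r ha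
  | mem z hz =>
    obtain ⟨B, hB, w, hw, rfl⟩ := hz
    rw [act_tprod, ← hB.cover]
    exact tpMap_ev_mem n hB.disj hw ψ.2

/-- Composition in the PROP: the components of `φ` are substituted for the letters of `ψ`. -/
def compCL {m n p : ℕ} (φ : CL m n) (ψ : CL n p) : CL m p := ⟨act ψ φ.1, act_mem ψ φ.2⟩

/-- The identity morphism `x₁ ⊗ ⋯ ⊗ xₙ`. -/
def idCL (n : ℕ) : CL n n :=
  ⟨PiTensorProduct.tprod ℚ (FreeLieAlgebra.of ℚ), Submodule.subset_span
    ⟨fun i => {i}, ⟨fun i j h => by simpa using h, by ext; simp⟩, _, fun i => of_mem_lieOp i, rfl⟩⟩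

lemma tpMap_id (n : ℕ) (z : TPow n g) : tpMap n (LieHom.id : g →ₗ⁅ℚ⁆ g) z = z := by
  have : tpMap n (LieHom.id : g →ₗ⁅ℚ⁆ g) = LinearMap.id :=
    PiTensorProduct.ext (MultilinearMap.ext fun v => by simp)
  rw [this]; rfl

lemma ceMap_id (n : ℕ) (k : CESp n g) : ceMap n (LieHom.id : g →ₗ⁅ℚ⁆ g) k = k := by
  induction k using ce_induction with
  | ha a b h h' => simp only [map_add, h, h']
  | h1 z => simp [tpMap_id]
  | hw u k ih => rw [ceMap_wedge, ih]; rfl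

lemma act_idCL (n : ℕ) (z : TPow n g) : act (idCL n) z = z := by
  have : act (g := g) (idCL n) = LinearMap.id := by
    refine PiTensorProduct.ext (MultilinearMap.ext fun v => ?_)
    simp [idCL]
  rw [this]; rfl

lemma act_on_id {m n : ℕ} (ψ : CL m n) : act ψ (idCL m).1 = ψ.1 := by
  rw [idCL, act_tprod, ev_self, tpMap_id]

lemma act_compCL {m n p : ℕ} (φ : CL m n) (ψ : CL n p) (z : TPow m g) :
    act (compCL φ ψ) z = act ψ (act φ z) := by
  have : act (g := g) (compCL φ ψ) = act ψ ∘ₗ act φ := by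
    refine PiTensorProduct.ext (MultilinearMap.ext fun v => ?_)
    simp [compCL, act_map]
  rw [this]; rfl

/-- The objects of the PROP associated with the Lie operad are the natural numbers. -/
structure CatLie : Type where
  /-- the underlying natural number -/
  arity : ℕ

/-- The PROP associated with the Lie operad, as a category. -/
instance : Category CatLie where
  Hom m n := CL m.arity n.arity
  id n := idCL n.arity
  comp φ ψ := compCL φ ψ
  id_comp ψ := Subtype.ext (act_on_id ψ)
  comp_id φ := Subtype.ext (act_idCL _ φ.1)
  assoc φ ψ χ := Subtype.ext (act_compCL ψ χ φ.1).symm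

lemma compCL_add {m n p : ℕ} (φ : CL m n) (ψ ψ' : CL n p) :
    compCL φ (ψ + ψ') = compCL φ ψ + compCL φ ψ' :=
  Subtype.ext (LinearMap.congr_fun (map_add act ψ ψ') φ.1)

lemma compCL_smul {m n p : ℕ} (φ : CL m n) (r : ℚ) (ψ : CL n p) :
    compCL φ (r • ψ) = r • compCL φ ψ :=
  Subtype.ext (LinearMap.congr_fun (map_smul act r ψ) φ.1)

instance : Preadditive CatLie where
  homGroup m n := inferInstanceAs (AddCommGroup (CL m.arity n.arity))
  add_comp _ _ _ φ φ' ψ := Subtype.ext ((act ψ).map_add φ.1 φ'.1)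
  comp_add _ _ _ φ ψ ψ' := compCL_add φ ψ ψ'

instance : Linear ℚ CatLie where
  homModule m n := inferInstanceAs (Module ℚ (CL m.arity n.arity))
  smul_comp _ _ _ r φ ψ := Subtype.ext ((act ψ).map_smul r φ.1)
  comp_smul _ _ _ φ r ψ := compCL_smul φ r ψ

/-! ### Adjoint actions and multilinear parts -/

lemma ev_update_sum {S : Finset A} {w : FreeLieAlgebra ℚ A} (hw : w ∈ lieOp S) (v : A → g) (x : g) :
    ∑ a ∈ S, ev (Function.update v a ⁅v a, x⁆) w = ⁅ev v w, x⁆ := by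
  induction hw using Submodule.span_induction with
  | zero => simp
  | add a b _ _ ha hb => simp only [map_add, sum_add_distrib, ha, hb, add_lie]
  | smul r a _ ha => simp only [map_smul, ← smul_sum, ha, smul_lie]
  | mem w hw =>
    change LieMon S w at hw
    induction hw with
    | of a => simp
    | @lie S T p q hp hq h ihp ihq =>
      have hS : ∀ a ∈ S, ev (Function.update v a ⁅v a, x⁆) ⁅p, q⁆ =
          ⁅ev (Function.update v a ⁅v a, x⁆) p, ev v q⁆ := by
        intro a ha
        rw [LieHom.map_lie, (mlOn_lieOp (Submodule.subset_span hq)).const v a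
          (Finset.disjoint_left.1 h ha)]
      have hT : ∀ a ∈ T, ev (Function.update v a ⁅v a, x⁆) ⁅p, q⁆ =
          ⁅ev v p, ev (Function.update v a ⁅v a, x⁆) q⁆ := by
        intro a ha
        rw [LieHom.map_lie, (mlOn_lieOp (Submodule.subset_span hp)).const v a
          (Finset.disjoint_right.1 h ha)]
      rw [sum_union h, sum_congr rfl hS, sum_congr rfl hT, ← sum_lie, ← lie_sum, ihp, ihq,
        LieHom.map_lie, leibniz_lie (ev v p) (ev v q) x, ← lie_skew (ev v q) ⁅ev v p, x⁆]
      abel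

lemma act_adAct {m n : ℕ} (ψ : CL m n) (x : g) (z : TPow m g) :
    act ψ (adAct m x z) = adAct n x (act ψ z) := by
  have : act ψ ∘ₗ adAct m x = adAct n x ∘ₗ act (g := g) ψ := by
    refine PiTensorProduct.ext (MultilinearMap.ext fun v => ?_)
    simp only [LinearMap.compMultilinearMap_apply, LinearMap.comp_apply, adAct_tprod, map_sum,
      act_tprod]
    obtain ⟨ξ, hξ⟩ := ψ
    simp only
    induction hξ using Submodule.span_induction with
    | zero => simp
    | add a b _ _ ha hb => simp only [map_add, sum_add_distrib, ha, hb]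
    | smul r a _ ha => simp only [map_smul, ← smul_sum, ha]
    | mem ξ h =>
      obtain ⟨B, hB, w, hw, rfl⟩ := h
      simp only [tpMap_tprod, adAct_tprod]
      have key : ∀ i, ∀ a ∈ B i, PiTensorProduct.tprod ℚ
          (fun j => ev (Function.update v a ⁅v a, x⁆) (w j)) =
          PiTensorProduct.tprod ℚ (Function.update (fun j => ev v (w j)) i
            (ev (Function.update v a ⁅v a, x⁆) (w i))) := by
        intro i a ha
        congr 1
        funext j
        rcases eq_or_ne j i with rfl | hj
        · simp
        · simp only [Function.update_of_ne hj]
          exact (mlOn_lieOp (hw j)).const v a (fun h => hj (hB.eq h ha)) _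
      rw [← hB.cover, sum_biUnion (fun i _ j _ hij => hB.disj i j hij)]
      refine sum_congr rfl fun i _ => ?_
      rw [sum_congr rfl (key i), ← MultilinearMap.map_update_sum, ev_update_sum (hw i)]
  exact DFunLike.congr_fun this z

lemma adAct_mem {n : ℕ} {S T : Finset A} (h : Disjoint S T) {z : TPow n (FreeLieAlgebra ℚ A)}
    (hz : z ∈ catLieSub n S) {x : FreeLieAlgebra ℚ A} (hx : x ∈ lieOp T) :
    adAct n x z ∈ catLieSub n (S ∪ T) := by
  induction hz using Submodule.span_induction with
  | zero => simp
  | add a b _ _ ha hb => rw [map_add]; exact add_mem ha hb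
  | smul r a _ ha => rw [map_smul]; exact Submodule.smul_mem _ r ha
  | mem z hz =>
    obtain ⟨B, hB, w, hw, rfl⟩ := hz
    rw [adAct_tprod]
    refine sum_mem fun i _ => Submodule.subset_span ⟨_, hB.update h i, _, fun j => ?_, rfl⟩
    rcases eq_or_ne j i with rfl | hj
    · simp only [Function.update_self]
      exact lie_mem_lieOp (h.mono_left fun a ha => (hB.mem a).2 ⟨_, ha⟩) (hw _) hx
    · simp only [Function.update_of_ne hj]; exact hw j

lemma extLieSub_zero {S : Finset A} {ω : ExteriorAlgebra ℚ (FreeLieAlgebra ℚ A)}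
    (hω : ω ∈ extLieSub 0 S) : ω = 0 ∨ (S = ∅ ∧ ∃ r : ℚ, ω = r • 1) := by
  by_cases hS : S = ∅
  · refine Or.inr ⟨hS, ?_⟩
    induction hω using Submodule.span_induction with
    | zero => exact ⟨0, by simp⟩
    | add a b _ _ ha hb =>
      obtain ⟨r, rfl⟩ := ha
      obtain ⟨s, rfl⟩ := hb
      exact ⟨r + s, (add_smul r s _).symm⟩
    | smul r a _ ha => obtain ⟨s, rfl⟩ := ha; exact ⟨r * s, smul_smul r s _⟩
    | mem ω h =>
      obtain ⟨B, hB, u, hu, rfl⟩ := h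
      exact ⟨1, by rw [ExteriorAlgebra.ιMulti_zero_apply, one_smul]⟩
  · left
    induction hω using Submodule.span_induction with
    | zero => rfl
    | add a b _ _ ha hb => rw [ha, hb, add_zero]
    | smul r a _ ha => rw [ha, smul_zero]
    | mem ω h =>
      obtain ⟨B, hB, u, hu, rfl⟩ := h
      exact absurd (by rw [← hB.cover]; simp) hS

lemma ι_mul_mem {t : ℕ} {S T : Finset A} (h : Disjoint S T)
    {ω : ExteriorAlgebra ℚ (FreeLieAlgebra ℚ A)} (hω : ω ∈ extLieSub t S)
    {x : FreeLieAlgebra ℚ A} (hx : x ∈ lieOp T) :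
    ExteriorAlgebra.ι ℚ x * ω ∈ extLieSub (t + 1) (S ∪ T) := by
  induction hω using Submodule.span_induction with
  | zero => simp
  | add a b _ _ ha hb => rw [mul_add]; exact add_mem ha hb
  | smul r a _ ha => rw [mul_smul_comm]; exact Submodule.smul_mem _ r ha
  | mem ω hω =>
    obtain ⟨B, hB, u, hu, rfl⟩ := hω
    refine Submodule.subset_span ⟨Fin.cons T B, ?_, Fin.cons x u, ?_, ?_⟩
    · rw [isPart_iff] at hB ⊢
      rw [Finset.disjoint_left] at h
      refine ⟨fun a => ?_, fun i j a => ?_⟩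
      · rw [Fin.exists_fin_succ]
        simp only [Fin.cons_zero, Fin.cons_succ, mem_union, hB.1 a]
        exact or_comm
      · refine Fin.cases ?_ (fun i => ?_) i <;> refine Fin.cases ?_ (fun j => ?_) j <;>
          simp only [Fin.cons_zero, Fin.cons_succ]
        · simp
        · exact fun h1 h2 => absurd h1 (h ((hB.1 a).2 ⟨j, h2⟩))
        · exact fun h1 h2 => absurd h2 (h ((hB.1 a).2 ⟨i, h1⟩))
        · exact fun h1 h2 => by rw [hB.2 i j a h1 h2]
    · exact Fin.cases (by simpa using hx) (fun i => by simpa using hu i)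
    · rw [ExteriorAlgebra.ιMulti_succ_apply]; rfl

lemma extLieSub_succ_le (t : ℕ) (S : Finset A) : extLieSub (t + 1) S ≤
    Submodule.span ℚ {ω | ∃ S' T : Finset A, Disjoint S' T ∧ S' ∪ T = S ∧ ∃ ω' ∈ extLieSub t S',
      ∃ x ∈ lieOp T, ω = ExteriorAlgebra.ι ℚ x * ω'} := by
  refine Submodule.span_mono ?_
  rintro _ ⟨B, hB, u, hu, rfl⟩
  rw [isPart_iff] at hB
  refine ⟨Finset.univ.biUnion (Fin.tail B), B 0, ?_, ?_, ExteriorAlgebra.ιMulti ℚ t (Fin.tail u),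
    Submodule.subset_span ⟨Fin.tail B, ⟨fun i j hij => ?_, rfl⟩, Fin.tail u, fun i => hu _, rfl⟩,
    u 0, hu 0, ?_⟩
  · rw [Finset.disjoint_left]
    intro a ha h0
    obtain ⟨i, _, hi⟩ := mem_biUnion.1 ha
    exact Fin.succ_ne_zero i (hB.2 _ _ a hi h0)
  · ext a
    rw [hB.1 a, Fin.exists_fin_succ]
    simp [Fin.tail, or_comm]
  · exact Finset.disjoint_left.2 fun a h1 h2 => hij (Fin.succ_injective _ (hB.2 _ _ a h1 h2))
  · rw [ExteriorAlgebra.ιMulti_succ_apply]; rfl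

lemma extAct_mem {t : ℕ} {S T : Finset A} (h : Disjoint S T)
    {ω : ExteriorAlgebra ℚ (FreeLieAlgebra ℚ A)} (hω : ω ∈ extLieSub t S)
    {x : FreeLieAlgebra ℚ A} (hx : x ∈ lieOp T) : extAct x ω ∈ extLieSub t (S ∪ T) := by
  induction t generalizing S ω with
  | zero =>
    rcases extLieSub_zero hω with rfl | ⟨_, r, rfl⟩
    · simp
    · simp
  | succ t ih =>
    have hω' := extLieSub_succ_le t S hω
    clear hω
    induction hω' using Submodule.span_induction with
    | zero => simp
    | add a b _ _ ha hb => rw [map_add]; exact add_mem ha hb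
    | smul r a _ ha => rw [map_smul]; exact Submodule.smul_mem _ r ha
    | mem ω hω =>
      obtain ⟨S', T', hd, rfl, ω', hω', y, hy, rfl⟩ := hω
      rw [disjoint_union_left] at h
      rw [extAct_ι_mul]
      refine add_mem ?_ ?_
      · rw [union_assoc]
        exact ι_mul_mem (disjoint_union_right.2 ⟨hd, h.1⟩) hω' (lie_mem_lieOp h.2 hy hx)
      · rw [union_right_comm]
        exact ι_mul_mem (disjoint_union_left.2 ⟨hd, h.2.symm⟩) (ih h.1 hω') hy

lemma wedge_mem {t n : ℕ} {S T : Finset A} (h : Disjoint S T)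
    {k : CESp n (FreeLieAlgebra ℚ A)} (hk : k ∈ ceSub t n S)
    {x : FreeLieAlgebra ℚ A} (hx : x ∈ lieOp T) : wedge n x k ∈ ceSub (t + 1) n (S ∪ T) := by
  induction hk using Submodule.span_induction with
  | zero => simp
  | add a b _ _ ha hb => rw [map_add]; exact add_mem ha hb
  | smul r a _ ha => rw [map_smul]; exact Submodule.smul_mem _ r ha
  | mem k hk =>
    obtain ⟨S₁, S₂, hd, rfl, z, hz, ω, hω, rfl⟩ := hk
    rw [disjoint_union_left] at h
    rw [wedge_tmul, union_assoc]
    exact tmul_mem_ceSub (disjoint_union_right.2 ⟨hd, h.1⟩) hz (ι_mul_mem h.2 hω hx)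

lemma diagAct_mem {t n : ℕ} {S T : Finset A} (h : Disjoint S T)
    {k : CESp n (FreeLieAlgebra ℚ A)} (hk : k ∈ ceSub t n S)
    {x : FreeLieAlgebra ℚ A} (hx : x ∈ lieOp T) : diagAct n x k ∈ ceSub t n (S ∪ T) := by
  induction hk using Submodule.span_induction with
  | zero => simp
  | add a b _ _ ha hb => rw [map_add]; exact add_mem ha hb
  | smul r a _ ha => rw [map_smul]; exact Submodule.smul_mem _ r ha
  | mem k hk =>
    obtain ⟨S₁, S₂, hd, rfl, z, hz, ω, hω, rfl⟩ := hk
    rw [disjoint_union_left] at h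
    rw [diagAct_tmul]
    refine add_mem ?_ ?_
    · rw [union_right_comm]
      exact tmul_mem_ceSub (disjoint_union_left.2 ⟨hd, h.2.symm⟩) (adAct_mem h.1 hz hx) hω
    · rw [union_assoc]
      exact tmul_mem_ceSub (disjoint_union_right.2 ⟨hd, h.1⟩) hz (extAct_mem h.2 hω hx)

lemma ceSub_succ_le (t n : ℕ) (S : Finset A) : ceSub (t + 1) n S ≤
    Submodule.span ℚ {k | ∃ S' T : Finset A, Disjoint S' T ∧ S' ∪ T = S ∧ ∃ k' ∈ ceSub t n S',
      ∃ x ∈ lieOp T, k = wedge n x k'} := by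
  refine Submodule.span_le.2 ?_
  rintro _ ⟨S₁, S₂, hd, rfl, z, hz, ω, hω, rfl⟩
  have hω' := extLieSub_succ_le t S₂ hω
  clear hω
  induction hω' using Submodule.span_induction with
  | zero => simp
  | add a b _ _ ha hb => rw [TensorProduct.tmul_add]; exact add_mem ha hb
  | smul r a _ ha => rw [TensorProduct.tmul_smul]; exact Submodule.smul_mem _ r ha
  | mem ω hω =>
    obtain ⟨S', T, hd', rfl, ω', hω', x, hx, rfl⟩ := hω
    rw [disjoint_union_right] at hd
    exact Submodule.subset_span ⟨S₁ ∪ S', T, disjoint_union_left.2 ⟨hd.2, hd'⟩, union_assoc _ _ _,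
      z ⊗ₜ ω', tmul_mem_ceSub hd.1 hz hω', x, hx, rfl⟩

lemma ceD_mem {t n : ℕ} {S : Finset A} {k : CESp n (FreeLieAlgebra ℚ A)}
    (hk : k ∈ ceSub (t + 1) n S) : ceD n k ∈ ceSub t n S := by
  induction t generalizing S k with
  | zero =>
    have hk' := ceSub_succ_le 0 n S hk
    clear hk
    induction hk' using Submodule.span_induction with
    | zero => simp
    | add a b _ _ ha hb => rw [map_add]; exact add_mem ha hb
    | smul r a _ ha => rw [map_smul]; exact Submodule.smul_mem _ r ha
    | mem k hk =>
      obtain ⟨S', T, hd, rfl, k', hk', x, hx, rfl⟩ := hk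
      have h0 : ceD n k' = 0 := by
        clear hd
        induction hk' using Submodule.span_induction with
        | zero => simp
        | add a b _ _ ha hb => rw [map_add, ha, hb, add_zero]
        | smul r a _ ha => rw [map_smul, ha, smul_zero]
        | mem k hk =>
          obtain ⟨S₁, S₂, hd, rfl, z, hz, ω, hω, rfl⟩ := hk
          rcases extLieSub_zero hω with rfl | ⟨_, r, rfl⟩
          · simp
          · rw [TensorProduct.tmul_smul, map_smul, ceD_one, smul_zero]
      rw [ceD_wedge, h0, map_zero, sub_zero]
      exact diagAct_mem hd hk' hx
  | succ t ih =>
    have hk' := ceSub_succ_le (t + 1) n S hk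
    clear hk
    induction hk' using Submodule.span_induction with
    | zero => simp
    | add a b _ _ ha hb => rw [map_add]; exact add_mem ha hb
    | smul r a _ ha => rw [map_smul]; exact Submodule.smul_mem _ r ha
    | mem k hk =>
      obtain ⟨S', T, hd, rfl, k', hk', x, hx, rfl⟩ := hk
      rw [ceD_wedge]
      exact sub_mem (diagAct_mem hd hk' hx) (wedge_mem hd (ih hk') hx)

end Closure


/-! ### The map `π` -/

section Pi

open Finset

attribute [local instance] LieRing.ofAssociativeRing

variable {A A' : Type}

lemma free_induction {P : FreeLieAlgebra ℚ A → Prop} (h0 : P 0)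
    (hof : ∀ a, P (FreeLieAlgebra.of ℚ a)) (hadd : ∀ x y, P x → P y → P (x + y))
    (hsmul : ∀ (r : ℚ) x, P x → P (r • x)) (hlie : ∀ x y, P x → P y → P ⁅x, y⁆)
    (x : FreeLieAlgebra ℚ A) : P x := by
  let K : LieSubalgebra ℚ (FreeLieAlgebra ℚ A) :=
    { carrier := {x | P x}
      add_mem' := fun {a b} ha hb => hadd a b ha hb
      zero_mem' := h0
      smul_mem' := fun r a ha => hsmul r a ha
      lie_mem' := fun {a b} ha hb => hlie a b ha hb }
  let f : FreeLieAlgebra ℚ A →ₗ⁅ℚ⁆ K := FreeLieAlgebra.lift ℚ (fun a => ⟨_, hof a⟩)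
  have hf : K.incl.comp f = LieHom.id :=
    FreeLieAlgebra.hom_ext (fun a => by simp [f])
  have : (f x : FreeLieAlgebra ℚ A) = x := DFunLike.congr_fun hf x
  rw [← this]
  exact (f x).2

/-- The operator `(z, z') ↦ (z · a, z ⊗ a)` on `L^{⊗ n} ⊕ L^{⊗ (n+1)}`, for a letter `a`. -/
def stepOp (n : ℕ) (a : A) :
    Module.End ℚ (TPow n (FreeLieAlgebra ℚ A) × TPow (n + 1) (FreeLieAlgebra ℚ A)) :=
  LinearMap.prod (adAct n (FreeLieAlgebra.of ℚ a) ∘ₗ LinearMap.fst ℚ _ _)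
    ((snocE n).toLinearMap ∘ₗ (TensorProduct.mk ℚ _ _).flip (FreeLieAlgebra.of ℚ a) ∘ₗ
      LinearMap.fst ℚ _ _)

/-- The right action of the free associative algebra (the tensor algebra `T`) on
`L^{⊗ n} ⊕ L^{⊗ (n+1)}` for which a letter acts by `stepOp`.  Hence `(z, 0) · (y a) = (z · y a, (z · y) ⊗ a)`
for a word `y` and a letter `a`, where `z · y` is the right action of `T`, the universal
enveloping algebra of `L`, on `L^{⊗ n}`. -/
def assAct (n : ℕ) : FreeAlgebra ℚ A →ₐ[ℚ]
    (Module.End ℚ (TPow n (FreeLieAlgebra ℚ A) × TPow (n + 1) (FreeLieAlgebra ℚ A)))ᵐᵒᵖ :=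
  FreeAlgebra.lift ℚ (fun a => MulOpposite.op (stepOp n a))

/-- The inclusion of the free Lie algebra in the free associative algebra. -/
def lieToAss : FreeLieAlgebra ℚ A →ₗ⁅ℚ⁆ FreeAlgebra ℚ A :=
  FreeLieAlgebra.lift ℚ (FreeAlgebra.ι ℚ)

/-- The action of an element of the free Lie algebra, through `assAct`. -/
def lieAct (n : ℕ) : FreeLieAlgebra ℚ A →ₗ[ℚ]
    Module.End ℚ (TPow n (FreeLieAlgebra ℚ A) × TPow (n + 1) (FreeLieAlgebra ℚ A)) :=
  (MulOpposite.opLinearEquiv ℚ).symm.toLinearMap ∘ₗ (assAct n).toLinearMap ∘ₗ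
    (lieToAss (A := A)).toLinearMap

/-- The map `π : L^{⊗ n} ⊗ L → L^{⊗ n} ⊗ V ⊆ L^{⊗ n} ⊗ L`, for `L` the free Lie algebra on the alphabet `A`
and `V ⊆ L` the span of the letters: the composite
`L^{⊗ n} ⊗ L ⊆ L^{⊗ n} ⊗ T⁺ ≅ L^{⊗ n} ⊗ T ⊗ V → L^{⊗ n} ⊗ V`, where `T` is the tensor algebra, `T⁺` its
augmentation ideal, `T ⊗ V ≅ T⁺` the product, and the last map is the right action of `T` on
`L^{⊗ n}`.  Here `L^{⊗ n} ⊗ L` is identified with `L^{⊗ (n+1)}`. -/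
def piMap (n : ℕ) : TPow (n + 1) (FreeLieAlgebra ℚ A) →ₗ[ℚ] TPow (n + 1) (FreeLieAlgebra ℚ A) :=
  TensorProduct.lift ((LinearMap.mk₂ ℚ (fun (x : FreeLieAlgebra ℚ A)
      (z : TPow n (FreeLieAlgebra ℚ A)) => (lieAct n x (z, 0)).2)
    (by intros; simp) (by intros; simp)
    (by
      intro x z z'
      rw [← Prod.snd_add, ← map_add]; simp)
    (by
      intro c x z
      rw [← Prod.smul_snd, ← map_smul]; simp)).flip) ∘ₗ (snocE n).symm.toLinearMap

lemma piMap_snoc (n : ℕ) (z : TPow n (FreeLieAlgebra ℚ A)) (x : FreeLieAlgebra ℚ A) :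
    piMap n (snocE n (z ⊗ₜ x)) = (lieAct n x (z, 0)).2 := by
  simp [piMap]

lemma lieAct_of (n : ℕ) (a : A) : lieAct n (FreeLieAlgebra.of ℚ a) = stepOp n a := by
  simp [lieAct, lieToAss, assAct]

lemma lieAct_lie (n : ℕ) (x y : FreeLieAlgebra ℚ A) :
    lieAct n ⁅x, y⁆ = lieAct n y * lieAct n x - lieAct n x * lieAct n y := by
  simp [lieAct, LieRing.of_associative_ring_bracket]

lemma lieAct_apply (n : ℕ) (x : FreeLieAlgebra ℚ A) (z : TPow n (FreeLieAlgebra ℚ A))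
    (z' : TPow (n + 1) (FreeLieAlgebra ℚ A)) :
    lieAct n x (z, z') = (adAct n x z, piMap n (snocE n (z ⊗ₜ x))) := by
  rw [piMap_snoc]
  induction x using free_induction generalizing z z' with
  | h0 => simp; rfl
  | hof a => rw [lieAct_of]; rfl
  | hadd x y hx hy =>
    rw [map_add, LinearMap.add_apply, LinearMap.add_apply, hx, hy, hx z 0, hy z 0, map_add]
    rfl
  | hsmul r x hx =>
    rw [map_smul, LinearMap.smul_apply, LinearMap.smul_apply, hx, hx z 0, map_smul]
    rfl
  | hlie x y hx hy =>
    rw [lieAct_lie]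
    simp only [LinearMap.sub_apply, Module.End.mul_apply]
    rw [hx z z', hy z z', hx z 0, hy z 0, hy _ (lieAct n x (z, 0)).2,
      hx _ (lieAct n y (z, 0)).2, adAct_lie]
    rfl

lemma piMap_of (n : ℕ) (z : TPow n (FreeLieAlgebra ℚ A)) (a : A) :
    piMap n (snocE n (z ⊗ₜ FreeLieAlgebra.of ℚ a)) = snocE n (z ⊗ₜ FreeLieAlgebra.of ℚ a) := by
  rw [piMap_snoc, lieAct_of]; rfl

lemma piMap_lie (n : ℕ) (z : TPow n (FreeLieAlgebra ℚ A)) (x y : FreeLieAlgebra ℚ A) :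
    piMap n (snocE n (z ⊗ₜ ⁅x, y⁆)) =
      piMap n (snocE n (adAct n x z ⊗ₜ y)) - piMap n (snocE n (adAct n y z ⊗ₜ x)) := by
  rw [piMap_snoc, lieAct_lie]
  simp only [LinearMap.sub_apply, Module.End.mul_apply]
  rw [lieAct_apply n x z 0, lieAct_apply n y z 0, lieAct_apply, lieAct_apply]
  rfl

lemma snoc_induction (n : ℕ) {g : Type} [LieRing g] [LieAlgebra ℚ g] {P : TPow (n + 1) g → Prop}
    (h0 : P 0) (ha : ∀ a b, P a → P b → P (a + b)) (ht : ∀ z x, P (snocE n (z ⊗ₜ x)))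
    (y : TPow (n + 1) g) : P y := by
  obtain ⟨y, rfl⟩ := (snocE n).surjective y
  induction y using TensorProduct.induction_on with
  | zero => simpa using h0
  | tmul z x => exact ht z x
  | add a b h h' => rw [map_add]; exact ha _ _ h h'

lemma piMap_map (n : ℕ) (h : FreeLieAlgebra ℚ A →ₗ⁅ℚ⁆ FreeLieAlgebra ℚ A')
    (y : TPow (n + 1) (FreeLieAlgebra ℚ A)) :
    piMap n (tpMap (n + 1) h (piMap n y)) = piMap n (tpMap (n + 1) h y) := by
  induction y using snoc_induction with
  | h0 => simp
  | ha a b h h' => simp only [map_add, h, h']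
  | ht z x =>
    induction x using free_induction generalizing z with
    | h0 => simp
    | hof a => rw [piMap_of]
    | hadd x y hx hy => simp only [TensorProduct.tmul_add, map_add, hx, hy]
    | hsmul r x hx => simp only [TensorProduct.tmul_smul, map_smul, hx]
    | hlie x y hx hy =>
      rw [piMap_lie, map_sub, map_sub, hx, hy, snocE_map, snocE_map, snocE_map, LieHom.map_lie,
        piMap_lie, adAct_map, adAct_map]

lemma adAct_piMap (n : ℕ)
    (α : TPow (n + 1) (FreeLieAlgebra ℚ A) →ₗ[ℚ] TPow n (FreeLieAlgebra ℚ A))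
    (hα : ∀ z x, α (snocE n (z ⊗ₜ x)) = adAct n x z) (y : TPow (n + 1) (FreeLieAlgebra ℚ A)) :
    α (piMap n y) = α y := by
  induction y using snoc_induction with
  | h0 => simp
  | ha a b h h' => simp only [map_add, h, h']
  | ht z x =>
    induction x using free_induction generalizing z with
    | h0 => simp
    | hof a => rw [piMap_of]
    | hadd x y hx hy => simp only [TensorProduct.tmul_add, map_add, hx, hy]
    | hsmul r x hx => simp only [TensorProduct.tmul_smul, map_smul, hx]
    | hlie x y hx hy => rw [piMap_lie, map_sub, hx, hy, hα, hα, hα, adAct_lie]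

variable [DecidableEq A] [DecidableEq A']

lemma IsPart.snoc {n : ℕ} {B : Fin n → Finset A} {S T : Finset A} (hB : IsPart B S)
    (h : Disjoint S T) : IsPart (Fin.snoc B T : Fin (n + 1) → Finset A) (S ∪ T) := by
  rw [isPart_iff] at hB ⊢
  rw [Finset.disjoint_left] at h
  refine ⟨fun a => ?_, fun i j a => ?_⟩
  · rw [mem_union, hB.1 a]
    constructor
    · rintro (⟨i, hi⟩ | ha)
      · exact ⟨i.castSucc, by simpa using hi⟩
      · exact ⟨Fin.last n, by simpa using ha⟩
    · rintro ⟨i, hi⟩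
      induction i using Fin.lastCases with
      | last => exact Or.inr (by simpa using hi)
      | cast i => exact Or.inl ⟨i, by simpa using hi⟩
  · refine Fin.lastCases ?_ (fun i => ?_) i <;> refine Fin.lastCases ?_ (fun j => ?_) j <;>
      simp only [Fin.snoc_last, Fin.snoc_castSucc]
    · simp
    · exact fun h1 h2 => absurd h1 (h ((hB.1 a).2 ⟨j, h2⟩))
    · exact fun h1 h2 => absurd h2 (h ((hB.1 a).2 ⟨i, h1⟩))
    · exact fun h1 h2 => by rw [hB.2 i j a h1 h2]

lemma IsPart.init {n : ℕ} {B : Fin (n + 1) → Finset A} {S : Finset A} (hB : IsPart B S) :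
    ∃ S', IsPart (Fin.init B) S' ∧ Disjoint S' (B (Fin.last n)) ∧ S' ∪ B (Fin.last n) = S := by
  rw [isPart_iff] at hB
  refine ⟨Finset.univ.biUnion (Fin.init B), ⟨fun i j hij => ?_, rfl⟩, ?_, ?_⟩
  · exact Finset.disjoint_left.2 fun a h1 h2 =>
      hij (Fin.castSucc_injective _ (hB.2 _ _ a h1 h2))
  · rw [Finset.disjoint_left]
    intro a ha h0
    obtain ⟨i, _, hi⟩ := mem_biUnion.1 ha
    exact (Fin.castSucc_lt_last i).ne (hB.2 _ _ a hi h0)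
  · ext a
    rw [hB.1 a, mem_union, mem_biUnion]
    constructor
    · rintro (⟨i, _, hi⟩ | hi)
      · exact ⟨_, hi⟩
      · exact ⟨_, hi⟩
    · rintro ⟨i, hi⟩
      induction i using Fin.lastCases with
      | last => exact Or.inr hi
      | cast i => exact Or.inl ⟨i, mem_univ _, hi⟩

lemma snocE_mem {n : ℕ} {S T : Finset A} (h : Disjoint S T) {z : TPow n (FreeLieAlgebra ℚ A)}
    (hz : z ∈ catLieSub n S) {x : FreeLieAlgebra ℚ A} (hx : x ∈ lieOp T) :
    snocE n (z ⊗ₜ x) ∈ catLieSub (n + 1) (S ∪ T) := by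
  induction hz using Submodule.span_induction with
  | zero => simp
  | add a b _ _ ha hb => rw [TensorProduct.add_tmul, map_add]; exact add_mem ha hb
  | smul r a _ ha =>
    rw [← TensorProduct.smul_tmul', map_smul]; exact Submodule.smul_mem _ r ha
  | mem z hz =>
    obtain ⟨B, hB, w, hw, rfl⟩ := hz
    rw [snocE_tprod]
    refine Submodule.subset_span ⟨_, hB.snoc h, _, fun i => ?_, rfl⟩
    induction i using Fin.lastCases with
    | last => simpa using hx
    | cast i => simpa using hw i

lemma snocE_mem_deltaOne {n : ℕ} {S : Finset A} {a : A} (h : Disjoint S {a})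
    {z : TPow n (FreeLieAlgebra ℚ A)} (hz : z ∈ catLieSub n S) :
    snocE n (z ⊗ₜ FreeLieAlgebra.of ℚ a) ∈ deltaOneSub n (S ∪ {a}) := by
  induction hz using Submodule.span_induction with
  | zero => simp
  | add a b _ _ ha hb => rw [TensorProduct.add_tmul, map_add]; exact add_mem ha hb
  | smul r a _ ha =>
    rw [← TensorProduct.smul_tmul', map_smul]; exact Submodule.smul_mem _ r ha
  | mem z hz =>
    obtain ⟨B, hB, w, hw, rfl⟩ := hz
    rw [snocE_tprod]
    refine Submodule.subset_span ⟨_, hB.snoc h, by simp, _, fun i => ?_, rfl⟩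
    induction i using Fin.lastCases with
    | last => simpa using of_mem_lieOp a
    | cast i => simpa using hw i

lemma catLieSub_succ_le (n : ℕ) (S : Finset A) : catLieSub (n + 1) S ≤
    Submodule.span ℚ {y | ∃ S' T : Finset A, Disjoint S' T ∧ S' ∪ T = S ∧ ∃ z ∈ catLieSub n S',
      ∃ x, LieMon T x ∧ y = snocE n (z ⊗ₜ x)} := by
  refine Submodule.span_le.2 ?_
  rintro _ ⟨B, hB, w, hw, rfl⟩
  obtain ⟨S', hS', hd, hu⟩ := hB.init
  have hw' : PiTensorProduct.tprod ℚ w =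
      snocE n (PiTensorProduct.tprod ℚ (Fin.init w) ⊗ₜ w (Fin.last n)) := by
    rw [snocE_tprod, Fin.snoc_init_self]
  have hz : PiTensorProduct.tprod ℚ (Fin.init w) ∈ catLieSub n S' :=
    Submodule.subset_span ⟨_, hS', _, fun i => hw _, rfl⟩
  rw [hw']
  have hl := hw (Fin.last n)
  clear hw'
  generalize w (Fin.last n) = y at hl ⊢
  induction hl using Submodule.span_induction with
  | zero => simp
  | add a b _ _ ha hb => rw [TensorProduct.tmul_add, map_add]; exact add_mem ha hb
  | smul r a _ ha => rw [TensorProduct.tmul_smul, map_smul]; exact Submodule.smul_mem _ r ha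
  | mem x hx => exact Submodule.subset_span ⟨_, _, hd, hu, _, hz, x, hx, rfl⟩

lemma deltaOneSub_le_span (n : ℕ) (S : Finset A) : deltaOneSub n S ≤
    Submodule.span ℚ {y | ∃ (S' : Finset A) (a : A), Disjoint S' {a} ∧ S' ∪ {a} = S ∧
      ∃ z ∈ catLieSub n S', y = snocE n (z ⊗ₜ FreeLieAlgebra.of ℚ a)} := by
  refine Submodule.span_le.2 ?_
  rintro _ ⟨B, hB, hc, w, hw, rfl⟩
  obtain ⟨S', hS', hd, hu⟩ := hB.init
  have hw' : PiTensorProduct.tprod ℚ w =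
      snocE n (PiTensorProduct.tprod ℚ (Fin.init w) ⊗ₜ w (Fin.last n)) := by
    rw [snocE_tprod, Fin.snoc_init_self]
  have hz : PiTensorProduct.tprod ℚ (Fin.init w) ∈ catLieSub n S' :=
    Submodule.subset_span ⟨_, hS', _, fun i => hw _, rfl⟩
  rw [hw']
  have hl := hw (Fin.last n)
  clear hw'
  generalize w (Fin.last n) = y at hl ⊢
  induction hl using Submodule.span_induction with
  | zero => simp
  | add a b _ _ ha hb => rw [TensorProduct.tmul_add, map_add]; exact add_mem ha hb
  | smul r a _ ha => rw [TensorProduct.tmul_smul, map_smul]; exact Submodule.smul_mem _ r ha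
  | mem x hx =>
    obtain ⟨a, ha, rfl⟩ := LieMon.eq_of hx hc
    rw [ha] at hd hu
    exact Submodule.subset_span ⟨_, a, hd, hu, _, hz, rfl⟩

lemma piMap_mem {n : ℕ} {S : Finset A} {y : TPow (n + 1) (FreeLieAlgebra ℚ A)}
    (hy : y ∈ catLieSub (n + 1) S) : piMap n y ∈ deltaOneSub n S := by
  have hy' := catLieSub_succ_le n S hy
  clear hy
  induction hy' using Submodule.span_induction with
  | zero => simp
  | add a b _ _ ha hb => rw [map_add]; exact add_mem ha hb
  | smul r a _ ha => rw [map_smul]; exact Submodule.smul_mem _ r ha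
  | mem y hy =>
    obtain ⟨S', T, hd, rfl, z, hz, x, hx, rfl⟩ := hy
    induction hx generalizing S' z with
    | of a => rw [piMap_of]; exact snocE_mem_deltaOne hd hz
    | @lie T₁ T₂ p q hp hq h ihp ihq =>
      rw [disjoint_union_right] at hd
      rw [piMap_lie]
      refine sub_mem ?_ ?_
      · rw [← union_assoc]
        exact ihq _ (disjoint_union_left.2 ⟨hd.2, h⟩) _
          (adAct_mem hd.1 hz (Submodule.subset_span hp))
      · rw [union_comm T₁, ← union_assoc]
        exact ihp _ (disjoint_union_left.2 ⟨hd.1, h.symm⟩) _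
          (adAct_mem hd.2 hz (Submodule.subset_span hq))

lemma piMap_of_mem {n : ℕ} {S : Finset A} {y : TPow (n + 1) (FreeLieAlgebra ℚ A)}
    (hy : y ∈ deltaOneSub n S) : piMap n y = y := by
  have hy' := deltaOneSub_le_span n S hy
  clear hy
  induction hy' using Submodule.span_induction with
  | zero => simp
  | add a b _ _ ha hb => rw [map_add, ha, hb]
  | smul r a _ ha => rw [map_smul, ha]
  | mem y hy =>
    obtain ⟨S', a, hd, rfl, z, hz, rfl⟩ := hy
    exact piMap_of n z a

end Pi

/-! ### The shift functor and the morphisms `μ(n)` -/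

section Shift

variable {g : Type} [LieRing g] [LieAlgebra ℚ g]

/-- The functor `- ⊞ 1` on morphisms: `ψ ⊞ 1 = ψ ⊗ x_{m+1}`. -/
def boxOne {m n : ℕ} : CL m n →ₗ[ℚ] CL (m + 1) (n + 1) :=
  LinearMap.codRestrict _ ((snocE n).toLinearMap ∘ₗ
      (TensorProduct.mk ℚ _ _).flip (FreeLieAlgebra.of ℚ (Fin.last m)) ∘ₗ
      tpMap n (ev fun i : Fin m => FreeLieAlgebra.of ℚ i.castSucc) ∘ₗ Submodule.subtype _)
    (fun ψ => by
      have h := tpMap_ev_mem n (C := fun i : Fin m => ({i.castSucc} : Finset (Fin (m + 1))))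
        (fun a b hab => by simpa using hab) (fun a => of_mem_lieOp _) ψ.2
      have hd : Disjoint (Finset.univ.biUnion fun i : Fin m => ({i.castSucc} : Finset (Fin (m + 1))))
          {Fin.last m} := by
        simpa using fun x => (Fin.castSucc_ne_last x).symm
      have hu : (Finset.univ.biUnion fun i : Fin m => ({i.castSucc} : Finset (Fin (m + 1)))) ∪
          {Fin.last m} = Finset.univ := by
        ext a
        induction a using Fin.lastCases <;> simp
      rw [← hu]
      exact snocE_mem hd h (of_mem_lieOp _))

lemma act_boxOne {m n : ℕ} (ψ : CL m n) (z : TPow m g) (x : g) :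
    act (boxOne ψ) (snocE m (z ⊗ₜ x)) = snocE n (act ψ z ⊗ₜ x) := by
  have : act (boxOne ψ) ∘ₗ (snocE m).toLinearMap ∘ₗ (TensorProduct.mk ℚ _ _).flip x =
      (snocE n).toLinearMap ∘ₗ (TensorProduct.mk ℚ _ _).flip x ∘ₗ act (g := g) ψ := by
    refine PiTensorProduct.ext (MultilinearMap.ext fun v => ?_)
    have h1 : act (boxOne ψ) (snocE m (PiTensorProduct.tprod ℚ v ⊗ₜ x)) =
        snocE n (act ψ (PiTensorProduct.tprod ℚ v) ⊗ₜ x) := by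
      rw [snocE_tprod, act_tprod, act_tprod]
      change tpMap (n + 1) _ (snocE n (tpMap n (ev _) ψ.1 ⊗ₜ _)) = _
      rw [snocE_map, tpMap_comp, comp_ev, ev_of]
      simp
    exact h1
  exact DFunLike.congr_fun this z

/-- The element `μ(n) : n+1 ⟶ n`, the sum over `1 ≤ i ≤ n` of
`x₁ ⊗ ⋯ ⊗ [x_i, x_{n+1}] ⊗ ⋯ ⊗ xₙ`. -/
def mu (n : ℕ) : CL (n + 1) n :=
  ⟨∑ i : Fin n, PiTensorProduct.tprod ℚ (Function.update
      (fun j : Fin n => FreeLieAlgebra.of ℚ j.castSucc) i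
      ⁅FreeLieAlgebra.of ℚ i.castSucc, FreeLieAlgebra.of ℚ (Fin.last n)⁆), by
    rw [← adAct_tprod]
    have hd : Disjoint (Finset.univ.biUnion fun i : Fin n => ({i.castSucc} : Finset (Fin (n + 1))))
        {Fin.last n} := by
      simpa using fun x => (Fin.castSucc_ne_last x).symm
    have hu : (Finset.univ.biUnion fun i : Fin n => ({i.castSucc} : Finset (Fin (n + 1)))) ∪
        {Fin.last n} = Finset.univ := by
      ext a
      induction a using Fin.lastCases <;> simp
    rw [← hu]
    refine adAct_mem hd (Submodule.subset_span
      ⟨fun i => {i.castSucc}, ⟨?_, rfl⟩, _, fun i => of_mem_lieOp _, rfl⟩) (of_mem_lieOp _)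
    intro i j hij
    simpa using hij⟩

lemma act_mu (n : ℕ) (z : TPow n g) (x : g) : act (mu n) (snocE n (z ⊗ₜ x)) = adAct n x z := by
  have : act (mu n) ∘ₗ (snocE n).toLinearMap ∘ₗ (TensorProduct.mk ℚ _ _).flip x =
      adAct n x := by
    refine PiTensorProduct.ext (MultilinearMap.ext fun v => ?_)
    have h1 : act (mu n) (snocE n (PiTensorProduct.tprod ℚ v ⊗ₜ x)) =
        adAct n x (PiTensorProduct.tprod ℚ v) := by
      rw [snocE_tprod, act_tprod, adAct_tprod, mu, map_sum]
      refine Finset.sum_congr rfl fun i _ => ?_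
      rw [tpMap_tprod]
      congr 1
      funext j
      rcases eq_or_ne j i with rfl | hj
      · simp
      · simp [hj]
    exact h1
  exact DFunLike.congr_fun this z

lemma act_piMap {m p n : ℕ} (ψ : CL n p) (y : TPow (n + 1) (FreeLieAlgebra ℚ (Fin m))) :
    piMap p (act (boxOne ψ) y) = act (boxOne ψ) (piMap n y) := by
  induction y using snoc_induction with
  | h0 => simp
  | ha a b h h' => simp only [map_add, h, h']
  | ht z x =>
    induction x using free_induction generalizing z with
    | h0 => simp
    | hof a => rw [act_boxOne, piMap_of, piMap_of, act_boxOne]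
    | hadd x y hx hy => simp only [TensorProduct.tmul_add, map_add, hx, hy]
    | hsmul r x hx => simp only [TensorProduct.tmul_smul, map_smul, hx]
    | hlie x y hx hy =>
      rw [piMap_lie, map_sub, ← hx, ← hy, act_boxOne, act_boxOne, act_boxOne, piMap_lie,
        act_adAct, act_adAct]

end Shift


/-! ### Bimodules over the PROP associated with the Lie operad -/

/-- Right modules: additive (equivalently, `ℚ`-linear) functors from the opposite of the PROP to
`ℚ`-vector spaces. -/
abbrev RightMod : Type 1 := CatLieᵒᵖ ⥤+ ModuleCat.{0} ℚ

/-- Bimodules: additive (equivalently, `ℚ`-linear) functors from the PROP to right modules.  The left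
module structure is given by the covariance. -/
abbrev Bimod : Type 1 := CatLie ⥤+ RightMod

/-- The right module `B(-, n)` underlying a bimodule `B`. -/
abbrev Bimod.right (B : Bimod) (n : CatLie) : RightMod := B.obj.obj n

/-- Evaluation `B ↦ B(m, n)` of bimodules. -/
def evalBimod (m n : CatLie) : Bimod ⥤ ModuleCat.{0} ℚ :=
  AdditiveFunctor.forget _ _ ⋙ (evaluation _ _).obj n ⋙
    AdditiveFunctor.forget _ _ ⋙ (evaluation _ _).obj (Opposite.op m)

instance (m n : CatLie) : (evalBimod m n).Additive where
  map_add := rfl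

/-- An explicit description of a bimodule: the spaces `T m n = B(m, n)` together with the left action `L`
and the right action `R` of the PROP. -/
structure BimodData where
  /-- the underlying vector spaces -/
  T : ℕ → ℕ → Type
  [acg : ∀ m n, AddCommGroup (T m n)]
  [mod : ∀ m n, Module ℚ (T m n)]
  /-- the left action -/
  L : ∀ (m : ℕ) {n p : ℕ}, CL n p →ₗ[ℚ] T m n →ₗ[ℚ] T m p
  /-- the right action -/
  R : ∀ (n : ℕ) {k m : ℕ}, CL k m →ₗ[ℚ] T m n →ₗ[ℚ] T k n
  L_id : ∀ m n (x : T m n), L m (idCL n) x = x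
  L_comp : ∀ m {n p q} (φ : CL n p) (ψ : CL p q) (x : T m n),
    L m (compCL φ ψ) x = L m ψ (L m φ x)
  R_id : ∀ m n (x : T m n), R n (idCL m) x = x
  R_comp : ∀ n {j k m} (φ : CL j k) (ψ : CL k m) (x : T m n),
    R n (compCL φ ψ) x = R n φ (R n ψ x)
  L_R : ∀ {k m n p} (φ : CL k m) (ψ : CL n p) (x : T m n),
    L k ψ (R n φ x) = R p φ (L m ψ x)

namespace BimodData

attribute [instance] BimodData.acg BimodData.mod

/-- The right module `B(-, n)`. -/
def toRight (D : BimodData) (n : ℕ) : RightMod where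
  obj :=
    { obj := fun m => ModuleCat.of ℚ (D.T m.unop.arity n)
      map := fun φ => ModuleCat.ofHom (D.R n φ.unop)
      map_id := fun _ => ModuleCat.hom_ext (LinearMap.ext fun x => D.R_id _ _ x)
      map_comp := fun φ ψ => ModuleCat.hom_ext (LinearMap.ext fun x => D.R_comp _ ψ.unop φ.unop x) }
  property := ⟨fun {_ _ φ ψ} => ModuleCat.hom_ext (map_add (D.R n) φ.unop ψ.unop)⟩

/-- The bimodule with the given explicit description. -/
def toBimod (D : BimodData) : Bimod where
  obj :=
    { obj := fun n => D.toRight n.arity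
      map := fun {n p} ψ => ⟨
        { app := fun m => ModuleCat.ofHom (D.L m.unop.arity ψ)
          naturality := fun k m φ => ModuleCat.hom_ext (LinearMap.ext fun x =>
            D.L_R φ.unop ψ x) }⟩
      map_id := fun n => by
        apply ObjectProperty.hom_ext
        ext m x
        exact D.L_id _ _ x
      map_comp := fun φ ψ => by
        apply ObjectProperty.hom_ext
        ext m x
        exact D.L_comp _ φ ψ x }
  property := ⟨fun {_ _ φ ψ} => by
    apply ObjectProperty.hom_ext
    ext m x
    exact LinearMap.congr_fun (map_add (D.L m.unop.arity) φ ψ) x⟩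

/-- A morphism of bimodules, given by linear maps commuting with the left and right actions. -/
def homMk (D D' : BimodData) (f : ∀ m n, D.T m n →ₗ[ℚ] D'.T m n)
    (hL : ∀ m {n p} (ψ : CL n p) x, f m p (D.L m ψ x) = D'.L m ψ (f m n x))
    (hR : ∀ n {k m} (φ : CL k m) x, f k n (D.R n φ x) = D'.R n φ (f m n x)) :
    D.toBimod ⟶ D'.toBimod where
  hom :=
    { app := fun n => ⟨
        { app := fun m => ModuleCat.ofHom (f m.unop.arity n.arity)
          naturality := fun k m φ => ModuleCat.hom_ext (LinearMap.ext fun x =>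
            hR n.arity φ.unop x) }⟩
      naturality := fun n p ψ => by
        apply ObjectProperty.hom_ext
        ext m x
        exact hL _ ψ x }

lemma hom_ext {D D' : BimodData} {f f' : D.toBimod ⟶ D'.toBimod}
    (h : ∀ m n : CatLie, (evalBimod m n).map f = (evalBimod m n).map f') : f = f' := by
  apply ObjectProperty.hom_ext
  refine NatTrans.ext (funext fun n => ?_)
  apply ObjectProperty.hom_ext
  refine NatTrans.ext (funext fun m => ?_)
  exact h m.unop n

end BimodData

/-- Composition in the PROP, as a bilinear map. -/
def compL (m : ℕ) {n p : ℕ} : CL n p →ₗ[ℚ] CL m n →ₗ[ℚ] CL m p :=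
  LinearMap.mk₂ ℚ (fun ψ φ => compCL φ ψ) (fun ψ ψ' φ => compCL_add φ ψ ψ')
    (fun r ψ φ => compCL_smul φ r ψ) (fun ψ φ φ' => Subtype.ext ((act ψ).map_add φ.1 φ'.1))
    (fun r ψ φ => Subtype.ext ((act ψ).map_smul r φ.1))

/-- The PROP as a bimodule over itself. -/
def catLieData : BimodData where
  T := CL
  L m := compL m
  R _ _ _ := (compL _).flip
  L_id _ _ x := Subtype.ext (act_idCL _ x.1)
  L_comp _ _ _ _ φ ψ x := Subtype.ext (act_compCL φ ψ x.1)
  R_id _ _ x := Subtype.ext (act_on_id x)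
  R_comp _ _ _ _ φ ψ x := Subtype.ext (act_compCL ψ x φ.1).symm
  L_R φ ψ x := Subtype.ext (act_compCL x ψ φ.1).symm

lemma idCL_succ (n : ℕ) : (idCL (n + 1)).1 =
    snocE n (PiTensorProduct.tprod ℚ (fun i : Fin n => FreeLieAlgebra.of ℚ i.castSucc) ⊗ₜ
      FreeLieAlgebra.of ℚ (Fin.last n)) := by
  rw [snocE_tprod]
  refine congrArg (PiTensorProduct.tprod ℚ) (funext fun i => ?_)
  induction i using Fin.lastCases <;> simp

lemma boxOne_id (n : ℕ) : boxOne (idCL n) = idCL (n + 1) := by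
  refine Subtype.ext ?_
  rw [← act_on_id (boxOne (idCL n)), idCL_succ, act_boxOne, act_idCL]

lemma boxOne_comp {m n p : ℕ} (φ : CL m n) (ψ : CL n p) :
    boxOne (compCL φ ψ) = compCL (boxOne φ) (boxOne ψ) := by
  refine Subtype.ext ?_
  change _ = act (boxOne ψ) (boxOne φ).1
  rw [← act_on_id (boxOne (compCL φ ψ)), ← act_on_id (boxOne φ), idCL_succ, act_boxOne, act_boxOne,
    act_boxOne, act_compCL]

/-- The bimodule `δ 𝐂𝐚𝐭𝔏𝔦𝔢 = 𝐂𝐚𝐭𝔏𝔦𝔢(-, - ⊞ 1)`, with `ψ` acting on the left by composition with `ψ ⊞ 1`. -/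
def deltaData : BimodData where
  T m n := CL m (n + 1)
  L m := (compL m).comp boxOne
  R _ _ _ := (compL _).flip
  L_id m n x := by
    change compL m (boxOne (idCL n)) x = x
    rw [boxOne_id]; exact catLieData.L_id _ _ x
  L_comp m _ _ _ φ ψ x := by
    change compL m (boxOne (compCL φ ψ)) x = _
    rw [boxOne_comp]; exact catLieData.L_comp _ _ _ x
  R_id _ _ x := catLieData.R_id _ _ x
  R_comp _ _ _ _ φ ψ x := catLieData.R_comp _ φ ψ x
  L_R φ ψ x := catLieData.L_R φ (boxOne ψ) x

/-- The spaces `δ⁽¹⁾ 𝐂𝐚𝐭𝔏𝔦𝔢(m, n) ⊆ δ 𝐂𝐚𝐭𝔏𝔦𝔢(m, n) = 𝐂𝐚𝐭𝔏𝔦𝔢(m, n+1)`. -/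
abbrev DeltaOne (m n : ℕ) : Type := ↥(deltaOneSub n (Finset.univ : Finset (Fin m)))

/-- The inclusion of `δ⁽¹⁾ 𝐂𝐚𝐭𝔏𝔦𝔢` in `δ 𝐂𝐚𝐭𝔏𝔦𝔢` (this is not a morphism of right modules). -/
def deltaOneIncl (m n : ℕ) : DeltaOne m n →ₗ[ℚ] CL m (n + 1) :=
  Submodule.inclusion (deltaOneSub_le n _)

/-- The components `δ 𝐂𝐚𝐭𝔏𝔦𝔢(m, n) → δ⁽¹⁾ 𝐂𝐚𝐭𝔏𝔦𝔢(m, n)` of the map `π`. -/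
def piCL (m n : ℕ) : CL m (n + 1) →ₗ[ℚ] DeltaOne m n :=
  (piMap n).restrict (fun _ h => piMap_mem h)

lemma piCL_incl (m n : ℕ) (x : DeltaOne m n) : piCL m n (deltaOneIncl m n x) = x :=
  Subtype.ext (piMap_of_mem x.2)

lemma piCL_right (n : ℕ) {k m : ℕ} (φ : CL k m) (y : CL m (n + 1)) :
    piCL k n (compCL φ (deltaOneIncl m n (piCL m n y))) = piCL k n (compCL φ y) := by
  refine Subtype.ext ?_
  change piMap n (act (deltaOneIncl m n (piCL m n y)) φ.1) = piMap n (act y φ.1)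
  have : piMap n ∘ₗ act (deltaOneIncl m n (piCL m n y)) =
      piMap n ∘ₗ act (g := FreeLieAlgebra ℚ (Fin k)) y := by
    refine PiTensorProduct.ext (MultilinearMap.ext fun v => ?_)
    simp only [LinearMap.compMultilinearMap_apply, LinearMap.comp_apply, act_tprod]
    exact piMap_map n (ev v) y.1
  exact DFunLike.congr_fun this φ.1

lemma piCL_left (m : ℕ) {n p : ℕ} (ψ : CL n p) (y : CL m (n + 1)) :
    deltaOneIncl m p (piCL m p (compCL y (boxOne ψ))) =
      compCL (deltaOneIncl m n (piCL m n y)) (boxOne ψ) :=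
  Subtype.ext (act_piMap ψ y.1)

lemma piCL_left_incl (m : ℕ) {n p : ℕ} (ψ : CL n p) (y : CL m (n + 1)) :
    piCL m p (compCL y (boxOne ψ)) =
      piCL m p (compCL (deltaOneIncl m n (piCL m n y)) (boxOne ψ)) := by
  rw [← piCL_left, piCL_incl]

/-- The bimodule `δ⁽¹⁾ 𝐂𝐚𝐭𝔏𝔦𝔢`.  The left action is the restriction of that on `δ 𝐂𝐚𝐭𝔏𝔦𝔢`; the right action
is that of `δ 𝐂𝐚𝐭𝔏𝔦𝔢` followed by the retraction `π`.  It is the unique bimodule structure for which `π` is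
a morphism of bimodules. -/
def deltaOneData : BimodData where
  T := DeltaOne
  L m n p := ((compL m).comp boxOne).compr₂ (piCL m p) |>.compl₂ (deltaOneIncl m n)
  R n k m := ((compL k (n := m) (p := n + 1)).flip.compr₂ (piCL k n)).compl₂ (deltaOneIncl m n)
  L_id m n x := by
    change piCL m n (compCL (deltaOneIncl m n x) (boxOne (idCL n))) = x
    rw [boxOne_id, show compCL (deltaOneIncl m n x) (idCL (n + 1)) = deltaOneIncl m n x from
      Subtype.ext (act_idCL _ _), piCL_incl]
  L_comp m n p q φ ψ x := by
    change piCL m q (compCL (deltaOneIncl m n x) (boxOne (compCL φ ψ))) =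
      piCL m q (compCL (deltaOneIncl m p (piCL m p (compCL (deltaOneIncl m n x) (boxOne φ))))
        (boxOne ψ))
    rw [piCL_left, piCL_incl, boxOne_comp]
    exact congrArg _ (Subtype.ext (act_compCL _ _ _))
  R_id m n x := by
    change piCL m n (compCL (idCL m) (deltaOneIncl m n x)) = x
    rw [show compCL (idCL m) (deltaOneIncl m n x) = deltaOneIncl m n x from
      Subtype.ext (act_on_id _), piCL_incl]
  R_comp n j k m φ ψ x := by
    change piCL j n (compCL (compCL φ ψ) (deltaOneIncl m n x)) =
      piCL j n (compCL φ (deltaOneIncl k n (piCL k n (compCL ψ (deltaOneIncl m n x)))))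
    rw [piCL_right]
    exact congrArg _ (Subtype.ext (act_compCL _ _ _).symm)
  L_R {k m n p} φ ψ x := by
    change piCL k p (compCL (deltaOneIncl k n (piCL k n (compCL φ (deltaOneIncl m n x))))
        (boxOne ψ)) =
      piCL k p (compCL φ (deltaOneIncl m p (piCL m p (compCL (deltaOneIncl m n x) (boxOne ψ)))))
    rw [piCL_right, ← piCL_left, piCL_incl]
    exact congrArg _ (Subtype.ext (act_compCL _ _ _).symm)

/-- The zero bimodule. -/
def zeroData : BimodData where
  T _ _ := PUnit
  L _ _ _ := 0
  R _ _ _ := 0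
  L_id _ _ _ := rfl
  L_comp _ _ _ _ _ _ _ := rfl
  R_id _ _ _ := rfl
  R_comp _ _ _ _ _ _ _ := rfl
  L_R _ _ _ := rfl

/-- The bimodule `𝐂𝐚𝐭𝔏𝔦𝔢`. -/
def CatLieBimod : Bimod := catLieData.toBimod

/-- The bimodule `δ 𝐂𝐚𝐭𝔏𝔦𝔢`. -/
def DeltaBimod : Bimod := deltaData.toBimod

/-- The bimodule `δ⁽¹⁾ 𝐂𝐚𝐭𝔏𝔦𝔢`. -/
def DeltaOneBimod : Bimod := deltaOneData.toBimod

/-- The morphism of bimodules `π : δ 𝐂𝐚𝐭𝔏𝔦𝔢 ⟶ δ⁽¹⁾ 𝐂𝐚𝐭𝔏𝔦𝔢`. -/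
def piHom : DeltaBimod ⟶ DeltaOneBimod :=
  BimodData.homMk deltaData deltaOneData piCL
    (fun m _ _ ψ x => piCL_left_incl m ψ x) (fun n _ _ φ x => (piCL_right n φ x).symm)

lemma mu_central {n p : ℕ} (ψ : CL n p) {g : Type} [LieRing g] [LieAlgebra ℚ g]
    (y : TPow (n + 1) g) : act (mu p) (act (boxOne ψ) y) = act ψ (act (mu n) y) := by
  induction y using snoc_induction with
  | h0 => simp
  | ha a b h h' => simp only [map_add, h, h']
  | ht z x => rw [act_boxOne, act_mu, act_mu, act_adAct]

/-- The morphism of bimodules `μ̃ : δ 𝐂𝐚𝐭𝔏𝔦𝔢 ⟶ 𝐂𝐚𝐭𝔏𝔦𝔢`, given by composition with the elements `μ(n)`. -/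
def muTilde : DeltaBimod ⟶ CatLieBimod :=
  BimodData.homMk deltaData catLieData (fun m n => compL m (mu n))
    (fun _ _ _ ψ x => Subtype.ext (mu_central ψ x.1))
    (fun n _ _ φ x => Subtype.ext (act_compCL x (mu n) φ.1).symm)

lemma mu_pi (m n : ℕ) (y : CL m (n + 1)) :
    compCL (deltaOneIncl m n (piCL m n y)) (mu n) = compCL y (mu n) :=
  Subtype.ext (adAct_piMap n (act (mu n)) (act_mu n) y.1)

/-- The morphism of bimodules `μ̃⁽¹⁾ : δ⁽¹⁾ 𝐂𝐚𝐭𝔏𝔦𝔢 ⟶ 𝐂𝐚𝐭𝔏𝔦𝔢`, the restriction of `μ̃`. -/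
def muOne : DeltaOneBimod ⟶ CatLieBimod :=
  BimodData.homMk deltaOneData catLieData (fun m n => (compL m (mu n)).comp (deltaOneIncl m n))
    (fun m n p ψ x => by
      change compCL (deltaOneIncl m p (piCL m p (compCL (deltaOneIncl m n x) (boxOne ψ)))) (mu p) =
        compCL (compCL (deltaOneIncl m n x) (mu n)) ψ
      rw [mu_pi]
      exact Subtype.ext (mu_central ψ _))
    (fun n k m φ x => by
      change compCL (deltaOneIncl k n (piCL k n (compCL φ (deltaOneIncl m n x)))) (mu n) =
        compCL φ (compCL (deltaOneIncl m n x) (mu n))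
      rw [mu_pi]
      exact Subtype.ext (act_compCL (deltaOneIncl m n x) (mu n) φ.1).symm)

/-- The terms of the complex `ℂ𝔏𝔦𝔢`. -/
def cLieX : ℕ → Bimod
  | 0 => CatLieBimod
  | 1 => DeltaOneBimod
  | _ + 2 => zeroData.toBimod

/-- The differentials of the complex `ℂ𝔏𝔦𝔢`. -/
def cLieD : (t : ℕ) → (cLieX (t + 1) ⟶ cLieX t)
  | 0 => muOne
  | _ + 1 => 0

/-- The complex of bimodules `ℂ𝔏𝔦𝔢 = (μ̃⁽¹⁾ : δ⁽¹⁾ 𝐂𝐚𝐭𝔏𝔦𝔢 ⟶ 𝐂𝐚𝐭𝔏𝔦𝔢)`, with `𝐂𝐚𝐭𝔏𝔦𝔢` in degree `0` and `δ⁽¹⁾ 𝐂𝐚𝐭𝔏𝔦𝔢`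
in degree `1`. -/
def CLie : ChainComplex Bimod ℕ :=
  ChainComplex.of cLieX cLieD (fun t => by
    change (0 : cLieX (t + 2) ⟶ cLieX (t + 1)) ≫ _ = 0
    exact Limits.zero_comp)

/-! ### The universal Chevalley–Eilenberg complex -/

/-- The operation of `ψ : n ⟶ p` on the coefficients of the Chevalley–Eilenberg complex. -/
def ceL {g : Type} [LieRing g] [LieAlgebra ℚ g] {n p : ℕ} (ψ : CL n p) :
    CESp n g →ₗ[ℚ] CESp p g :=
  LinearMap.rTensor _ (act ψ)

section CEActions

variable {g g' : Type} [LieRing g'] [LieAlgebra ℚ g'] [LieRing g] [LieAlgebra ℚ g]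

@[simp] lemma ceL_tmul {n p : ℕ} (ψ : CL n p) (z : TPow n g) (ω : ExteriorAlgebra ℚ g) :
    ceL ψ (z ⊗ₜ ω) = act ψ z ⊗ₜ ω := rfl

lemma ceL_wedge {n p : ℕ} (ψ : CL n p) (x : g) (k : CESp n g) :
    ceL ψ (wedge n x k) = wedge p x (ceL ψ k) := by
  induction k using TensorProduct.induction_on with
  | zero => simp
  | add a b h h' => simp only [map_add, h, h']
  | tmul z ω => rfl

lemma ceL_diagAct {n p : ℕ} (ψ : CL n p) (x : g) (k : CESp n g) :
    ceL ψ (diagAct n x k) = diagAct p x (ceL ψ k) := by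
  induction k using TensorProduct.induction_on with
  | zero => simp
  | add a b h h' => simp only [map_add, h, h']
  | tmul z ω => simp [act_adAct]

lemma ceL_ceD {n p : ℕ} (ψ : CL n p) (k : CESp n g) : ceL ψ (ceD n k) = ceD p (ceL ψ k) := by
  induction k using ce_induction with
  | ha a b h h' => simp only [map_add, h, h']
  | h1 z => simp [ceD_one]
  | hw u k h => rw [ceD_wedge, ceL_wedge, ceD_wedge, map_sub, ceL_wedge, ceL_diagAct, h]

lemma ceL_ceMap {n p : ℕ} (ψ : CL n p) (h : g →ₗ⁅ℚ⁆ g') (k : CESp n g) :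
    ceL ψ (ceMap n h k) = ceMap p h (ceL ψ k) := by
  induction k using TensorProduct.induction_on with
  | zero => simp
  | add a b h h' => simp only [map_add, h, h']
  | tmul z ω => simp [act_map]

lemma ceL_mem {A : Type} [DecidableEq A] {t n p : ℕ} (ψ : CL n p) {S : Finset A}
    {k : CESp n (FreeLieAlgebra ℚ A)} (hk : k ∈ ceSub t n S) : ceL ψ k ∈ ceSub t p S := by
  induction hk using Submodule.span_induction with
  | zero => simp
  | add a b _ _ ha hb => rw [map_add]; exact add_mem ha hb
  | smul r a _ ha => rw [map_smul]; exact Submodule.smul_mem _ r ha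
  | mem k hk =>
    obtain ⟨S₁, S₂, hd, rfl, z, hz, ω, hω, rfl⟩ := hk
    exact tmul_mem_ceSub hd (act_mem ψ hz) hω

/-- The spaces `(𝐂𝐚𝐭𝔏𝔦𝔢(-, n) ⊙ Λ^t 𝔏𝔦𝔢)(m)`. -/
abbrev CET (t m n : ℕ) : Type := ↥(ceSub t n (Finset.univ : Finset (Fin m)))

/-- Substitution in an element of `(𝐂𝐚𝐭𝔏𝔦𝔢(-, n) ⊙ Λ^t 𝔏𝔦𝔢)(m)`. -/
def ceAct {t m n : ℕ} : CET t m n →ₗ[ℚ] TPow m g →ₗ[ℚ] CESp n g :=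
  substGen _ (fun v => ceMap n (ev v)) (fun _ h => mlOn_ceSub t n h)

@[simp] lemma ceAct_tprod {t m n : ℕ} (ξ : CET t m n) (v : Fin m → g) :
    ceAct ξ (PiTensorProduct.tprod ℚ v) = ceMap n (ev v) ξ.1 := substGen_tprod _ _ _ _ _

lemma ceAct_mem {A : Type} [DecidableEq A] {t m n : ℕ} (ξ : CET t m n) {S : Finset A}
    {z : TPow m (FreeLieAlgebra ℚ A)} (hz : z ∈ catLieSub m S) : ceAct ξ z ∈ ceSub t n S := by
  induction hz using Submodule.span_induction with
  | zero => simp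
  | add a b _ _ ha hb => rw [map_add]; exact add_mem ha hb
  | smul r a _ ha => rw [map_smul]; exact Submodule.smul_mem _ r ha
  | mem z hz =>
    obtain ⟨B, hB, w, hw, rfl⟩ := hz
    rw [ceAct_tprod, ← hB.cover]
    exact ceMap_ev_mem t n hB.disj hw ξ.2

lemma ceAct_on_id {t m n : ℕ} (ξ : CET t m n) : ceAct ξ (idCL m).1 = ξ.1 := by
  rw [idCL, ceAct_tprod, ev_self, ceMap_id]

lemma ceAct_map {t m n : ℕ} (ξ : CET t m n) (h : g →ₗ⁅ℚ⁆ g') (z : TPow m g) :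
    ceMap n h (ceAct ξ z) = ceAct ξ (tpMap m h z) := by
  have : ceMap n h ∘ₗ ceAct ξ = ceAct ξ ∘ₗ tpMap m h := by
    refine PiTensorProduct.ext (MultilinearMap.ext fun v => ?_)
    simp [ceMap_comp, comp_ev]
  exact DFunLike.congr_fun this z

lemma ceAct_comp {t k m n : ℕ} (ξ : CET t m n) (ψ : CL k m) (z : TPow k g) :
    ceAct (⟨ceAct ξ ψ.1, ceAct_mem ξ ψ.2⟩ : CET t k n) z = ceAct ξ (act ψ z) := by
  have : ceAct (g := g) (⟨ceAct ξ ψ.1, ceAct_mem ξ ψ.2⟩ : CET t k n) = ceAct ξ ∘ₗ act ψ := by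
    refine PiTensorProduct.ext (MultilinearMap.ext fun v => ?_)
    simp [ceAct_map]
  rw [this]; rfl

lemma ceAct_ceL {t m n p : ℕ} (ξ : CET t m n) (ψ : CL n p) (z : TPow m g) :
    ceAct (⟨ceL ψ ξ.1, ceL_mem ψ ξ.2⟩ : CET t m p) z = ceL ψ (ceAct ξ z) := by
  have : ceAct (g := g) (⟨ceL ψ ξ.1, ceL_mem ψ ξ.2⟩ : CET t m p) = ceL ψ ∘ₗ ceAct ξ := by
    refine PiTensorProduct.ext (MultilinearMap.ext fun v => ?_)
    simp [ceL_ceMap]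
  rw [this]; rfl

lemma ceAct_ceD {t m n : ℕ} (ξ : CET (t + 1) m n) (z : TPow m g) :
    ceAct (⟨ceD n ξ.1, ceD_mem ξ.2⟩ : CET t m n) z = ceD n (ceAct ξ z) := by
  have : ceAct (g := g) (⟨ceD n ξ.1, ceD_mem ξ.2⟩ : CET t m n) = ceD n ∘ₗ ceAct ξ := by
    refine PiTensorProduct.ext (MultilinearMap.ext fun v => ?_)
    simp [ceMap_ceD]
  rw [this]; rfl

lemma ceL_add {n p : ℕ} (ψ ψ' : CL n p) (k : CESp n g) : ceL (ψ + ψ') k = ceL ψ k + ceL ψ' k := by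
  rw [ceL, map_add, LinearMap.rTensor_add]; rfl

lemma ceL_smul {n p : ℕ} (r : ℚ) (ψ : CL n p) (k : CESp n g) : ceL (r • ψ) k = r • ceL ψ k := by
  rw [ceL, map_smul, LinearMap.rTensor_smul]; rfl

lemma ceL_id {n : ℕ} (k : CESp n g) : ceL (idCL n) k = k := by
  induction k using TensorProduct.induction_on with
  | zero => simp
  | add a b h h' => simp only [map_add, h, h']
  | tmul z ω => simp [act_idCL]

lemma ceL_comp {n p q : ℕ} (φ : CL n p) (ψ : CL p q) (k : CESp n g) :
    ceL (compCL φ ψ) k = ceL ψ (ceL φ k) := by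
  induction k using TensorProduct.induction_on with
  | zero => simp
  | add a b h h' => simp only [map_add, h, h']
  | tmul z ω => simp [act_compCL]

end CEActions

/-- The left action on `𝐂𝐚𝐭𝔏𝔦𝔢 ⊙ Λ^t 𝔏𝔦𝔢`, by the operation on the coefficients. -/
def ceLeft {t m n p : ℕ} (ψ : CL n p) (ξ : CET t m n) : CET t m p := ⟨ceL ψ ξ.1, ceL_mem ψ ξ.2⟩

/-- The right action on `𝐂𝐚𝐭𝔏𝔦𝔢 ⊙ Λ^t 𝔏𝔦𝔢`, by substitution. -/
def ceRight {t k m n : ℕ} (φ : CL k m) (ξ : CET t m n) : CET t k n := ⟨ceAct ξ φ.1, ceAct_mem ξ φ.2⟩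

lemma ceRight_add {t k m n : ℕ} (φ : CL k m) (ξ ξ' : CET t m n) :
    ceRight φ (ξ + ξ') = ceRight φ ξ + ceRight φ ξ' := by
  refine Subtype.ext ?_
  change ceAct (ξ + ξ') φ.1 = ceAct ξ φ.1 + ceAct ξ' φ.1
  rw [map_add]; rfl

lemma ceRight_smul {t k m n : ℕ} (r : ℚ) (φ : CL k m) (ξ : CET t m n) :
    ceRight φ (r • ξ) = r • ceRight φ ξ := by
  refine Subtype.ext ?_
  change ceAct (r • ξ) φ.1 = r • ceAct ξ φ.1
  rw [map_smul]; rfl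

/-- The left action on `𝐂𝐚𝐭𝔏𝔦𝔢 ⊙ Λ^t 𝔏𝔦𝔢`, as a bilinear map. -/
def ceLeftL (t m : ℕ) {n p : ℕ} : CL n p →ₗ[ℚ] CET t m n →ₗ[ℚ] CET t m p :=
  LinearMap.mk₂ ℚ ceLeft
    (fun ψ ψ' ξ => Subtype.ext (ceL_add ψ ψ' ξ.1)) (fun r ψ ξ => Subtype.ext (ceL_smul r ψ ξ.1))
    (fun ψ ξ ξ' => Subtype.ext ((ceL ψ).map_add ξ.1 ξ'.1))
    (fun r ψ ξ => Subtype.ext ((ceL ψ).map_smul r ξ.1))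

/-- The right action on `𝐂𝐚𝐭𝔏𝔦𝔢 ⊙ Λ^t 𝔏𝔦𝔢`, as a bilinear map. -/
def ceRightL (t n : ℕ) {k m : ℕ} : CL k m →ₗ[ℚ] CET t m n →ₗ[ℚ] CET t k n :=
  LinearMap.mk₂ ℚ ceRight
    (fun φ φ' ξ => Subtype.ext ((ceAct ξ).map_add φ.1 φ'.1))
    (fun r φ ξ => Subtype.ext ((ceAct ξ).map_smul r φ.1))
    ceRight_add (fun r φ ξ => ceRight_smul r φ ξ)

/-- The degree `t` term `𝐂𝐚𝐭𝔏𝔦𝔢 ⊙ Λ^t 𝔏𝔦𝔢` of the universal Chevalley–Eilenberg complex, as a bimodule: the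
left action is the operation on the coefficients, and the right action is given by substitution. -/
def ceData (t : ℕ) : BimodData where
  T := CET t
  L m _ _ := ceLeftL t m
  R n _ _ := ceRightL t n
  L_id _ _ x := Subtype.ext (ceL_id x.1)
  L_comp _ _ _ _ φ ψ x := Subtype.ext (ceL_comp φ ψ x.1)
  R_id _ _ x := Subtype.ext (ceAct_on_id x)
  R_comp _ _ _ _ φ ψ x := Subtype.ext (ceAct_comp x ψ φ.1).symm
  L_R φ ψ x := Subtype.ext (ceAct_ceL x ψ φ.1).symm

/-- The differential of the universal Chevalley–Eilenberg complex: on `L^{⊗ n} ⊗ Λ^* L`, for `L` a free Lie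
algebra, it is the Chevalley–Eilenberg differential of `L` with coefficients in `L^{⊗ n}`. -/
def ceDHom (t : ℕ) : (ceData (t + 1)).toBimod ⟶ (ceData t).toBimod :=
  BimodData.homMk (ceData (t + 1)) (ceData t)
    (fun _ n => (ceD n).restrict (fun _ h => ceD_mem h))
    (fun _ _ _ ψ x => Subtype.ext (ceL_ceD ψ x.1).symm)
    (fun _ _ _ φ x => Subtype.ext (ceAct_ceD x φ.1).symm)

/-- The universal Chevalley–Eilenberg complex `CE_𝔏𝔦𝔢`, a complex of bimodules. -/
def CELie : ChainComplex Bimod ℕ :=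
  ChainComplex.of (fun t => (ceData t).toBimod) ceDHom (fun t =>
    BimodData.hom_ext fun m n => ModuleCat.hom_ext (LinearMap.ext fun x =>
      Subtype.ext (ceD_ceD n.arity (x : CET (t + 2) m.arity n.arity).1)))

section Comparison

variable {g g' : Type} [LieRing g'] [LieAlgebra ℚ g'] [LieRing g] [LieAlgebra ℚ g]

/-- The projection `g^{⊗ n} ⊗ Λ^* g → g^{⊗ n} ⊗ Λ^0 g = g^{⊗ n}`. -/
def degZero (n : ℕ) : CESp n g →ₗ[ℚ] TPow n g :=
  (TensorProduct.rid ℚ _).toLinearMap ∘ₗ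
    LinearMap.lTensor _ (ExteriorAlgebra.algebraMapInv (R := ℚ) (M := g)).toLinearMap

/-- The projection `g^{⊗ n} ⊗ Λ^* g → g^{⊗ n} ⊗ Λ^1 g = g^{⊗ (n+1)}`. -/
def degOne (n : ℕ) : CESp n g →ₗ[ℚ] TPow (n + 1) g :=
  (snocE n).toLinearMap ∘ₗ LinearMap.lTensor _ (ExteriorAlgebra.ιInv (R := ℚ) (M := g))

lemma degZero_tmul (n : ℕ) (z : TPow n g) (ω : ExteriorAlgebra ℚ g) :
    degZero n (z ⊗ₜ ω) = ExteriorAlgebra.algebraMapInv ω • z := rfl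

lemma degOne_tmul (n : ℕ) (z : TPow n g) (ω : ExteriorAlgebra ℚ g) :
    degOne n (z ⊗ₜ ω) = snocE n (z ⊗ₜ ExteriorAlgebra.ιInv ω) := rfl

lemma degZero_map (n : ℕ) (h : g →ₗ⁅ℚ⁆ g') (k : CESp n g) :
    degZero n (ceMap n h k) = tpMap n h (degZero n k) := by
  induction k using TensorProduct.induction_on with
  | zero => simp
  | add a b h h' => simp only [map_add, h, h']
  | tmul z ω =>
    have : (ExteriorAlgebra.algebraMapInv (R := ℚ)).comp (ExteriorAlgebra.map h.toLinearMap) =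
        ExteriorAlgebra.algebraMapInv :=
      ExteriorAlgebra.hom_ext (LinearMap.ext fun x => by simp [ExteriorAlgebra.algebraMapInv])
    rw [ceMap_tmul, degZero_tmul, degZero_tmul, map_smul, ← this]; rfl

lemma degOne_map (n : ℕ) (h : g →ₗ⁅ℚ⁆ g') (k : CESp n g) :
    degOne n (ceMap n h k) = tpMap (n + 1) h (degOne n k) := by
  induction k using TensorProduct.induction_on with
  | zero => simp
  | add a b h h' => simp only [map_add, h, h']
  | tmul z ω =>
    have := LinearMap.congr_fun (ExteriorAlgebra.ιInv_comp_map h.toLinearMap) ω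
    rw [ceMap_tmul, degOne_tmul, degOne_tmul, snocE_map]
    exact congrArg (fun y => snocE n (tpMap n h z ⊗ₜ y)) this

lemma degZero_ceL {n p : ℕ} (ψ : CL n p) (k : CESp n g) :
    degZero p (ceL ψ k) = act ψ (degZero n k) := by
  induction k using TensorProduct.induction_on with
  | zero => simp
  | add a b h h' => simp only [map_add, h, h']
  | tmul z ω => rw [ceL_tmul, degZero_tmul, degZero_tmul, map_smul]

lemma degOne_ceL {n p : ℕ} (ψ : CL n p) (k : CESp n g) :
    degOne p (ceL ψ k) = act (boxOne ψ) (degOne n k) := by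
  induction k using TensorProduct.induction_on with
  | zero => simp
  | add a b h h' => simp only [map_add, h, h']
  | tmul z ω => rw [ceL_tmul, degOne_tmul, degOne_tmul, act_boxOne]

lemma degZero_mem {A : Type} [DecidableEq A] {n : ℕ} {S : Finset A}
    {k : CESp n (FreeLieAlgebra ℚ A)} (hk : k ∈ ceSub 0 n S) : degZero n k ∈ catLieSub n S := by
  induction hk using Submodule.span_induction with
  | zero => simp
  | add a b _ _ ha hb => rw [map_add]; exact add_mem ha hb
  | smul r a _ ha => rw [map_smul]; exact Submodule.smul_mem _ r ha
  | mem k hk =>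
    obtain ⟨S₁, S₂, hd, rfl, z, hz, ω, hω, rfl⟩ := hk
    rcases extLieSub_zero hω with rfl | ⟨rfl, r, rfl⟩
    · simp
    · rw [degZero_tmul, Finset.union_empty]; exact Submodule.smul_mem _ _ hz

lemma degOne_mem {A : Type} [DecidableEq A] {n : ℕ} {S : Finset A}
    {k : CESp n (FreeLieAlgebra ℚ A)} (hk : k ∈ ceSub 1 n S) :
    degOne n k ∈ catLieSub (n + 1) S := by
  induction hk using Submodule.span_induction with
  | zero => simp
  | add a b _ _ ha hb => rw [map_add]; exact add_mem ha hb
  | smul r a _ ha => rw [map_smul]; exact Submodule.smul_mem _ r ha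
  | mem k hk =>
    obtain ⟨S₁, S₂, hd, rfl, z, hz, ω, hω, rfl⟩ := hk
    rw [degOne_tmul]
    refine snocE_mem hd hz ?_
    induction hω using Submodule.span_induction with
    | zero => simp
    | add a b _ _ ha hb => rw [map_add]; exact add_mem ha hb
    | smul r a _ ha => rw [map_smul]; exact Submodule.smul_mem _ r ha
    | mem ω hω =>
      obtain ⟨B, hB, u, hu, rfl⟩ := hω
      have hc : B 0 = S₂ := by rw [← hB.cover]; simp
      rw [ExteriorAlgebra.ιMulti_succ_apply, ExteriorAlgebra.ιMulti_zero_apply, mul_one,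
        ExteriorAlgebra.ι_leftInverse, ← hc]
      exact hu 0

/-- The components of the identification `(CE_𝔏𝔦𝔢)₀ = 𝐂𝐚𝐭𝔏𝔦𝔢`. -/
def ceZeroCL (m n : ℕ) : CET 0 m n →ₗ[ℚ] CL m n := (degZero n).restrict (fun _ h => degZero_mem h)

/-- The components of the identification `(CE_𝔏𝔦𝔢)₁ = δ 𝐂𝐚𝐭𝔏𝔦𝔢`. -/
def ceOneCL (m n : ℕ) : CET 1 m n →ₗ[ℚ] CL m (n + 1) := (degOne n).restrict (fun _ h => degOne_mem h)

lemma ceZeroCL_right (n : ℕ) {k m : ℕ} (φ : CL k m) (x : CET 0 m n) :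
    ceZeroCL k n (ceRight φ x) = compCL φ (ceZeroCL m n x) := by
  refine Subtype.ext ?_
  have : degZero n ∘ₗ ceAct x = act (g := FreeLieAlgebra ℚ (Fin k)) (ceZeroCL m n x) := by
    refine PiTensorProduct.ext (MultilinearMap.ext fun v => ?_)
    simp only [LinearMap.compMultilinearMap_apply, LinearMap.comp_apply, act_tprod, ceAct_tprod,
      degZero_map]
    rfl
  exact DFunLike.congr_fun this φ.1

lemma ceOneCL_right (n : ℕ) {k m : ℕ} (φ : CL k m) (x : CET 1 m n) :
    ceOneCL k n (ceRight φ x) = compCL φ (ceOneCL m n x) := by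
  refine Subtype.ext ?_
  have : degOne n ∘ₗ ceAct x = act (g := FreeLieAlgebra ℚ (Fin k)) (ceOneCL m n x) := by
    refine PiTensorProduct.ext (MultilinearMap.ext fun v => ?_)
    simp only [LinearMap.compMultilinearMap_apply, LinearMap.comp_apply, act_tprod, ceAct_tprod,
      degOne_map]
    rfl
  exact DFunLike.congr_fun this φ.1

end Comparison

/-- The identification `(CE_𝔏𝔦𝔢)₀ = 𝐂𝐚𝐭𝔏𝔦𝔢`, given by `z ⊗ 1 ↦ z`. -/
def ceZero : CELie.X 0 ⟶ CatLieBimod :=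
  BimodData.homMk (ceData 0) catLieData ceZeroCL (fun _ _ _ ψ x => Subtype.ext (degZero_ceL ψ x.1))
    (fun n _ _ φ x => ceZeroCL_right n φ x)

/-- The identification `(CE_𝔏𝔦𝔢)₁ = 𝐂𝐚𝐭𝔏𝔦𝔢 ⊙ 𝔏𝔦𝔢 = δ 𝐂𝐚𝐭𝔏𝔦𝔢`, given by
`(z₁ ⊗ ⋯ ⊗ zₙ) ⊗ x ↦ z₁ ⊗ ⋯ ⊗ zₙ ⊗ x`. -/
def ceOne : CELie.X 1 ⟶ DeltaBimod :=
  BimodData.homMk (ceData 1) deltaData ceOneCL (fun _ _ _ ψ x => Subtype.ext (degOne_ceL ψ x.1))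
    (fun n _ _ φ x => ceOneCL_right n φ x)

end LiePROP

end

/-! The degree one comparisons are formal: `degZero` and `degOne` are bijective on the multilinear
parts, and the rule π(z ⊗ [X, Y]) = π(z·X ⊗ Y) - π(z·Y ⊗ X) says exactly that π kills d(z ⊗ X ∧ Y).
Hence the identity and π form a morphism of complexes (`comparison`), which is surjective because π
is a retraction. It is then a quasi-isomorphism as soon as its kernel is acyclic
(`quasiIso_of_surjective`), and this kernel is zero in degree 0, ker π in degree 1, and the whole
Chevalley–Eilenberg term in degrees at least 2.

In degree 1, the formula for d(z ⊗ X ∧ Y) lets one break up brackets, so that modulo boundaries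
every element is a sum of terms z ⊗ a with a a letter (`exists_letters_add_ceD`). Since π fixes such
terms and kills boundaries, ker π consists of boundaries (`exists_ceD_eq_of_piMap`).

In degrees at least 2, write the differential as `actD` plus 1 ⊗ `trivD`, where `trivD` is the
differential with trivial coefficients, and filter by the number of letters in the coefficients. A
nonzero Lie element involves at least one letter, so `actD` strictly raises the filtration, and the
leading part of d is 1 ⊗ `trivD`. The filtration is finite, so exactness follows from that of the
multilinear part of (Λ L, `trivD`) by successive approximation (`exists_sub_ceD_mem`,
`exists_ceD_eq`). When fewer than two letters are left, Λ^t vanishes for t ≥ 2; otherwise one needs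
`exists_trivD_eq`, the multilinear form of the fact that a free Lie algebra has no homology beyond
the scalars and the span of the letters.

That acyclicity is proved by induction on the number of letters. Fix a letter s. In a multilinear
element of Λ^{t+1} exactly one factor contains s; moving it to the front identifies Λ^{t+1}, up to
the sign of the differential, with the degree t part of the complex with coefficients in L^{⊗ 1} in
which s occurs in the coefficient (`wedgeIn`, `wedgeIn_ceD`, `wedgeIn_injective`,
`exists_wedgeIn_eq`). In degree 0, every bracket is a boundary (`exists_ceD_eq_tmul_one`). In
degrees at least 2, the filtration argument applies, and only sets of letters without s are
involved. In degree 1, one reduces to a sum of z_a ⊗ a with s in z_a, whose boundary is the sum of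
the [z_a, a]; the z_a are recovered from it because left-normed brackets starting with s are
linearly independent. This is detected by expanding in words starting with s (`wordExp`,
`eq_zero_of_wordExp`, `letters_eq_zero`).

Projectivity uses characteristic zero: antisymmetrization makes Λ^t a natural direct summand of the
t-th tensor power, so the term of degree t is a retract of the right module represented by n + t,
which is projective by the Yoneda lemma. -/

noncomputable section

namespace LiePROP

/-! ### Splitting the differential: trivial coefficients and action on the coefficients -/

section TrivialDifferential

variable {g : Type} [LieRing g] [LieAlgebra ℚ g]

/-- The Chevalley–Eilenberg differential of `Λ^* g` with trivial coefficients: the linear map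
determined by `d 1 = 0` and `d (x ∧ ω) = ω · x - x ∧ d ω`. -/
def trivD : ExteriorAlgebra ℚ g →ₗ[ℚ] ExteriorAlgebra ℚ g :=
  CliffordAlgebra.foldr' (0 : QuadraticForm ℚ g)
    (LinearMap.mk₂ ℚ
      (fun (u : g) (p : ExteriorAlgebra ℚ g × ExteriorAlgebra ℚ g) =>
        extAct u p.1 - ExteriorAlgebra.ι ℚ u * p.2)
      (by intros; simp only [extAct_add, map_add, add_mul]; abel)
      (by intros; simp only [extAct_smul, map_smul, smul_mul_assoc, smul_sub])
      (by intros; simp only [Prod.fst_add, Prod.snd_add, map_add, mul_add]; abel)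
      (by intros; simp only [Prod.smul_fst, Prod.smul_snd, map_smul, mul_smul_comm, smul_sub]))
    (by
      rintro u ω h
      have h2 := ExteriorAlgebra.ι_sq_zero (R := ℚ) u
      change extAct u (ExteriorAlgebra.ι ℚ u * ω) - ExteriorAlgebra.ι ℚ u *
        (extAct u ω - ExteriorAlgebra.ι ℚ u * _) = _
      rw [extAct_ι_mul, mul_sub, ← mul_assoc, h2, zero_mul, lie_self]
      simp)
    0

lemma trivD_one : trivD (1 : ExteriorAlgebra ℚ g) = 0 := by
  rw [trivD, ← map_one (algebraMap ℚ (ExteriorAlgebra ℚ g)), CliffordAlgebra.foldr'_algebraMap,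
    smul_zero]

lemma trivD_ι_mul (x : g) (ω : ExteriorAlgebra ℚ g) :
    trivD (ExteriorAlgebra.ι ℚ x * ω) = extAct x ω - ExteriorAlgebra.ι ℚ x * trivD ω :=
  CliffordAlgebra.foldr'_ι_mul _ _ _ _ _ _

/-- The part of the Chevalley–Eilenberg differential which involves the action on the
coefficients. -/
def actD (n : ℕ) : CESp n g →ₗ[ℚ] CESp n g := ceD n - LinearMap.lTensor _ trivD

lemma ceD_eq (n : ℕ) (k : CESp n g) : ceD n k = actD n k + LinearMap.lTensor _ trivD k := by
  simp [actD]

lemma actD_one (n : ℕ) (z : TPow n g) : actD n (z ⊗ₜ 1) = 0 := by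
  simp [actD, ceD_one, trivD_one]

/-- In the recursion for `ceD`, the diagonal action is the action on the coefficients plus that on
Λ; the second summand is cancelled by the recursion for `trivD`. -/
lemma actD_wedge (n : ℕ) (x : g) (k : CESp n g) :
    actD n (wedge n x k) = LinearMap.rTensor _ (adAct n x) k - wedge n x (actD n k) := by
  have h : LinearMap.lTensor (TPow n g) trivD (wedge n x k) =
      LinearMap.lTensor _ (extAct x) k - wedge n x (LinearMap.lTensor _ trivD k) := by
    induction k using TensorProduct.induction_on with
    | zero => simp
    | add a b h h' => simp only [map_add, h, h']; abel
    | tmul z ω => simp [trivD_ι_mul, TensorProduct.tmul_sub]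
  simp only [actD, LinearMap.sub_apply, ceD_wedge, h, diagAct, LinearMap.add_apply, map_sub]
  abel

end TrivialDifferential

/-! ### The filtration by the number of letters in the coefficients -/

section Filtration

open Finset

variable {A : Type} [DecidableEq A]

lemma lieOp_empty : lieOp (∅ : Finset A) = ⊥ := by
  rw [lieOp, Submodule.span_eq_bot]
  intro x hx
  exact absurd (LieMon.nonempty hx) (by simp)

/-- With fewer letters than factors some block is empty, and there is no Lie monomial without
letters. This takes care of sets with at most one letter in degrees at least 2, where
`exists_trivD_eq` does not apply. -/
lemma extLieSub_eq_bot {t : ℕ} {S : Finset A} (h : S.card < t) : extLieSub t S = ⊥ := by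
  rw [extLieSub, Submodule.span_eq_bot]
  rintro _ ⟨B, hB, u, hu, rfl⟩
  have : ∃ i, B i = ∅ := by
    by_contra! hne
    have h1 : S.card = ∑ i, (B i).card := by
      rw [← hB.cover]
      exact card_biUnion fun i _ j _ hij => hB.disj i j hij
    have h2 : ∑ _i : Fin t, 1 ≤ ∑ i, (B i).card :=
      sum_le_sum fun i _ => (hne i).card_pos
    simp at h2
    omega
  obtain ⟨i, hi⟩ := this
  have h0 := hu i
  rw [hi, lieOp_empty, Submodule.mem_bot] at h0
  exact (ExteriorAlgebra.ιMulti ℚ t).map_coord_zero i h0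

lemma trivD_mem {t : ℕ} {S : Finset A} {ω : ExteriorAlgebra ℚ (FreeLieAlgebra ℚ A)}
    (hω : ω ∈ extLieSub (t + 1) S) : trivD ω ∈ extLieSub t S := by
  induction t generalizing S ω with
  | zero =>
    have hω' := extLieSub_succ_le 0 S hω
    clear hω
    induction hω' using Submodule.span_induction with
    | zero => simp
    | add a b _ _ ha hb => rw [map_add]; exact add_mem ha hb
    | smul r a _ ha => rw [map_smul]; exact Submodule.smul_mem _ r ha
    | mem k hk =>
      obtain ⟨S', T, hd, rfl, ω', hω', x, hx, rfl⟩ := hk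
      have h0 : trivD ω' = 0 := by
        rcases extLieSub_zero hω' with rfl | ⟨_, r, rfl⟩
        · simp
        · rw [map_smul, trivD_one, smul_zero]
      rw [trivD_ι_mul, h0, mul_zero, sub_zero]
      exact extAct_mem hd hω' hx
  | succ t ih =>
    have hω' := extLieSub_succ_le (t + 1) S hω
    clear hω
    induction hω' using Submodule.span_induction with
    | zero => simp
    | add a b _ _ ha hb => rw [map_add]; exact add_mem ha hb
    | smul r a _ ha => rw [map_smul]; exact Submodule.smul_mem _ r ha
    | mem k hk =>
      obtain ⟨S', T, hd, rfl, ω', hω', x, hx, rfl⟩ := hk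
      rw [trivD_ι_mul]
      exact sub_mem (extAct_mem hd hω' hx) (ι_mul_mem hd (ih hω') hx)

/-- The part of `(𝐂𝐚𝐭𝔏𝔦𝔢(-, n) ⊙ Λ^t 𝔏𝔦𝔢)(S)` in which the letters of `U` occur in the
coefficients, and at least `p` letters occur in the coefficients. -/
def ceFil (U : Finset A) (p t n : ℕ) (S : Finset A) :
    Submodule ℚ (CESp n (FreeLieAlgebra ℚ A)) :=
  Submodule.span ℚ {k | ∃ S₁ S₂ : Finset A, Disjoint S₁ S₂ ∧ S₁ ∪ S₂ = S ∧ U ⊆ S₁ ∧ p ≤ S₁.card ∧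
    ∃ z ∈ catLieSub n S₁, ∃ ω ∈ extLieSub t S₂, k = z ⊗ₜ ω}

lemma ceFil_empty (t n : ℕ) (S : Finset A) : ceFil ∅ 0 t n S = ceSub t n S := by
  simp [ceFil, ceSub]

lemma ceFil_le (U : Finset A) {p q : ℕ} (h : q ≤ p) (t n : ℕ) (S : Finset A) :
    ceFil U p t n S ≤ ceFil U q t n S :=
  Submodule.span_mono fun _ ⟨S₁, S₂, h1, h2, h3, h4, h5⟩ => ⟨S₁, S₂, h1, h2, h3, h.trans h4, h5⟩

/-- Finiteness of the filtration, which makes the successive approximation in `exists_ceD_eq` stop.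
-/
lemma ceFil_eq_bot (U : Finset A) {p : ℕ} (t n : ℕ) {S : Finset A} (h : S.card < p) :
    ceFil U p t n S = ⊥ := by
  rw [ceFil, Submodule.span_eq_bot]
  rintro _ ⟨S₁, S₂, hd, rfl, -, hp, -⟩
  exact absurd (card_le_card (subset_union_left (s₁ := S₁) (s₂ := S₂))) (by omega)

lemma tmul_mem_ceFil {U : Finset A} {p t n : ℕ} {S T : Finset A} (h : Disjoint S T) (hU : U ⊆ S)
    (hp : p ≤ S.card) {z : TPow n (FreeLieAlgebra ℚ A)} (hz : z ∈ catLieSub n S)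
    {ω : ExteriorAlgebra ℚ (FreeLieAlgebra ℚ A)} (hω : ω ∈ extLieSub t T) :
    z ⊗ₜ ω ∈ ceFil U p t n (S ∪ T) :=
  Submodule.subset_span ⟨S, T, h, rfl, hU, hp, z, hz, ω, hω, rfl⟩

lemma wedge_mem_ceFil {U : Finset A} {p t n : ℕ} {S T : Finset A} (h : Disjoint S T)
    {k : CESp n (FreeLieAlgebra ℚ A)} (hk : k ∈ ceFil U p t n S)
    {x : FreeLieAlgebra ℚ A} (hx : x ∈ lieOp T) :
    wedge n x k ∈ ceFil U p (t + 1) n (S ∪ T) := by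
  induction hk using Submodule.span_induction with
  | zero => simp
  | add a b _ _ ha hb => rw [map_add]; exact add_mem ha hb
  | smul r a _ ha => rw [map_smul]; exact Submodule.smul_mem _ r ha
  | mem k hk =>
    obtain ⟨S₁, S₂, hd, rfl, hU, hp, z, hz, ω, hω, rfl⟩ := hk
    rw [disjoint_union_left] at h
    rw [wedge_tmul, union_assoc]
    exact tmul_mem_ceFil (disjoint_union_right.2 ⟨hd, h.1⟩) hU hp hz (ι_mul_mem h.2 hω hx)

/-- Each term of `actD` moves one Lie factor from Λ into the coefficients, and this factor brings at
least one new letter. -/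
lemma actD_tmul_mem {U : Finset A} {p t n : ℕ} {S T : Finset A} (h : Disjoint S T) (hU : U ⊆ S)
    (hp : p ≤ S.card) {z : TPow n (FreeLieAlgebra ℚ A)} (hz : z ∈ catLieSub n S)
    {ω : ExteriorAlgebra ℚ (FreeLieAlgebra ℚ A)} (hω : ω ∈ extLieSub (t + 1) T) :
    actD n (z ⊗ₜ ω) ∈ ceFil U (p + 1) t n (S ∪ T) := by
  have main : ∀ (t : ℕ) (S' T' : Finset A), Disjoint S' T' → Disjoint S (S' ∪ T') →
      ∀ ω' ∈ extLieSub t S', ∀ x ∈ lieOp T',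
      LinearMap.rTensor _ (adAct n x) (z ⊗ₜ[ℚ] ω') ∈ ceFil U (p + 1) t n (S ∪ (S' ∪ T')) := by
    intro t S' T' hd h ω' hω' x hx
    rw [disjoint_union_right] at h
    -- The strict increase comes from here: a factor with no letters is zero, and any other factor
    -- adds at least one letter to the coefficients.
    rcases T'.eq_empty_or_nonempty with rfl | hT
    · rw [lieOp_empty, Submodule.mem_bot] at hx
      simp [hx]
    · rw [LinearMap.rTensor_tmul, union_comm S', ← union_assoc]
      refine tmul_mem_ceFil (disjoint_union_left.2 ⟨h.1, hd.symm⟩)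
        (hU.trans subset_union_left) ?_ (adAct_mem h.2 hz hx) hω'
      rw [card_union_of_disjoint h.2]
      have := hT.card_pos
      omega
  induction t generalizing T ω with
  | zero =>
    have hω' := extLieSub_succ_le 0 T hω
    clear hω
    induction hω' using Submodule.span_induction with
    | zero => simp
    | add a b _ _ ha hb => rw [TensorProduct.tmul_add, map_add]; exact add_mem ha hb
    | smul r a _ ha => rw [TensorProduct.tmul_smul, map_smul]; exact Submodule.smul_mem _ r ha
    | mem k hk =>
      obtain ⟨S', T', hd, rfl, ω', hω', x, hx, rfl⟩ := hk
      have h0 : actD n (z ⊗ₜ ω') = 0 := by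
        rcases extLieSub_zero hω' with rfl | ⟨_, r, rfl⟩
        · simp
        · rw [TensorProduct.tmul_smul, map_smul, actD_one, smul_zero]
      rw [← wedge_tmul, actD_wedge, h0, map_zero, sub_zero]
      exact main _ S' T' hd h ω' hω' x hx
  | succ t ih =>
    have hω' := extLieSub_succ_le (t + 1) T hω
    clear hω
    induction hω' using Submodule.span_induction with
    | zero => simp
    | add a b _ _ ha hb => rw [TensorProduct.tmul_add, map_add]; exact add_mem ha hb
    | smul r a _ ha => rw [TensorProduct.tmul_smul, map_smul]; exact Submodule.smul_mem _ r ha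
    | mem k hk =>
      obtain ⟨S', T', hd, rfl, ω', hω', x, hx, rfl⟩ := hk
      rw [← wedge_tmul, actD_wedge]
      refine sub_mem (main _ S' T' hd h ω' hω' x hx) ?_
      rw [disjoint_union_right] at h
      rw [← union_assoc]
      refine wedge_mem_ceFil (disjoint_union_left.2 ⟨h.2, hd⟩) (ih h.1 hω') hx

lemma actD_mem {U : Finset A} {p t n : ℕ} {S : Finset A} {k : CESp n (FreeLieAlgebra ℚ A)}
    (hk : k ∈ ceFil U p (t + 1) n S) : actD n k ∈ ceFil U (p + 1) t n S := by
  induction hk using Submodule.span_induction with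
  | zero => simp
  | add a b _ _ ha hb => rw [map_add]; exact add_mem ha hb
  | smul r a _ ha => rw [map_smul]; exact Submodule.smul_mem _ r ha
  | mem k hk =>
    obtain ⟨S₁, S₂, hd, rfl, hU, hp, z, hz, ω, hω, rfl⟩ := hk
    exact actD_tmul_mem hd hU hp hz hω

lemma ceD_mem_ceFil {U : Finset A} {p t n : ℕ} {S : Finset A} {k : CESp n (FreeLieAlgebra ℚ A)}
    (hk : k ∈ ceFil U p (t + 1) n S) : ceD n k ∈ ceFil U p t n S := by
  rw [ceD_eq]
  refine add_mem (ceFil_le U p.le_succ t n S (actD_mem hk)) ?_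
  induction hk using Submodule.span_induction with
  | zero => simp
  | add a b _ _ ha hb => rw [map_add]; exact add_mem ha hb
  | smul r a _ ha => rw [map_smul]; exact Submodule.smul_mem _ r ha
  | mem k hk =>
    obtain ⟨S₁, S₂, hd, rfl, hU, hp, z, hz, ω, hω, rfl⟩ := hk
    exact tmul_mem_ceFil hd hU hp hz (trivD_mem hω)

/-! ### Restriction to a subset of the letters -/

variable {g : Type} [LieRing g] [LieAlgebra ℚ g]

lemma ev_congr {S : Finset A} {v v' : A → g} (h : ∀ a ∈ S, v a = v' a) {w : FreeLieAlgebra ℚ A}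
    (hw : w ∈ lieOp S) : ev v w = ev v' w := by
  induction hw using Submodule.span_induction with
  | zero => simp
  | add a b _ _ ha hb => rw [map_add, map_add, ha, hb]
  | smul r a _ ha => rw [map_smul, map_smul, ha]
  | mem x hx =>
    change LieMon S x at hx
    induction hx with
    | of a => simpa using h a
    | lie _ _ _ hx hy =>
      rw [LieHom.map_lie, LieHom.map_lie, hx fun a ha => h a (mem_union_left _ ha),
        hy fun a ha => h a (mem_union_right _ ha)]

/-- The endomorphism of the free Lie algebra which is the identity on the letters of `S` and sends the
other letters to zero. -/
def restrictTo (S : Finset A) : FreeLieAlgebra ℚ A →ₗ⁅ℚ⁆ FreeLieAlgebra ℚ A :=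
  ev (fun a => if a ∈ S then FreeLieAlgebra.of ℚ a else 0)

lemma restrictTo_lieOp {S T : Finset A} (h : S ⊆ T) {w : FreeLieAlgebra ℚ A} (hw : w ∈ lieOp S) :
    restrictTo T w = w := by
  rw [restrictTo, ev_congr (v' := FreeLieAlgebra.of ℚ) (fun a ha => if_pos (h ha)) hw, ev_self]
  rfl

lemma tpMap_restrictTo {n : ℕ} {S T : Finset A} (h : S ⊆ T) {z : TPow n (FreeLieAlgebra ℚ A)}
    (hz : z ∈ catLieSub n S) : tpMap n (restrictTo T) z = z := by
  induction hz using Submodule.span_induction with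
  | zero => simp
  | add a b _ _ ha hb => rw [map_add, ha, hb]
  | smul r a _ ha => rw [map_smul, ha]
  | mem z hz =>
    obtain ⟨B, hB, w, hw, rfl⟩ := hz
    rw [tpMap_tprod]
    congr 1
    funext i
    exact restrictTo_lieOp (fun a ha => h ((hB.mem a).2 ⟨i, ha⟩)) (hw i)

/-- Some letter of S is sent to zero, and evaluation is linear in that letter. -/
lemma tpMap_restrictTo_of_not_subset {n : ℕ} {S T : Finset A} (h : ¬ S ⊆ T)
    {z : TPow n (FreeLieAlgebra ℚ A)} (hz : z ∈ catLieSub n S) : tpMap n (restrictTo T) z = 0 := by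
  obtain ⟨a, ha, haT⟩ := Finset.not_subset.1 h
  let v : A → FreeLieAlgebra ℚ A := fun a => if a ∈ T then FreeLieAlgebra.of ℚ a else 0
  -- The value of v at a is already zero; writing it as 0 • 0 lets homogeneity in the letter a give
  -- the vanishing.
  have hv : Function.update v a ((0 : ℚ) • 0) = v := by
    rw [smul_zero]
    exact Function.update_eq_self_iff.2 (if_neg haT).symm
  have := (mlOn_catLieSub n hz).smul v a ha 0 0
  rw [hv, zero_smul] at this
  exact this

lemma restrictTo_of_not_subset {S T : Finset A} (h : ¬ S ⊆ T) {w : FreeLieAlgebra ℚ A}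
    (hw : w ∈ lieOp S) : restrictTo T w = 0 := by
  obtain ⟨a, ha, haT⟩ := Finset.not_subset.1 h
  let v : A → FreeLieAlgebra ℚ A := fun a => if a ∈ T then FreeLieAlgebra.of ℚ a else 0
  have hv : Function.update v a ((0 : ℚ) • 0) = v := by
    rw [smul_zero]
    exact Function.update_eq_self_iff.2 (if_neg haT).symm
  have := (mlOn_lieOp hw).smul v a ha 0 0
  rw [hv, zero_smul] at this
  exact this

/-- The projection of `⨁_{S₁} 𝐂𝐚𝐭𝔏𝔦𝔢(S₁, n) ⊗ (Λ^t 𝔏𝔦𝔢)(S₂)` on the sum of the terms for which `S₁ ⊆ T`. -/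
def coeffProj (n : ℕ) (T : Finset A) :
    CESp n (FreeLieAlgebra ℚ A) →ₗ[ℚ] CESp n (FreeLieAlgebra ℚ A) :=
  LinearMap.rTensor _ (tpMap n (restrictTo T))

/-- A set with at least as many elements as T is contained in T only if it equals T. So on the p-th
step of the filtration the projections for the sets T of size p pick out the individual summands of
the associated graded piece. -/
lemma coeffProj_tmul {n p : ℕ} {S T : Finset A} (hT : T.card = p) (hS : p ≤ S.card)
    {z : TPow n (FreeLieAlgebra ℚ A)} (hz : z ∈ catLieSub n S)
    (ω : ExteriorAlgebra ℚ (FreeLieAlgebra ℚ A)) :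
    coeffProj n T (z ⊗ₜ ω) = if T = S then z ⊗ₜ ω else 0 := by
  rw [coeffProj, LinearMap.rTensor_tmul]
  split_ifs with h
  · rw [h, tpMap_restrictTo (subset_refl _) hz]
  · rw [tpMap_restrictTo_of_not_subset (fun h' => h (eq_of_subset_of_card_le h' (by omega)).symm) hz,
      TensorProduct.zero_tmul]

lemma coeffProj_eq_zero {U : Finset A} {p t n : ℕ} {S T : Finset A} (hT : T.card < p)
    {k : CESp n (FreeLieAlgebra ℚ A)} (hk : k ∈ ceFil U p t n S) : coeffProj n T k = 0 := by
  induction hk using Submodule.span_induction with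
  | zero => simp
  | add a b _ _ ha hb => rw [map_add, ha, hb, add_zero]
  | smul r a _ ha => rw [map_smul, ha, smul_zero]
  | mem k hk =>
    obtain ⟨S₁, S₂, hd, rfl, hU, hp, z, hz, ω, hω, rfl⟩ := hk
    rw [coeffProj_tmul rfl (by omega) hz, if_neg]
    rintro rfl
    omega

lemma coeffProj_mem {U : Finset A} {p t n : ℕ} {S T : Finset A} (hT : T.card = p)
    {k : CESp n (FreeLieAlgebra ℚ A)} (hk : k ∈ ceFil U p t n S) :
    coeffProj n T k ∈ Submodule.span ℚ {k | ∃ z ∈ catLieSub n T, ∃ ω ∈ extLieSub t (S \ T),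
      k = z ⊗ₜ[ℚ] ω} := by
  induction hk using Submodule.span_induction with
  | zero => simp
  | add a b _ _ ha hb => rw [map_add]; exact add_mem ha hb
  | smul r a _ ha => rw [map_smul]; exact Submodule.smul_mem _ r ha
  | mem k hk =>
    obtain ⟨S₁, S₂, hd, rfl, hU, hp, z, hz, ω, hω, rfl⟩ := hk
    rw [coeffProj_tmul hT (by omega) hz]
    split_ifs with h
    · subst h
      refine Submodule.subset_span ⟨z, hz, ω, ?_, rfl⟩
      rwa [union_sdiff_cancel_left hd]
    · exact zero_mem _

/-- Subtracting the components with exactly p letters in the coefficients leaves those with more. -/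
lemma sub_sum_coeffProj_mem {U : Finset A} {p t n : ℕ} {S : Finset A}
    {k : CESp n (FreeLieAlgebra ℚ A)} (hk : k ∈ ceFil U p t n S) :
    k - ∑ T ∈ (S.powersetCard p).filter (U ⊆ ·), coeffProj n T k ∈ ceFil U (p + 1) t n S := by
  induction hk using Submodule.span_induction with
  | zero => simp
  | add a b _ _ ha hb =>
    simp only [map_add, sum_add_distrib, add_sub_add_comm]
    exact add_mem ha hb
  | smul r a _ ha =>
    simp only [map_smul, ← smul_sum, ← smul_sub]
    exact Submodule.smul_mem _ r ha
  | mem k hk =>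
    obtain ⟨S₁, S₂, hd, rfl, hU, hp, z, hz, ω, hω, rfl⟩ := hk
    rw [sum_congr rfl fun T hT => coeffProj_tmul
      (mem_powersetCard.1 (mem_filter.1 hT).1).2 hp hz ω, sum_ite_eq']
    split_ifs with h
    · simp
    · rw [sub_zero]
      refine tmul_mem_ceFil hd hU ?_ hz hω
      refine lt_of_le_of_ne hp fun hc => h ?_
      exact mem_filter.2 ⟨mem_powersetCard.2 ⟨subset_union_left, hc.symm⟩, hU⟩

end Filtration

/-- Over a field, a linear section of the corestriction to the range extends to the whole target. It
serves to choose preimages linearly, hence compatibly with tensor products. -/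
lemma exists_generalizedInverse {V W : Type} [AddCommGroup V] [Module ℚ V] [AddCommGroup W]
    [Module ℚ W] (f : V →ₗ[ℚ] W) : ∃ g : W →ₗ[ℚ] V, ∀ v, f (g (f v)) = f v := by
  obtain ⟨s, hs⟩ := f.rangeRestrict.exists_rightInverse_of_surjective f.range_rangeRestrict
  obtain ⟨g, hg⟩ := s.exists_extend
  refine ⟨g, fun v => ?_⟩
  have h1 : g (f v) = s (f.rangeRestrict v) := LinearMap.congr_fun hg (f.rangeRestrict v)
  rw [h1]
  exact congrArg Subtype.val (LinearMap.congr_fun hs (f.rangeRestrict v))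

/-! ### From trivial coefficients to general coefficients; reduction to letters in degree one -/

section Acyclicity

open Finset

variable {A : Type} [DecidableEq A]

/-- Exactness in one degree is turned into a contracting homotopy by linear maps defined on all of Λ
L, a form which can be tensored with the coefficients. -/
lemma exists_homotopy {t : ℕ} {S : Finset A}
    (h : ∀ ω ∈ extLieSub (t + 1) S, trivD ω = 0 → ∃ ω' ∈ extLieSub (t + 2) S, trivD ω' = ω) :
    ∃ p q : ExteriorAlgebra ℚ (FreeLieAlgebra ℚ A) →ₗ[ℚ]
        ExteriorAlgebra ℚ (FreeLieAlgebra ℚ A),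
      ∀ ω ∈ extLieSub (t + 1) S, p ω ∈ extLieSub (t + 2) S ∧ trivD (p ω) + q (trivD ω) = ω := by
  obtain ⟨g, hg⟩ := exists_generalizedInverse (trivD ∘ₗ (extLieSub (t + 1) S).subtype)
  obtain ⟨g', hg'⟩ := exists_generalizedInverse (trivD ∘ₗ (extLieSub (t + 2) S).subtype)
  let q := (extLieSub (t + 1) S).subtype ∘ₗ g
  let p := (extLieSub (t + 2) S).subtype ∘ₗ g' ∘ₗ (LinearMap.id - q ∘ₗ trivD)
  refine ⟨p, q, fun ω hω => ⟨(g' _).2, ?_⟩⟩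
  -- Since q is a generalized inverse of `trivD` on degree t + 1, this difference is a cycle, hence
  -- a boundary by hypothesis; p is the generalized inverse on degree t + 2 applied to it.
  have h1 : trivD (ω - q (trivD ω)) = 0 := by
    rw [map_sub, sub_eq_zero]
    exact (hg ⟨ω, hω⟩).symm
  obtain ⟨ω', hω', he⟩ := h _ (sub_mem hω (g (trivD ω)).2) h1
  have h2 : trivD (p ω) = ω - q (trivD ω) := by
    have := hg' ⟨ω', hω'⟩
    simp only [LinearMap.comp_apply, Submodule.subtype_apply, he] at this
    exact this
  rw [h2, sub_add_cancel]

lemma lTensor_homotopy_mem {t n : ℕ} {S T : Finset A}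
    {P Q : ExteriorAlgebra ℚ (FreeLieAlgebra ℚ A) →ₗ[ℚ] ExteriorAlgebra ℚ (FreeLieAlgebra ℚ A)}
    (h : ∀ ω ∈ extLieSub (t + 1) T, P ω ∈ extLieSub (t + 2) T ∧ trivD (P ω) + Q (trivD ω) = ω)
    (hd : Disjoint S T) {U : Finset A} (hU : U ⊆ S) {k : CESp n (FreeLieAlgebra ℚ A)}
    (hk : k ∈ Submodule.span ℚ {k | ∃ z ∈ catLieSub n S, ∃ ω ∈ extLieSub (t + 1) T,
      k = z ⊗ₜ[ℚ] ω}) :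
    LinearMap.lTensor _ P k ∈ ceFil U S.card (t + 2) n (S ∪ T) ∧
      LinearMap.lTensor _ trivD (LinearMap.lTensor _ P k) +
        LinearMap.lTensor _ Q (LinearMap.lTensor _ trivD k) = k := by
  induction hk using Submodule.span_induction with
  | zero => simp
  | add a b _ _ ha hb =>
    simp only [map_add]
    rw [add_add_add_comm, ha.2, hb.2]
    exact ⟨add_mem ha.1 hb.1, rfl⟩
  | smul r a _ ha =>
    simp only [map_smul]
    rw [← smul_add, ha.2]
    exact ⟨Submodule.smul_mem _ r ha.1, rfl⟩
  | mem k hk =>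
    obtain ⟨z, hz, ω, hω, rfl⟩ := hk
    simp only [LinearMap.lTensor_tmul]
    rw [← TensorProduct.tmul_add, (h ω hω).2]
    exact ⟨tmul_mem_ceFil hd hU le_rfl hz (h ω hω).1, rfl⟩

lemma lTensor_coeffProj {n : ℕ} (T : Finset A)
    (f : ExteriorAlgebra ℚ (FreeLieAlgebra ℚ A) →ₗ[ℚ] ExteriorAlgebra ℚ (FreeLieAlgebra ℚ A))
    (k : CESp n (FreeLieAlgebra ℚ A)) :
    LinearMap.lTensor _ f (coeffProj n T k) = coeffProj n T (LinearMap.lTensor _ f k) := by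
  induction k using TensorProduct.induction_on with
  | zero => simp
  | add a b h h' => simp only [map_add, h, h']
  | tmul z ω => rfl

/-- The leading component of a cycle at T is a cycle for 1 ⊗ `trivD`, and the homotopy, tensored
with the coefficients, provides a primitive for it. -/
lemma exists_lTensor_trivD_eq {U S T : Finset A} {t : ℕ}
    (h : ∀ ω ∈ extLieSub (t + 1) (S \ T), trivD ω = 0 →
      ∃ ω' ∈ extLieSub (t + 2) (S \ T), trivD ω' = ω) (hTS : T ⊆ S) (hUT : U ⊆ T) {n : ℕ}
    {k : CESp n (FreeLieAlgebra ℚ A)} (hk : k ∈ ceFil U T.card (t + 1) n S) (hd : ceD n k = 0) :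
    ∃ l ∈ ceFil U T.card (t + 2) n S, LinearMap.lTensor _ trivD l = coeffProj n T k := by
  obtain ⟨P, Q, hPQ⟩ := exists_homotopy h
  obtain ⟨h1, h2⟩ := lTensor_homotopy_mem hPQ disjoint_sdiff hUT (coeffProj_mem rfl hk)
  rw [union_sdiff_of_subset hTS] at h1
  refine ⟨_, h1, ?_⟩
  have h3 : LinearMap.lTensor _ trivD (coeffProj n T k) = 0 := by
    -- As d k = 0, the two parts of the differential of k are opposite; the `actD` part has more
    -- than |T| letters in the coefficients, so the projection at T kills it.
    have h4 : LinearMap.lTensor _ trivD k = - actD n k :=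
      eq_neg_of_add_eq_zero_right ((ceD_eq n k).symm.trans hd)
    rw [lTensor_coeffProj, h4, map_neg,
      coeffProj_eq_zero (Nat.lt_succ_self _) (actD_mem hk), neg_zero]
  rwa [h3, map_zero, add_zero] at h2

/-- One step of the successive approximation: primitives of all leading components are added up, and
the resulting boundary agrees with the cycle modulo the next step of the filtration. The hypothesis
only concerns sets disjoint from U because the letters of U stay in the coefficients. -/
lemma exists_sub_ceD_mem {U S : Finset A} {t : ℕ}
    (h : ∀ T ⊆ S \ U, ∀ ω ∈ extLieSub (t + 1) T, trivD ω = 0 →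
      ∃ ω' ∈ extLieSub (t + 2) T, trivD ω' = ω) {n p : ℕ}
    {k : CESp n (FreeLieAlgebra ℚ A)} (hk : k ∈ ceFil U p (t + 1) n S) (hd : ceD n k = 0) :
    ∃ l ∈ ceFil U p (t + 2) n S, k - ceD n l ∈ ceFil U (p + 1) (t + 1) n S := by
  have key : ∀ T ∈ (S.powersetCard p).filter (U ⊆ ·), ∃ l ∈ ceFil U p (t + 2) n S,
      LinearMap.lTensor _ trivD l = coeffProj n T k := by
    intro T hT
    obtain ⟨h1, hUT⟩ := mem_filter.1 hT
    obtain ⟨hTS, rfl⟩ := mem_powersetCard.1 h1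
    exact exists_lTensor_trivD_eq (h _ (sdiff_subset_sdiff subset_rfl hUT)) hTS hUT hk hd
  choose! l hl he using key
  have hs := sum_mem hl
  refine ⟨_, hs, ?_⟩
  -- The error has two sources, both of higher filtration: the non-leading components of k, and the
  -- `actD` part of the boundary.
  have h1 : k - ceD n (∑ T ∈ (S.powersetCard p).filter (U ⊆ ·), l T) =
      (k - ∑ T ∈ (S.powersetCard p).filter (U ⊆ ·), coeffProj n T k) -
        actD n (∑ T ∈ (S.powersetCard p).filter (U ⊆ ·), l T) := by
    rw [ceD_eq, map_sum (LinearMap.lTensor _ trivD), sum_congr rfl he, add_comm, sub_sub]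
  have h2 := sub_mem (sub_sum_coeffProj_mem hk) (actD_mem hs)
  rw [← h1] at h2
  exact h2

/-- Iterate `exists_sub_ceD_mem`; the remainder is still a cycle, and it is zero once p exceeds the
number of letters. -/
lemma exists_ceD_eq {U S : Finset A} {t : ℕ}
    (h : ∀ T ⊆ S \ U, ∀ ω ∈ extLieSub (t + 1) T, trivD ω = 0 →
      ∃ ω' ∈ extLieSub (t + 2) T, trivD ω' = ω) {n p : ℕ}
    {k : CESp n (FreeLieAlgebra ℚ A)} (hk : k ∈ ceFil U p (t + 1) n S) (hd : ceD n k = 0) :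
    ∃ l ∈ ceFil U p (t + 2) n S, ceD n l = k := by
  induction hj : S.card + 1 - p generalizing p k with
  | zero =>
    rw [ceFil_eq_bot U _ n (by omega), Submodule.mem_bot] at hk
    exact ⟨0, zero_mem _, by rw [hk, map_zero]⟩
  | succ j ih =>
    obtain ⟨l, hl, hkl⟩ := exists_sub_ceD_mem h hk hd
    obtain ⟨l', hl', he⟩ := ih hkl (by rw [map_sub, hd, ceD_ceD, sub_zero]) (by omega)
    exact ⟨l + l', add_mem hl (ceFil_le U p.le_succ _ n S hl'), by rw [map_add, he]; abel⟩

/-- Modulo boundaries, the elements of degree one are sums of elements `z ⊗ a` with `a` a letter. -/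
lemma exists_letters_add_ceD {U S : Finset A} {n : ℕ} {k : CESp n (FreeLieAlgebra ℚ A)}
    (hk : k ∈ ceFil U 0 1 n S) :
    ∃ z : A → TPow n (FreeLieAlgebra ℚ A),
      (∀ a, z a ∈ ⨆ _ : a ∈ S ∧ U ⊆ S.erase a, catLieSub n (S.erase a)) ∧
      ∃ l ∈ ceFil U 0 2 n S, k = ∑ a ∈ S, z a ⊗ₜ ExteriorAlgebra.ι ℚ (FreeLieAlgebra.of ℚ a) +
        ceD n l := by
  induction hk using Submodule.span_induction with
  | zero => exact ⟨0, fun _ => zero_mem _, 0, zero_mem _, by simp⟩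
  | add k k' _ _ h h' =>
    obtain ⟨z, hz, l, hl, rfl⟩ := h
    obtain ⟨z', hz', l', hl', rfl⟩ := h'
    refine ⟨z + z', fun a => add_mem (hz a) (hz' a), l + l', add_mem hl hl', ?_⟩
    simp only [Pi.add_apply, TensorProduct.add_tmul, sum_add_distrib, map_add]
    abel
  | smul r k _ h =>
    obtain ⟨z, hz, l, hl, rfl⟩ := h
    refine ⟨r • z, fun a => Submodule.smul_mem _ r (hz a), r • l, Submodule.smul_mem _ r hl, ?_⟩
    simp only [Pi.smul_apply, ← TensorProduct.smul_tmul', ← smul_sum, map_smul, smul_add]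
  | mem k hk =>
    obtain ⟨S₁, S₂, hd, rfl, hU, -, z, hz, ω, hω, rfl⟩ := hk
    have hω' := extLieSub_succ_le 0 S₂ hω
    clear hω
    induction hω' using Submodule.span_induction with
    | zero => exact ⟨0, fun _ => zero_mem _, 0, zero_mem _, by simp⟩
    | add k k' _ _ h h' =>
      obtain ⟨z, hz, l, hl, h⟩ := h
      obtain ⟨z', hz', l', hl', h'⟩ := h'
      refine ⟨z + z', fun a => add_mem (hz a) (hz' a), l + l', add_mem hl hl', ?_⟩
      simp only [Pi.add_apply, TensorProduct.add_tmul, sum_add_distrib, map_add,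
        TensorProduct.tmul_add, h, h']
      abel
    | smul r k _ h =>
      obtain ⟨z, hz, l, hl, h⟩ := h
      refine ⟨r • z, fun a => Submodule.smul_mem _ r (hz a), r • l, Submodule.smul_mem _ r hl, ?_⟩
      simp only [Pi.smul_apply, ← TensorProduct.smul_tmul', ← smul_sum, map_smul,
        TensorProduct.tmul_smul, h, smul_add]
    | mem ω hω =>
      obtain ⟨S', T, hd', rfl, ω', hω', x, hx, rfl⟩ := hω
      rcases extLieSub_zero hω' with rfl | ⟨rfl, r, rfl⟩
      · exact ⟨0, fun _ => zero_mem _, 0, zero_mem _, by simp⟩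
      -- Degree zero of Λ is made of scalars; the scalar is absorbed in the coefficient, so that the
      -- generator has the form z ⊗ x with x in the Lie operad part.
      rw [mul_smul_comm, mul_one, ← TensorProduct.smul_tmul]
      rw [empty_union] at hd ⊢
      have hrz := Submodule.smul_mem _ r hz
      clear hz
      generalize r • z = z at hrz ⊢
      induction hx using Submodule.span_induction with
      | zero => exact ⟨0, fun _ => zero_mem _, 0, zero_mem _, by simp⟩
      | add k k' _ _ h h' =>
        obtain ⟨z, hz, l, hl, h⟩ := h
        obtain ⟨z', hz', l', hl', h'⟩ := h'
        refine ⟨z + z', fun a => add_mem (hz a) (hz' a), l + l', add_mem hl hl', ?_⟩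
        simp only [Pi.add_apply, TensorProduct.add_tmul, sum_add_distrib, map_add,
          TensorProduct.tmul_add, h, h']
        abel
      | smul r k _ h =>
        obtain ⟨z, hz, l, hl, h⟩ := h
        refine ⟨r • z, fun a => Submodule.smul_mem _ r (hz a), r • l,
          Submodule.smul_mem _ r hl, ?_⟩
        simp only [Pi.smul_apply, ← TensorProduct.smul_tmul', ← smul_sum, map_smul,
          TensorProduct.tmul_smul, h, smul_add]
      | mem x hx =>
        change LieMon T x at hx
        clear hd' hω'
        -- The coefficient and its letters must vary: breaking a bracket moves one of its two
        -- factors into the coefficient.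
        induction hx generalizing S₁ z with
        | of a =>
          have haS : a ∉ S₁ := by simpa using hd
          refine ⟨Pi.single a z, fun b => ?_, 0, zero_mem _, ?_⟩
          · rcases eq_or_ne b a with rfl | hb
            · have he : (S₁ ∪ {b}).erase b = S₁ := by
                rw [union_comm, ← insert_eq, erase_insert haS]
              rw [Pi.single_eq_same, he]
              exact Submodule.mem_iSup_of_mem ⟨by simp, hU⟩ hrz
            · rw [Pi.single_eq_of_ne hb]; exact zero_mem _
          · rw [map_zero, add_zero, sum_eq_single a]
            · rw [Pi.single_eq_same]
            · intro b _ hb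
              rw [Pi.single_eq_of_ne hb, TensorProduct.zero_tmul]
            · simp
        | @lie T₁ T₂ x y hx hy h ihx ihy =>
          rw [disjoint_union_right] at hd
          have hx' := Submodule.subset_span (R := ℚ) hx
          have hy' := Submodule.subset_span (R := ℚ) hy
          -- Modulo d(z ⊗ x ∧ y), the element z ⊗ [x, y] is z·x ⊗ y - z·y ⊗ x, and both terms have a
          -- shorter monomial in the Λ factor.
          obtain ⟨z₁, hz₁, l₁, hl₁, h₁⟩ := ihy _ (hU.trans subset_union_left)
            (disjoint_union_left.2 ⟨hd.2, h⟩) _ (adAct_mem hd.1 hrz hx')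
          obtain ⟨z₂, hz₂, l₂, hl₂, h₂⟩ := ihx _ (hU.trans subset_union_left)
            (disjoint_union_left.2 ⟨hd.1, h.symm⟩) _ (adAct_mem hd.2 hrz hy')
          rw [union_assoc] at hz₁ hl₁ h₁
          rw [union_assoc, union_comm T₂] at hz₂ hl₂ h₂
          have h1 : ExteriorAlgebra.ι ℚ x * (ExteriorAlgebra.ι ℚ y * 1) ∈
              extLieSub 2 (T₁ ∪ T₂) := by
            have := ι_mul_mem (t := 0) (S := ∅) (disjoint_empty_left T₂)
              (Submodule.subset_span ⟨Fin.elim0, ⟨fun i => i.elim0, rfl⟩, Fin.elim0,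
                fun i => i.elim0, rfl⟩) hy'
            rw [ExteriorAlgebra.ιMulti_zero_apply, empty_union] at this
            rw [union_comm]
            exact ι_mul_mem h.symm this hx'
          rw [mul_one] at h1
          refine ⟨z₁ - z₂, fun a => sub_mem (hz₁ a) (hz₂ a), l₁ - l₂ - z ⊗ₜ
            (ExteriorAlgebra.ι ℚ x * ExteriorAlgebra.ι ℚ y), sub_mem (sub_mem hl₁ hl₂)
            (tmul_mem_ceFil (disjoint_union_right.2 hd) hU (Nat.zero_le _) hrz h1), ?_⟩
          rw [map_sub, map_sub, ceD_deg_two, h₁, h₂]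
          simp only [Pi.sub_apply, TensorProduct.sub_tmul, sum_sub_distrib]
          abel

end Acyclicity

/-! ### Coefficients in the adjoint representation and wedging the coefficient into Λ -/

section DistinguishedFactor

variable {g : Type} [LieRing g] [LieAlgebra ℚ g]

/-- The identification `g^{⊗ 1} = g`. -/
def tpowOne : TPow 1 g ≃ₗ[ℚ] g :=
  PiTensorProduct.subsingletonEquiv (R := ℚ) (s := fun _ : Fin 1 => g) 0

lemma tpowOne_tprod (v : Fin 1 → g) : tpowOne (PiTensorProduct.tprod ℚ v) = v 0 :=
  PiTensorProduct.subsingletonEquiv_apply_tprod _ _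

lemma tpowOne_symm (x : g) : tpowOne.symm x = PiTensorProduct.tprod ℚ (fun _ : Fin 1 => x) :=
  (LinearEquiv.symm_apply_eq _).2 (tpowOne_tprod (fun _ : Fin 1 => x)).symm

lemma tpowOne_adAct (x : g) (z : TPow 1 g) : tpowOne (adAct 1 x z) = ⁅tpowOne z, x⁆ := by
  obtain ⟨y, rfl⟩ := tpowOne.symm.surjective z
  rw [tpowOne_symm, adAct_tprod, tpowOne_tprod]
  simp [tpowOne_tprod]

/-- The map `g ⊗ Λ^* g → Λ^* g`, `z ⊗ ω ↦ z ∧ ω`. -/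
def wedgeIn : CESp 1 g →ₗ[ℚ] ExteriorAlgebra ℚ g :=
  TensorProduct.lift (LinearMap.mul ℚ (ExteriorAlgebra ℚ g) ∘ₗ ExteriorAlgebra.ι ℚ ∘ₗ
    tpowOne.toLinearMap)

@[simp] lemma wedgeIn_tmul (z : TPow 1 g) (ω : ExteriorAlgebra ℚ g) :
    wedgeIn (z ⊗ₜ ω) = ExteriorAlgebra.ι ℚ (tpowOne z) * ω := rfl

lemma wedgeIn_wedge (x : g) (k : CESp 1 g) :
    wedgeIn (wedge 1 x k) = - (ExteriorAlgebra.ι ℚ x * wedgeIn k) := by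
  induction k using TensorProduct.induction_on with
  | zero => simp
  | add a b h h' => simp only [map_add, h, h', mul_add, neg_add]
  | tmul z ω =>
    have h := ExteriorAlgebra.ι_add_mul_swap (R := ℚ) (tpowOne z) x
    rw [wedge_tmul, wedgeIn_tmul, wedgeIn_tmul, ← mul_assoc, ← mul_assoc,
      eq_neg_of_add_eq_zero_left h, neg_mul]

lemma wedgeIn_diagAct (x : g) (k : CESp 1 g) :
    wedgeIn (diagAct 1 x k) = extAct x (wedgeIn k) := by
  induction k using TensorProduct.induction_on with
  | zero => simp
  | add a b h h' => simp only [map_add, h, h']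
  | tmul z ω => rw [diagAct_tmul, map_add, wedgeIn_tmul, wedgeIn_tmul, wedgeIn_tmul, extAct_ι_mul,
      tpowOne_adAct]

/-- Bracketing a factor of Λ into the coefficient becomes, after wedging, the part of `trivD` which
brackets that factor with the front one. The sign appears because a factor now has to pass the front
one (`wedgeIn_wedge`). -/
lemma wedgeIn_ceD (k : CESp 1 g) : wedgeIn (ceD 1 k) = - trivD (wedgeIn k) := by
  induction k using ce_induction with
  | ha a b h h' => simp only [map_add, h, h', neg_add]
  | h1 z => rw [ceD_one, map_zero, wedgeIn_tmul, trivD_ι_mul, trivD_one, extAct_one]; simp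
  | hw x k h =>
    rw [ceD_wedge, map_sub, wedgeIn_diagAct, wedgeIn_wedge, h, wedgeIn_wedge, map_neg, trivD_ι_mul]
    simp

end DistinguishedFactor

-- The coordinate functionals of a basis of the first factor determine a tensor.
open scoped Classical in
lemma tensor_eq_zero {V W : Type} [AddCommGroup V] [Module ℚ V] [AddCommGroup W] [Module ℚ W]
    (k : V ⊗[ℚ] W)
    (h : ∀ d : Module.Dual ℚ V, TensorProduct.lid ℚ W (LinearMap.rTensor W d k) = 0) : k = 0 := by
  let b := Module.Basis.ofVectorSpace ℚ V
  apply (TensorProduct.equivFinsuppOfBasisLeft (N := W) b).injective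
  rw [map_zero]
  ext i
  have : ∀ k : V ⊗[ℚ] W, TensorProduct.equivFinsuppOfBasisLeft b k i =
      TensorProduct.lid ℚ W (LinearMap.rTensor W (b.coord i) k) := by
    intro k
    induction k using TensorProduct.induction_on with
    | zero => simp
    | add a b h h' => simp only [map_add, Finsupp.add_apply, h, h']
    | tmul z ω => simp
  rw [this, h]
  rfl

/-! ### Isolating the Lie factor which contains a chosen letter -/

section Acyclicity

open Finset

variable {A : Type} [DecidableEq A]

lemma tpowOne_symm_mem {S : Finset A} {x : FreeLieAlgebra ℚ A} (hx : x ∈ lieOp S) :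
    tpowOne.symm x ∈ catLieSub 1 S := by
  rw [tpowOne_symm]
  exact Submodule.subset_span ⟨fun _ => S, ⟨fun i j h => absurd (Subsingleton.elim i j) h,
    by simp⟩, _, fun _ => hx, rfl⟩

lemma tpowOne_mem {S : Finset A} {z : TPow 1 (FreeLieAlgebra ℚ A)} (hz : z ∈ catLieSub 1 S) :
    tpowOne z ∈ lieOp S := by
  induction hz using Submodule.span_induction with
  | zero => simp
  | add a b _ _ ha hb => rw [map_add]; exact add_mem ha hb
  | smul r a _ ha => rw [map_smul]; exact Submodule.smul_mem _ r ha
  | mem z hz =>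
    obtain ⟨B, hB, w, hw, rfl⟩ := hz
    rw [tpowOne_tprod]
    have : B 0 = S := by rw [← hB.cover]; simp
    rw [← this]
    exact hw 0

/-- The factor containing s can be moved to the front. If it is the first one, it becomes the
coefficient; otherwise one recurses, and passing the first factor costs a sign. -/
lemma exists_wedgeIn_eq {t : ℕ} {S : Finset A} {s : A} (hs : s ∈ S)
    {ω : ExteriorAlgebra ℚ (FreeLieAlgebra ℚ A)} (hω : ω ∈ extLieSub (t + 1) S) :
    ∃ k ∈ ceFil {s} 0 t 1 S, wedgeIn k = ω := by
  induction t generalizing S ω with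
  | zero =>
    have hω' := extLieSub_succ_le 0 S hω
    clear hω
    induction hω' using Submodule.span_induction with
    | zero => exact ⟨0, zero_mem _, map_zero _⟩
    | add a b _ _ ha hb =>
      obtain ⟨k, hk, rfl⟩ := ha
      obtain ⟨l, hl, rfl⟩ := hb
      exact ⟨k + l, add_mem hk hl, map_add _ _ _⟩
    | smul r a _ ha =>
      obtain ⟨k, hk, rfl⟩ := ha
      exact ⟨r • k, Submodule.smul_mem _ r hk, map_smul _ _ _⟩
    | mem ω hω =>
      obtain ⟨S', T, hd, rfl, ω', hω', x, hx, rfl⟩ := hω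
      rcases extLieSub_zero hω' with rfl | ⟨rfl, -⟩
      · exact ⟨0, zero_mem _, by simp⟩
      · refine ⟨tpowOne.symm x ⊗ₜ ω', ?_, by simp⟩
        rw [union_comm]
        exact tmul_mem_ceFil hd.symm (by simpa using hs) (Nat.zero_le _) (tpowOne_symm_mem hx) hω'
  | succ t ih =>
    have hω' := extLieSub_succ_le (t + 1) S hω
    clear hω
    induction hω' using Submodule.span_induction with
    | zero => exact ⟨0, zero_mem _, map_zero _⟩
    | add a b _ _ ha hb =>
      obtain ⟨k, hk, rfl⟩ := ha
      obtain ⟨l, hl, rfl⟩ := hb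
      exact ⟨k + l, add_mem hk hl, map_add _ _ _⟩
    | smul r a _ ha =>
      obtain ⟨k, hk, rfl⟩ := ha
      exact ⟨r • k, Submodule.smul_mem _ r hk, map_smul _ _ _⟩
    | mem ω hω =>
      obtain ⟨S', T, hd, rfl, ω', hω', x, hx, rfl⟩ := hω
      rcases mem_union.1 hs with hs | hs
      · obtain ⟨k, hk, rfl⟩ := ih hs hω'
        exact ⟨- wedge 1 x k, neg_mem (wedge_mem_ceFil hd hk hx), by
          rw [map_neg, wedgeIn_wedge, neg_neg]⟩
      · refine ⟨tpowOne.symm x ⊗ₜ ω', ?_, by simp⟩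
        rw [union_comm]
        exact tmul_mem_ceFil hd.symm (by simpa using hs) (Nat.zero_le _) (tpowOne_symm_mem hx) hω'

/-- Contraction is an antiderivation, and the functional vanishes on every factor. -/
lemma contractLeft_eq_zero {t : ℕ} {S : Finset A} {d : Module.Dual ℚ (FreeLieAlgebra ℚ A)}
    (h : ∀ T ⊆ S, ∀ x ∈ lieOp T, d x = 0) {ω : ExteriorAlgebra ℚ (FreeLieAlgebra ℚ A)}
    (hω : ω ∈ extLieSub t S) :
    CliffordAlgebra.contractLeft (Q := (0 : QuadraticForm ℚ (FreeLieAlgebra ℚ A))) d ω = 0 := by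
  induction t generalizing S ω with
  | zero =>
    rcases extLieSub_zero hω with rfl | ⟨rfl, r, rfl⟩
    · exact map_zero _
    · rw [map_smul]
      exact (congrArg (r • ·) (CliffordAlgebra.contractLeft_one _ d)).trans (smul_zero r)
  | succ t ih =>
    have hω' := extLieSub_succ_le t S hω
    clear hω
    induction hω' using Submodule.span_induction with
    | zero => exact map_zero _
    | add a b _ _ ha hb => rw [map_add, ha, hb, add_zero]
    | smul r a _ ha => rw [map_smul, ha, smul_zero]
    | mem ω hω =>
      obtain ⟨S', T, hd, rfl, ω', hω', x, hx, rfl⟩ := hω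
      refine (CliffordAlgebra.contractLeft_ι_mul (Q := 0) d x ω').trans ?_
      rw [ih (fun T hT => h T (hT.trans subset_union_left)) hω', h T subset_union_right x hx,
        zero_smul, mul_zero, sub_zero]

/-- Only the coefficient contains s. Contracting z ∧ ω with a functional which ignores Lie elements
without s therefore evaluates the functional on z and leaves ω, so each d ⊗ 1 applied to k is
recovered from its image. -/
lemma wedgeIn_injective {t : ℕ} {S : Finset A} {s : A} {k : CESp 1 (FreeLieAlgebra ℚ A)}
    (hk : k ∈ ceFil {s} 0 t 1 S) (h : wedgeIn k = 0) : k = 0 := by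
  refine tensor_eq_zero k fun d => ?_
  -- On multilinear elements in letters of S, subtracting the restriction to the letters other than
  -- s keeps those which contain s and kills the others.
  let d' : Module.Dual ℚ (FreeLieAlgebra ℚ A) :=
    (d ∘ₗ tpowOne.symm.toLinearMap) ∘ₗ (LinearMap.id - (restrictTo (S.erase s)).toLinearMap)
  have hd' : ∀ x, d' x = d (tpowOne.symm (x - restrictTo (S.erase s) x)) := fun x => rfl
  have key : CliffordAlgebra.contractLeft (Q := (0 : QuadraticForm ℚ (FreeLieAlgebra ℚ A))) d'
      (wedgeIn k) = TensorProduct.lid ℚ _ (LinearMap.rTensor _ d k) := by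
    clear h
    induction hk using Submodule.span_induction with
    | zero => simp
    | add a b _ _ ha hb => simp only [map_add, ha, hb]
    | smul r a _ ha => simp only [map_smul, ha]
    | mem k hk =>
      obtain ⟨S₁, S₂, hd, rfl, hU, -, z, hz, ω, hω, rfl⟩ := hk
      have hs : s ∈ S₁ := by simpa using hU
      refine (CliffordAlgebra.contractLeft_ι_mul (Q := 0) d' (tpowOne z) ω).trans ?_
      have h1 : CliffordAlgebra.contractLeft (Q := (0 : QuadraticForm ℚ (FreeLieAlgebra ℚ A))) d'
          ω = 0 := by
        refine contractLeft_eq_zero (fun T hT x hx => ?_) hω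
        have hT' : T ⊆ (S₁ ∪ S₂).erase s := fun a ha => mem_erase.2
          ⟨fun h => disjoint_left.1 hd hs (h ▸ hT ha), mem_union_right _ (hT ha)⟩
        rw [hd', restrictTo_lieOp hT' hx, sub_self, map_zero, map_zero]
      have h2 : d' (tpowOne z) = d z := by
        rw [hd', restrictTo_of_not_subset (fun h => by simpa using h hs) (tpowOne_mem hz), sub_zero,
          LinearEquiv.symm_apply_apply]
      rw [h1, h2, mul_zero, sub_zero]
      simp
  rw [← key, h, map_zero]

/-! ### Left-normed brackets starting with a given letter -/

section Words

attribute [local instance] LieRing.ofAssociativeRing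

/-- On functions on words, the operator which corresponds to adding the letter `a` in front of a
word. -/
def consOp (a : A) : (List A → ℚ) →ₗ[ℚ] (List A → ℚ) where
  toFun f l := match l with
    | [] => 0
    | b :: l => if b = a then f l else 0
  map_add' f f' := by
    funext l
    rcases l with _ | ⟨b, l⟩
    · simp
    · by_cases h : b = a <;> simp [h]
  map_smul' r f := by
    funext l
    rcases l with _ | ⟨b, l⟩
    · simp
    · by_cases h : b = a <;> simp [h]

lemma consOp_cons (a b : A) (f : List A → ℚ) (l : List A) :
    consOp a f (b :: l) = if b = a then f l else 0 := rfl

/-- The representation of the free Lie algebra for which the letter `s` sends the generator of the second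
summand to the empty word, and the other letters act on words. -/
def wordRep (s : A) : FreeLieAlgebra ℚ A →ₗ⁅ℚ⁆ Module.End ℚ ((List A → ℚ) × ℚ) :=
  FreeLieAlgebra.lift ℚ fun a => LinearMap.inl ℚ _ _ ∘ₗ
    (if a = s then (LinearMap.toSpanSingleton ℚ _ (Pi.single [] 1)) ∘ₗ LinearMap.snd ℚ _ _
      else consOp a ∘ₗ LinearMap.fst ℚ _ _)

/-- The expansion of an element of the free Lie algebra in terms of words starting with `s` (the first
letter is omitted, and the word is read backwards). -/
def wordExp (s : A) : FreeLieAlgebra ℚ A →ₗ[ℚ] (List A → ℚ) where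
  toFun x := (wordRep s x (0, 1)).1
  map_add' x y := by simp
  map_smul' r x := by simp

lemma wordExp_of (s : A) : wordExp s (FreeLieAlgebra.of ℚ s) = Pi.single [] 1 := by
  simp [wordExp, wordRep]

/-- A letter other than s kills the starting vector (0, 1), so only one term of the commutator
contributes. -/
lemma wordExp_lie {s a : A} (h : a ≠ s) (x : FreeLieAlgebra ℚ A) :
    wordExp s ⁅x, FreeLieAlgebra.of ℚ a⁆ = - consOp a (wordExp s x) := by
  have h0 : wordRep s (FreeLieAlgebra.of ℚ a) = LinearMap.inl ℚ _ _ ∘ₗ consOp a ∘ₗ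
      LinearMap.fst ℚ _ _ := by
    simp [wordRep, h]
  change (wordRep s ⁅x, FreeLieAlgebra.of ℚ a⁆ (0, 1)).1 = - consOp a (wordRep s x (0, 1)).1
  rw [LieHom.map_lie, h0, LieRing.of_associative_ring_bracket]
  simp only [LinearMap.sub_apply, Module.End.mul_apply, LinearMap.comp_apply,
    LinearMap.fst_apply, map_zero, LinearMap.inl_apply, Prod.fst_sub]
  simp

end Words

/-- Unfolds the convention used for families indexed by all letters: the entry at a letter lies in
the expected space when the condition holds, and is zero otherwise. -/
lemma mem_iSup_prop {V : Type} [AddCommGroup V] [Module ℚ V] {p : Prop} {M : Submodule ℚ V}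
    {x : V} : x ∈ (⨆ _ : p, M) ↔ (p → x ∈ M) ∧ (¬ p → x = 0) := by
  by_cases h : p <;> simp [h]

/-- A monomial in at least two letters is a bracket [x, y], and this is the boundary of x ⊗ y. By
antisymmetry the factor containing s may be taken as the coefficient. -/
lemma exists_ceD_eq_tmul_one {S : Finset A} {s : A} (hs : s ∈ S) (hS : 2 ≤ S.card)
    {x : FreeLieAlgebra ℚ A} (hx : x ∈ lieOp S) :
    ∃ k ∈ ceFil {s} 0 1 1 S, ceD 1 k = tpowOne.symm x ⊗ₜ 1 := by
  induction hx using Submodule.span_induction with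
  | zero => exact ⟨0, zero_mem _, by simp⟩
  | add a b _ _ ha hb =>
    obtain ⟨k, hk, h⟩ := ha
    obtain ⟨l, hl, h'⟩ := hb
    exact ⟨k + l, add_mem hk hl, by rw [map_add, map_add, h, h', TensorProduct.add_tmul]⟩
  | smul r a _ ha =>
    obtain ⟨k, hk, h⟩ := ha
    exact ⟨r • k, Submodule.smul_mem _ r hk, by
      rw [map_smul, map_smul, h, TensorProduct.smul_tmul']⟩
  | mem x hx =>
    have key : ∀ S T : Finset A, s ∈ S → Disjoint S T → ∀ x ∈ lieOp S, ∀ y ∈ lieOp T,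
        ∃ k ∈ ceFil {s} 0 1 1 (S ∪ T), ceD 1 k = tpowOne.symm ⁅x, y⁆ ⊗ₜ 1 := by
      intro S T hs hd x hx y hy
      refine ⟨tpowOne.symm x ⊗ₜ ExteriorAlgebra.ι ℚ y, tmul_mem_ceFil hd (by simpa using hs)
        (Nat.zero_le _) (tpowOne_symm_mem hx) ?_, ?_⟩
      · have : ExteriorAlgebra.ι ℚ y = ExteriorAlgebra.ιMulti ℚ 1 (fun _ : Fin 1 => y) := by
          simp [ExteriorAlgebra.ιMulti_succ_apply]
        rw [this]
        exact Submodule.subset_span ⟨fun _ => T,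
          ⟨fun i j h => absurd (Subsingleton.elim i j) h, by simp⟩, _, fun _ => hy, rfl⟩
      · rw [ceD_deg_one]
        congr 1
        apply tpowOne.injective
        rw [tpowOne_adAct, LinearEquiv.apply_symm_apply, LinearEquiv.apply_symm_apply]
    cases hx with
    | of a => simp at hS
    | @lie S T x y hx hy h =>
      have hx' := Submodule.subset_span (R := ℚ) hx
      have hy' := Submodule.subset_span (R := ℚ) hy
      rcases mem_union.1 hs with hs | hs
      · exact key S T hs h x hx' y hy'
      · obtain ⟨k, hk, he⟩ := key T S hs h.symm y hy' x hx'
        rw [union_comm] at hk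
        refine ⟨-k, neg_mem hk, ?_⟩
        rw [map_neg, he, ← lie_skew x y, map_neg, TensorProduct.neg_tmul]

/-- The outermost letter of a left-normed bracket is the head of the word, so the words beginning
with b only see the summand at b. The summand at s has to vanish since `wordExp_lie` excludes that
letter. -/
lemma wordExp_cons {S : Finset A} {s : A} {y : A → FreeLieAlgebra ℚ A} (hy : y s = 0) {b : A}
    (hb : b ∈ S) (l : List A) :
    wordExp s (∑ a ∈ S, ⁅y a, FreeLieAlgebra.of ℚ a⁆) (b :: l) = - wordExp s (y b) l := by
  have h : ∀ a, wordExp s ⁅y a, FreeLieAlgebra.of ℚ a⁆ = - consOp a (wordExp s (y a)) := by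
    intro a
    rcases eq_or_ne a s with rfl | ha
    · simp [hy]
    · exact wordExp_lie ha _
  simp only [map_sum, h, Finset.sum_apply, Pi.neg_apply, consOp_cons, sum_neg_distrib,
    sum_ite_eq, if_pos hb]

/-- Write x as a boundary of an element of degree one with s in the coefficient, and replace that
element by a sum of terms with a letter in Λ; its boundary is unchanged. Iterated, this says that
left-normed brackets starting with s span. -/
lemma exists_eq_sum_lie {S : Finset A} {s : A} (hs : s ∈ S) (hS : 2 ≤ S.card)
    {x : FreeLieAlgebra ℚ A} (hx : x ∈ lieOp S) :
    ∃ y : A → FreeLieAlgebra ℚ A, (∀ a, y a ∈ ⨆ _ : a ∈ S ∧ {s} ⊆ S.erase a, lieOp (S.erase a)) ∧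
      x = ∑ a ∈ S, ⁅y a, FreeLieAlgebra.of ℚ a⁆ := by
  obtain ⟨k, hk, he⟩ := exists_ceD_eq_tmul_one hs hS hx
  obtain ⟨z, hz, l, -, rfl⟩ := exists_letters_add_ceD hk
  refine ⟨fun a => tpowOne (z a), fun a => ?_, ?_⟩
  · have h := mem_iSup_prop.1 (hz a)
    exact mem_iSup_prop.2 ⟨fun hp => tpowOne_mem (h.1 hp), fun hp => by simp [h.2 hp]⟩
  · rw [map_add, ceD_ceD, add_zero, map_sum] at he
    simp only [ceD_deg_one] at he
    have := congrArg (fun k => tpowOne (degZero 1 k)) he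
    simpa [degZero_tmul, tpowOne_adAct] using this.symm

/-- Induction on the number of letters: in a decomposition of x as a sum of [y a, a], the word
expansion of x determines that of each y a, and s remains among the letters of every nonzero y a. -/
lemma eq_zero_of_wordExp {S : Finset A} {s : A} (hs : s ∈ S) {x : FreeLieAlgebra ℚ A}
    (hx : x ∈ lieOp S) (h : wordExp s x = 0) : x = 0 := by
  induction hc : S.card generalizing S x with
  | zero => simp [card_eq_zero.1 hc] at hs
  | succ c ih =>
    rcases Nat.lt_or_ge S.card 2 with hS | hS
    · have hS' : S.card = 1 := by omega
      obtain rfl : S = {s} := by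
        obtain ⟨a, rfl⟩ := card_eq_one.1 hS'
        simpa [eq_comm] using hs
      -- With s as the only letter, x is a multiple of s, and the empty word reads off the scalar.
      have hx' : x ∈ Submodule.span ℚ {FreeLieAlgebra.of ℚ s} := by
        refine Submodule.span_mono ?_ hx
        intro x hx
        obtain ⟨a, ha, rfl⟩ := LieMon.eq_of hx hS'
        rw [Finset.singleton_inj.1 ha]; rfl
      obtain ⟨r, rfl⟩ := Submodule.mem_span_singleton.1 hx'
      have := congrFun h []
      rw [map_smul, wordExp_of] at this
      simp at this
      rw [this, zero_smul]
    · obtain ⟨y, hy, rfl⟩ := exists_eq_sum_lie hs hS hx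
      have hys : y s = 0 := (mem_iSup_prop.1 (hy s)).2 (by simp)
      refine sum_eq_zero fun a ha => ?_
      have hya : y a = 0 := by
        by_cases hp : a ∈ S ∧ {s} ⊆ S.erase a
        · refine ih (by simpa using hp.2) ((mem_iSup_prop.1 (hy a)).1 hp) (funext fun l => ?_) ?_
          · have := wordExp_cons hys ha l
            rw [h] at this
            simpa using this.symm
          · rw [card_erase_of_mem ha, hc]; rfl
        · exact (mem_iSup_prop.1 (hy a)).2 hp
      rw [hya, zero_lie]

/-- The boundary is the sum of the [z a, a]. Its word expansion gives that of every z a, and word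
expansions are faithful. -/
lemma letters_eq_zero {S : Finset A} {s : A} {z : A → TPow 1 (FreeLieAlgebra ℚ A)}
    (hz : ∀ a, z a ∈ ⨆ _ : a ∈ S ∧ {s} ⊆ S.erase a, catLieSub 1 (S.erase a))
    (h : ceD 1 (∑ a ∈ S, z a ⊗ₜ ExteriorAlgebra.ι ℚ (FreeLieAlgebra.of ℚ a)) = 0) (a : A) :
    z a = 0 := by
  by_cases hp : a ∈ S ∧ {s} ⊆ S.erase a
  · have hzs : z s = 0 := (mem_iSup_prop.1 (hz s)).2 (by simp)
    rw [map_sum] at h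
    simp only [ceD_deg_one] at h
    have h1 : ∑ a ∈ S, ⁅tpowOne (z a), FreeLieAlgebra.of ℚ a⁆ = 0 := by
      simpa [degZero_tmul, tpowOne_adAct] using congrArg (fun k => tpowOne (degZero 1 k)) h
    refine (LinearEquiv.map_eq_zero_iff tpowOne).1 (eq_zero_of_wordExp (s := s)
      (by simpa using hp.2) (tpowOne_mem ((mem_iSup_prop.1 (hz a)).1 hp)) (funext fun l => ?_))
    have := wordExp_cons (S := S) (y := fun a => tpowOne (z a)) (s := s) (by simp [hzs]) hp.1 l
    rw [h1] at this
    simpa using this.symm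
  · exact (mem_iSup_prop.1 (hz a)).2 hp

/-! ### Acyclicity -/

/-- The multilinear part of the Chevalley–Eilenberg complex of the free Lie algebra with trivial coefficients
is acyclic if there are at least two letters. -/
lemma exists_trivD_eq {S : Finset A} (hS : 2 ≤ S.card) (t : ℕ)
    {ω : ExteriorAlgebra ℚ (FreeLieAlgebra ℚ A)} (hω : ω ∈ extLieSub t S) (h : trivD ω = 0) :
    ∃ ω' ∈ extLieSub (t + 1) S, trivD ω' = ω := by
  induction hc : S.card using Nat.strong_induction_on generalizing S t ω with
  | _ c ih =>
  rcases t with _ | t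
  · rcases extLieSub_zero hω with rfl | ⟨rfl, -⟩
    · exact ⟨0, zero_mem _, map_zero _⟩
    · simp at hS
  obtain ⟨s, hs⟩ : S.Nonempty := card_pos.1 (by omega)
  obtain ⟨k, hk, rfl⟩ := exists_wedgeIn_eq hs hω
  have wedgeIn_mem : ∀ l ∈ ceFil {s} 0 (t + 1) 1 S, wedgeIn l ∈ extLieSub (t + 2) S := by
    intro l hl
    induction hl using Submodule.span_induction with
    | zero => simp
    | add a b _ _ ha hb => rw [map_add]; exact add_mem ha hb
    | smul r a _ ha => rw [map_smul]; exact Submodule.smul_mem _ r ha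
    | mem k hk =>
      obtain ⟨S₁, S₂, hd, rfl, hU, -, z, hz, ω, hω, rfl⟩ := hk
      rw [wedgeIn_tmul, union_comm]
      exact ι_mul_mem hd.symm hω (tpowOne_mem hz)
  -- The problem is transported to adjoint coefficients with s in the coefficient, in degree one
  -- less; the sign in `wedgeIn_ceD` accounts for the minus sign.
  suffices ∃ l ∈ ceFil {s} 0 (t + 1) 1 S, ceD 1 l = k by
    obtain ⟨l, hl, rfl⟩ := this
    exact ⟨- wedgeIn l, neg_mem (wedgeIn_mem l hl), by rw [wedgeIn_ceD, map_neg]⟩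
  rcases t with _ | t
  -- Degree 0: here the assumption of at least two letters is used, through the fact that brackets
  -- are boundaries.
  · have : ∃ x ∈ lieOp S, k = tpowOne.symm x ⊗ₜ 1 := by
      clear h hω
      induction hk using Submodule.span_induction with
      | zero => exact ⟨0, zero_mem _, by simp⟩
      | add a b _ _ ha hb =>
        obtain ⟨x, hx, rfl⟩ := ha
        obtain ⟨y, hy, rfl⟩ := hb
        exact ⟨x + y, add_mem hx hy, by rw [map_add, TensorProduct.add_tmul]⟩
      | smul r a _ ha =>
        obtain ⟨x, hx, rfl⟩ := ha
        exact ⟨r • x, Submodule.smul_mem _ r hx, by rw [map_smul, TensorProduct.smul_tmul']⟩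
      | mem k hk =>
        obtain ⟨S₁, S₂, hd, rfl, hU, -, z, hz, ω, hω, rfl⟩ := hk
        rcases extLieSub_zero hω with rfl | ⟨rfl, r, rfl⟩
        · exact ⟨0, zero_mem _, by simp⟩
        · refine ⟨tpowOne (r • z), tpowOne_mem ?_, ?_⟩
          · rw [union_empty]; exact Submodule.smul_mem _ r hz
          · rw [LinearEquiv.symm_apply_apply, TensorProduct.smul_tmul]
    obtain ⟨x, hx, rfl⟩ := this
    exact exists_ceD_eq_tmul_one hs hS hx
  · have hd : ceD 1 k = 0 :=
      wedgeIn_injective (ceD_mem_ceFil hk) (by rw [wedgeIn_ceD, h, neg_zero])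
    rcases t with _ | t
    -- Degree 1: the letter part of a cycle vanishes, which leaves a boundary.
    · obtain ⟨z, hz, l, hl, rfl⟩ := exists_letters_add_ceD hk
      rw [map_add, ceD_ceD, add_zero] at hd
      refine ⟨l, hl, ?_⟩
      rw [sum_eq_zero fun a _ => by rw [letters_eq_zero hz hd a, TensorProduct.zero_tmul],
        zero_add]
    -- Degrees at least 2: the sets T to be handled omit s, so the induction hypothesis applies to
    -- them unless they have at most one letter, in which case Λ vanishes.
    · refine exists_ceD_eq (fun T hT ω hω hd => ?_) hk hd
      rcases Nat.lt_or_ge T.card 2 with hT2 | hT2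
      · rw [extLieSub_eq_bot (by omega), Submodule.mem_bot] at hω
        exact ⟨0, zero_mem _, by rw [hω, map_zero]⟩
      · refine ih T.card ?_ hT2 _ hω hd rfl
        rw [← hc]
        refine card_lt_card ⟨hT.trans sdiff_subset, fun hST => ?_⟩
        simpa using hT (hST hs)

/-- The universal Chevalley–Eilenberg complex is exact in degrees at least two. -/
lemma exists_ceD_eq_of_two_le {t n : ℕ} {S : Finset A} {k : CESp n (FreeLieAlgebra ℚ A)}
    (hk : k ∈ ceSub (t + 2) n S) (hd : ceD n k = 0) : ∃ l ∈ ceSub (t + 3) n S, ceD n l = k := by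
  rw [← ceFil_empty] at hk ⊢
  -- No letter is prescribed in the coefficients here, and the filtration starts at 0, so this is
  -- the whole complex.
  refine exists_ceD_eq (fun T _ ω hω hd => ?_) hk hd
  rcases Nat.lt_or_ge T.card 2 with hT2 | hT2
  · rw [extLieSub_eq_bot (by omega), Submodule.mem_bot] at hω
    exact ⟨0, zero_mem _, by rw [hω, map_zero]⟩
  · exact exists_trivD_eq hT2 _ hω hd

/-- The defining recursion of π on brackets is the vanishing of π on d(z ⊗ X ∧ Y). -/
lemma piMap_degOne_ceD {n : ℕ} {S : Finset A} {k : CESp n (FreeLieAlgebra ℚ A)}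
    (hk : k ∈ ceSub 2 n S) : piMap n (degOne n (ceD n k)) = 0 := by
  induction hk using Submodule.span_induction with
  | zero => simp
  | add a b _ _ ha hb => simp only [map_add, ha, hb, add_zero]
  | smul r a _ ha => simp only [map_smul, ha, smul_zero]
  | mem k hk =>
    obtain ⟨S₁, S₂, -, -, z, -, ω, hω, rfl⟩ := hk
    induction hω using Submodule.span_induction with
    | zero => simp
    | add a b _ _ ha hb => simp only [TensorProduct.tmul_add, map_add, ha, hb, add_zero]
    | smul r a _ ha => simp only [TensorProduct.tmul_smul, map_smul, ha, smul_zero]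
    | mem ω hω =>
      obtain ⟨B, -, u, -, rfl⟩ := hω
      rw [ExteriorAlgebra.ιMulti_succ_apply, ExteriorAlgebra.ιMulti_succ_apply,
        ExteriorAlgebra.ιMulti_zero_apply, mul_one, ceD_deg_two]
      simp only [map_sub, degOne_tmul, ExteriorAlgebra.ι_leftInverse _, piMap_lie]
      simp

/-- The kernel of `π` consists of boundaries. -/
lemma exists_ceD_eq_of_piMap {n : ℕ} {S : Finset A} {k : CESp n (FreeLieAlgebra ℚ A)}
    (hk : k ∈ ceSub 1 n S) (h : piMap n (degOne n k) = 0) :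
    ∃ l ∈ ceSub 2 n S, ceD n l = k := by
  rw [← ceFil_empty] at hk
  obtain ⟨z, -, l, hl, rfl⟩ := exists_letters_add_ceD hk
  rw [ceFil_empty] at hl
  refine ⟨l, hl, ?_⟩
  -- π kills the boundary and fixes the letter part, so the letter part is zero and only the
  -- boundary remains.
  rw [map_add, map_add, piMap_degOne_ceD hl, add_zero] at h
  simp only [map_sum, degOne_tmul, ExteriorAlgebra.ι_leftInverse _, piMap_of] at h
  rw [← map_sum, LinearEquiv.map_eq_zero_iff] at h
  have h' := congrArg (LinearMap.lTensor _ (ExteriorAlgebra.ι ℚ)) h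
  rw [map_sum, map_zero] at h'
  simp only [LinearMap.lTensor_tmul] at h'
  rw [h', zero_add]

end Acyclicity

/-! ### Identification of the terms of degrees zero and one; the comparison morphism -/

section Comparison

open Finset

variable {A : Type} [DecidableEq A]

lemma tmul_one_mem {n : ℕ} {S : Finset A} {z : TPow n (FreeLieAlgebra ℚ A)}
    (hz : z ∈ catLieSub n S) : z ⊗ₜ (1 : ExteriorAlgebra ℚ _) ∈ ceSub 0 n S := by
  rw [← union_empty S]
  refine tmul_mem_ceSub (disjoint_empty_right S) hz (Submodule.subset_span
    ⟨Fin.elim0, ⟨fun i => i.elim0, rfl⟩, Fin.elim0, fun i => i.elim0, ?_⟩)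
  rw [ExteriorAlgebra.ιMulti_zero_apply]

lemma degZero_tmul_one {n : ℕ} {S : Finset A} {k : CESp n (FreeLieAlgebra ℚ A)}
    (hk : k ∈ ceSub 0 n S) : degZero n k ⊗ₜ 1 = k := by
  induction hk using Submodule.span_induction with
  | zero => simp
  | add a b _ _ ha hb => rw [map_add, TensorProduct.add_tmul, ha, hb]
  | smul r a _ ha => rw [map_smul, ← TensorProduct.smul_tmul', ha]
  | mem k hk =>
    obtain ⟨S₁, S₂, -, -, z, -, ω, hω, rfl⟩ := hk
    rcases extLieSub_zero hω with rfl | ⟨-, r, rfl⟩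
    · simp
    · simp [degZero_tmul, TensorProduct.smul_tmul']

lemma ι_mem_extLieSub {S : Finset A} {x : FreeLieAlgebra ℚ A} (hx : x ∈ lieOp S) :
    ExteriorAlgebra.ι ℚ x ∈ extLieSub 1 S := by
  refine Submodule.subset_span ⟨fun _ => S, ⟨fun i j h => absurd (Subsingleton.elim i j) h,
    by simp⟩, fun _ => x, fun _ => hx, ?_⟩
  simp [ExteriorAlgebra.ιMulti_succ_apply]

/-- Elements of degree one are recovered from their `degOne`; this gives injectivity, and reduces
statements about them to tensors z ⊗ x. -/
lemma lTensor_ι_degOne {n : ℕ} {S : Finset A} {k : CESp n (FreeLieAlgebra ℚ A)}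
    (hk : k ∈ ceSub 1 n S) :
    LinearMap.lTensor _ (ExteriorAlgebra.ι ℚ) ((snocE n).symm (degOne n k)) = k := by
  induction hk using Submodule.span_induction with
  | zero => simp
  | add a b _ _ ha hb => simp only [map_add, ha, hb]
  | smul r a _ ha => simp only [map_smul, ha]
  | mem k hk =>
    obtain ⟨S₁, S₂, -, -, z, -, ω, hω, rfl⟩ := hk
    rw [degOne_tmul, LinearEquiv.symm_apply_apply, LinearMap.lTensor_tmul]
    congr 1
    induction hω using Submodule.span_induction with
    | zero => simp
    | add a b _ _ ha hb => simp only [map_add, ha, hb]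
    | smul r a _ ha => simp only [map_smul, ha]
    | mem ω hω =>
      obtain ⟨B, -, u, -, rfl⟩ := hω
      rw [ExteriorAlgebra.ιMulti_succ_apply, ExteriorAlgebra.ιMulti_zero_apply, mul_one,
        ExteriorAlgebra.ι_leftInverse]

lemma exists_degOne_eq {n : ℕ} {S : Finset A} {y : TPow (n + 1) (FreeLieAlgebra ℚ A)}
    (hy : y ∈ catLieSub (n + 1) S) : ∃ k ∈ ceSub 1 n S, degOne n k = y := by
  have hy' := catLieSub_succ_le n S hy
  clear hy
  induction hy' using Submodule.span_induction with
  | zero => exact ⟨0, zero_mem _, map_zero _⟩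
  | add a b _ _ ha hb =>
    obtain ⟨k, hk, rfl⟩ := ha
    obtain ⟨l, hl, rfl⟩ := hb
    exact ⟨k + l, add_mem hk hl, map_add _ _ _⟩
  | smul r a _ ha =>
    obtain ⟨k, hk, rfl⟩ := ha
    exact ⟨r • k, Submodule.smul_mem _ r hk, map_smul _ _ _⟩
  | mem y hy =>
    obtain ⟨S', T, hd, rfl, z, hz, x, hx, rfl⟩ := hy
    refine ⟨z ⊗ₜ ExteriorAlgebra.ι ℚ x,
      tmul_mem_ceSub hd hz (ι_mem_extLieSub (Submodule.subset_span hx)), ?_⟩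
    rw [degOne_tmul, ExteriorAlgebra.ι_leftInverse]

lemma degZero_ceD {m n : ℕ} {k : CESp n (FreeLieAlgebra ℚ (Fin m))} {S : Finset (Fin m)}
    (hk : k ∈ ceSub 1 n S) : degZero n (ceD n k) = act (mu n) (degOne n k) := by
  rw [← lTensor_ι_degOne hk]
  generalize (snocE n).symm (degOne n k) = y
  induction y using TensorProduct.induction_on with
  | zero => simp
  | add a b ha hb => simp only [map_add, ha, hb]
  | tmul z x =>
    rw [LinearMap.lTensor_tmul, ceD_deg_one, degOne_tmul, degZero_tmul, act_mu,
      ExteriorAlgebra.ι_leftInverse, map_one, one_smul]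

lemma ceZeroCL_bijective (m n : ℕ) : Function.Bijective (ceZeroCL m n) := by
  refine ⟨fun x y h => Subtype.ext ?_, fun y => ⟨⟨y.1 ⊗ₜ 1, tmul_one_mem y.2⟩, Subtype.ext ?_⟩⟩
  · rw [← degZero_tmul_one x.2, ← degZero_tmul_one y.2]
    exact congrArg (fun z : CL m n => z.1 ⊗ₜ 1) h
  · change degZero n (y.1 ⊗ₜ 1) = y.1
    simp [degZero_tmul]

lemma ceOneCL_bijective (m n : ℕ) : Function.Bijective (ceOneCL m n) := by
  refine ⟨fun x y h => Subtype.ext ?_, fun y => ?_⟩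
  · rw [← lTensor_ι_degOne x.2, ← lTensor_ι_degOne y.2]
    have h' : degOne n x.1 = degOne n y.1 := congrArg Subtype.val h
    rw [h']
  · obtain ⟨k, hk, h⟩ := exists_degOne_eq y.2
    exact ⟨⟨k, hk⟩, Subtype.ext h⟩

end Comparison

namespace BimodData

/-- The componentwise inverses commute with both actions because the maps themselves do and are
injective. -/
lemma homMk_isIso (D D' : BimodData) (f : ∀ m n, D.T m n →ₗ[ℚ] D'.T m n)
    (hL : ∀ m {n p} (ψ : CL n p) x, f m p (D.L m ψ x) = D'.L m ψ (f m n x))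
    (hR : ∀ n {k m} (φ : CL k m) x, f k n (D.R n φ x) = D'.R n φ (f m n x))
    (h : ∀ m n, Function.Bijective (f m n)) : IsIso (homMk D D' f hL hR) := by
  let e := fun m n => LinearEquiv.ofBijective (f m n) (h m n)
  have he : ∀ m n y, f m n ((e m n).symm y) = y := fun m n y => (e m n).apply_symm_apply y
  refine ⟨homMk D' D (fun m n => (e m n).symm.toLinearMap) (fun m n p ψ y => ?_)
    (fun n k m φ y => ?_), ?_, ?_⟩
  · apply (h m p).1
    simp only [LinearEquiv.coe_coe, he, hL]
  · apply (h k n).1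
    simp only [LinearEquiv.coe_coe, he, hR]
  · exact hom_ext fun m n => ModuleCat.hom_ext (LinearMap.ext fun x =>
      (e m.arity n.arity).symm_apply_apply x)
  · exact hom_ext fun m n => ModuleCat.hom_ext (LinearMap.ext fun x =>
      (e m.arity n.arity).apply_symm_apply x)

end BimodData

lemma isIso_ceZero : IsIso ceZero :=
  BimodData.homMk_isIso _ _ _ _ _ ceZeroCL_bijective

lemma isIso_ceOne : IsIso ceOne :=
  BimodData.homMk_isIso _ _ _ _ _ ceOneCL_bijective

lemma ceLie_d (t : ℕ) : CELie.d (t + 1) t = ceDHom t :=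
  ChainComplex.of_d (fun t => (ceData t).toBimod) ceDHom t

lemma ceLie_d_comp_ceZero : CELie.d 1 0 ≫ ceZero = ceOne ≫ muTilde := by
  rw [ceLie_d]
  exact BimodData.hom_ext fun m n => ModuleCat.hom_ext (LinearMap.ext fun x =>
    Subtype.ext (degZero_ceD (x : CET 1 m.arity n.arity).2))

lemma piHom_comp_muOne : piHom ≫ muOne = muTilde :=
  BimodData.hom_ext fun m n => ModuleCat.hom_ext (LinearMap.ext fun x => mu_pi m.arity n.arity x)

/-- The components of the comparison morphism `CE_𝔏𝔦𝔢 ⟶ ℂ𝔏𝔦𝔢`. -/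
def comparisonApp : (t : ℕ) → ((ceData t).toBimod ⟶ cLieX t)
  | 0 => ceZero
  | 1 => ceOne ≫ piHom
  | _ + 2 => 0

lemma ceDHom_comp_pi : ceDHom 1 ≫ ceOne ≫ piHom = 0 :=
  BimodData.hom_ext fun m n => ModuleCat.hom_ext (LinearMap.ext fun x =>
    Subtype.ext (piMap_degOne_ceD (x : CET 2 m.arity n.arity).2))

/-- The comparison morphism `CE_𝔏𝔦𝔢 ⟶ ℂ𝔏𝔦𝔢`. -/
def comparison : CELie ⟶ CLie :=
  ChainComplex.ofHom (X := CELie) (Y := CLie) comparisonApp (fun t => by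
    rw [ceLie_d, show CLie.d (t + 1) t = cLieD t from ChainComplex.of_d cLieX cLieD t]
    match t with
    | 0 =>
      change (ceOne ≫ piHom) ≫ muOne = ceDHom 0 ≫ ceZero
      rw [Category.assoc, piHom_comp_muOne, ← ceLie_d_comp_ceZero, ceLie_d]
      rfl
    | 1 =>
      change 0 ≫ 0 = ceDHom 1 ≫ ceOne ≫ piHom
      rw [ceDHom_comp_pi, Limits.zero_comp]
    | t + 2 =>
      exact Limits.zero_comp.trans Limits.comp_zero.symm)

/-- The target vanishes in degrees at least 2, so nothing is left to compare there. -/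
lemma comparison_unique (f f' : CELie ⟶ CLie) (h0 : f.f 0 = f'.f 0) (h1 : f.f 1 = f'.f 1) :
    f = f' := by
  refine HomologicalComplex.hom_ext _ _ fun t => ?_
  match t with
  | 0 => exact h0
  | 1 => exact h1
  | t + 2 =>
    exact BimodData.hom_ext (D := ceData (t + 2)) (D' := zeroData)
      fun m n => ModuleCat.hom_ext (LinearMap.ext fun x => rfl)

lemma piCL_surjective (m n : ℕ) : Function.Surjective (piCL m n) := fun x => ⟨_, piCL_incl m n x⟩

lemma comparison_surjective (t : ℕ) (m n : CatLie) :
    Function.Surjective ((evalBimod m n).map (comparison.f t)).hom := by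
  match t with
  | 0 => exact (ceZeroCL_bijective m.arity n.arity).2
  | 1 => exact (piCL_surjective m.arity n.arity).comp (ceOneCL_bijective m.arity n.arity).2
  | t + 2 => exact fun y => ⟨0, rfl⟩

/-- A surjection with acyclic kernel is a quasi-isomorphism. For t = 0 the truncated t - 1 is 0 and
the differential in `hk` is zero, so the cycle condition is void. Sections of f and generalized
inverses on its kernel are chosen linearly, so that the homology criteria hold without refining the
test object. -/
lemma quasiIso_of_surjective {K L : ChainComplex (ModuleCat.{0} ℚ) ℕ} (f : K ⟶ L)
    (hs : ∀ t, Function.Surjective (f.f t).hom)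
    (hk : ∀ t (x : K.X t), f.f t x = 0 → K.d t (t - 1) x = 0 →
      ∃ y : K.X (t + 1), f.f (t + 1) y = 0 ∧ K.d (t + 1) t y = x) : QuasiIso f := by
  choose σ hσ using fun t =>
    (f.f t).hom.exists_rightInverse_of_surjective (LinearMap.range_eq_top.2 (hs t))
  have hσ' : ∀ t y, f.f t (σ t y) = y := fun t y => LinearMap.congr_fun (hσ t) y
  have hfd : ∀ i j x, f.f j (K.d i j x) = L.d i j (f.f i x) := fun i j x =>
    (ConcreteCategory.congr_hom (f.comm i j) x).symm
  have hdd : ∀ i j k x, K.d j k (K.d i j x) = 0 := fun i j k x =>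
    ConcreteCategory.congr_hom (K.d_comp_d i j k) x
  choose g hg using fun t => exists_generalizedInverse
    ((K.d (t + 1) t).hom ∘ₗ (LinearMap.ker (f.f (t + 1)).hom).subtype)
  have hg' : ∀ t (x : K.X t), f.f t x = 0 → K.d t (t - 1) x = 0 → K.d (t + 1) t (g t x).1 = x := by
    intro t x h1 h2
    obtain ⟨y, hy, rfl⟩ := hk t x h1 h2
    exact hg t ⟨y, hy⟩
  refine ⟨fun t => ?_⟩
  have hn : (ComplexShape.down ℕ).next t = t - 1 := by cases t <;> simp
  rw [quasiIsoAt_iff_isIso_homologyMap]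
  have : Mono (HomologicalComplex.homologyMap f t) := by
    rw [HomologicalComplex.mono_homologyMap_iff_up_to_refinements f (t + 1) t (t - 1) (by simp)
      hn]
    intro B x hx y hy
    have hx' : ∀ b, K.d t (t - 1) (x b) = 0 := fun b => ConcreteCategory.congr_hom hx b
    have hy' : ∀ b, f.f t (x b) = L.d (t + 1) t (y b) := fun b => ConcreteCategory.congr_hom hy b
    -- Lift the primitive y of f(x) to τ; then x - d τ is a cycle in the kernel of f, hence the
    -- boundary of an element of the kernel.
    let τ : B →ₗ[ℚ] K.X (t + 1) := σ (t + 1) ∘ₗ y.hom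
    refine ⟨B, 𝟙 B, inferInstance, ModuleCat.ofHom (τ + (LinearMap.ker _).subtype ∘ₗ g t ∘ₗ
      (x.hom - (K.d (t + 1) t).hom ∘ₗ τ)), ?_⟩
    ext b
    have h := hg' t (x b - K.d (t + 1) t (τ b))
      (by rw [map_sub, hfd, hy', show f.f (t + 1) (τ b) = y b from hσ' _ _, sub_self])
      (by rw [map_sub, hx', hdd, sub_zero])
    change x b = K.d (t + 1) t (τ b + (g t (x b - K.d (t + 1) t (τ b))).1)
    rw [map_add, h, add_sub_cancel]
  have : Epi (HomologicalComplex.homologyMap f t) := by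
    rw [HomologicalComplex.epi_homologyMap_iff_up_to_refinements f (t + 1) t (t - 1) (by simp)
      hn]
    intro B y hy
    have hy' : ∀ b, L.d t (t - 1) (y b) = 0 := fun b => ConcreteCategory.congr_hom hy b
    rcases t with _ | t
    · refine ⟨B, 𝟙 B, inferInstance, ModuleCat.ofHom (σ 0 ∘ₗ y.hom), ?_, 0, ?_⟩
      · rw [K.shape _ _ (by simp), Limits.comp_zero]
      · ext b
        simpa using (hσ' 0 (y b)).symm
    -- A lift τ of the cycle y need not be a cycle, but d τ is a cycle in the kernel of f;
    -- subtracting a primitive in the kernel makes the lift a cycle without changing its image.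
    · let τ : B →ₗ[ℚ] K.X (t + 1) := σ (t + 1) ∘ₗ y.hom
      have hτ : ∀ b, f.f (t + 1) (τ b) = y b := fun b => hσ' _ _
      refine ⟨B, 𝟙 B, inferInstance, ModuleCat.ofHom (τ - (LinearMap.ker _).subtype ∘ₗ g t ∘ₗ
        (K.d (t + 1) t).hom ∘ₗ τ), ?_, 0, ?_⟩
      · ext b
        change K.d (t + 1) t (τ b - (g t (K.d (t + 1) t (τ b))).1) = 0
        rw [map_sub, hg' t _ (by rw [hfd, hτ]; exact hy' b) (hdd _ _ _ _), sub_self]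
      · ext b
        have h : f.f (t + 1) (g t (K.d (t + 1) t (τ b))).1 = 0 := (g t (K.d (t + 1) t (τ b))).2
        rw [Limits.zero_comp, add_zero]
        change y b = f.f (t + 1) (τ b - (g t (K.d (t + 1) t (τ b))).1)
        rw [map_sub, h, hτ, sub_zero]
  exact isIso_of_mono_of_epi _

lemma comparison_quasiIso (m n : CatLie) :
    QuasiIso (((evalBimod m n).mapHomologicalComplex (ComplexShape.down ℕ)).map comparison) := by
  refine quasiIso_of_surjective _ (fun t => comparison_surjective t m n) fun t x h1 h2 => ?_
  have key : ∀ (t : ℕ) (x : CET t m.arity n.arity), (∃ l ∈ ceSub (t + 1) n.arity Finset.univ,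
      ceD n.arity l = x.1) → ∀ x' : ((evalBimod m n).obj (CELie.X t)), x' = x →
      ∃ y : (evalBimod m n).obj (CELie.X (t + 1)), (evalBimod m n).map (CELie.d (t + 1) t) y = x' := by
    rintro t x ⟨l, hl, he⟩ _ rfl
    rw [ceLie_d]
    exact ⟨(⟨l, hl⟩ : CET (t + 1) m.arity n.arity), Subtype.ext he⟩
  -- The kernel of the comparison is zero in degree 0, ker π in degree 1, and everything from degree
  -- 2 on; the primitives are in degrees at least 2, except in the first case, so they automatically
  -- lie in the kernel.
  match t with
  | 0 =>
    have hx : x = 0 := (ceZeroCL_bijective m.arity n.arity).1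
      (h1.trans (map_zero (ceZeroCL m.arity n.arity)).symm)
    exact ⟨0, map_zero _, by rw [map_zero, hx]⟩
  | 1 =>
    have h3 : piCL m.arity n.arity (ceOneCL m.arity n.arity x) = 0 := h1
    obtain ⟨y, hy⟩ := key 1 x (exists_ceD_eq_of_piMap (x : CET 1 m.arity n.arity).2
      (congrArg Subtype.val h3)) x rfl
    exact ⟨y, rfl, hy⟩
  | t + 2 =>
    have h3 : (evalBimod m n).map (CELie.d (t + 2) (t + 1)) x = 0 := h2
    rw [ceLie_d] at h3
    obtain ⟨y, hy⟩ := key (t + 2) x (exists_ceD_eq_of_two_le (x : CET (t + 2) m.arity n.arity).2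
      (congrArg Subtype.val h3)) x rfl
    exact ⟨y, rfl, hy⟩

/-! ### Exterior powers as direct summands of tensor powers -/

section Antisymmetrization

variable {g g' : Type} [LieRing g'] [LieAlgebra ℚ g'] [LieRing g] [LieAlgebra ℚ g]

/-- The antisymmetrization map `Λ^t g → g^{⊗ t}`, extended by zero to the other degrees. -/
def antisym (t : ℕ) : ExteriorAlgebra ℚ g →ₗ[ℚ] TPow t g :=
  (t.factorial : ℚ)⁻¹ • ExteriorAlgebra.liftAlternating
    (Function.update 0 t (MultilinearMap.alternatization (PiTensorProduct.tprod ℚ)))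

lemma antisym_ιMulti (t : ℕ) (u : Fin t → g) :
    antisym t (ExteriorAlgebra.ιMulti ℚ t u) = (t.factorial : ℚ)⁻¹ •
      ∑ σ : Equiv.Perm (Fin t), Equiv.Perm.sign σ • PiTensorProduct.tprod ℚ (fun i => u (σ i)) := by
  rw [antisym, LinearMap.smul_apply, ExteriorAlgebra.liftAlternating_apply_ιMulti,
    Function.update_self, MultilinearMap.alternatization_apply]
  rfl

/-- The projection `g^{⊗ t} → Λ^t g`. -/
def toExterior (t : ℕ) : TPow t g →ₗ[ℚ] ExteriorAlgebra ℚ g :=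
  PiTensorProduct.lift (ExteriorAlgebra.ιMulti ℚ t).toMultilinearMap

lemma toExterior_tprod (t : ℕ) (u : Fin t → g) :
    toExterior t (PiTensorProduct.tprod ℚ u) = ExteriorAlgebra.ιMulti ℚ t u :=
  PiTensorProduct.lift.tprod _

/-- Each of the t! signed permutations contributes the same element, and t! is invertible in ℚ. -/
lemma toExterior_antisym (t : ℕ) (u : Fin t → g) :
    toExterior t (antisym t (ExteriorAlgebra.ιMulti ℚ t u)) = ExteriorAlgebra.ιMulti ℚ t u := by
  have h : ∀ σ : Equiv.Perm (Fin t), toExterior t (Equiv.Perm.sign σ •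
      PiTensorProduct.tprod ℚ (fun i => u (σ i))) = ExteriorAlgebra.ιMulti ℚ t u := by
    intro σ
    have h1 : ExteriorAlgebra.ιMulti ℚ t (fun i => u (σ i)) =
        Equiv.Perm.sign σ • ExteriorAlgebra.ιMulti ℚ t u :=
      (ExteriorAlgebra.ιMulti ℚ t).map_perm u σ
    rw [Units.smul_def, map_zsmul, toExterior_tprod, h1, ← Units.smul_def, smul_smul,
      Int.units_mul_self, one_smul]
  rw [antisym_ιMulti, map_smul, map_sum, Finset.sum_congr rfl fun σ _ => h σ, Finset.sum_const,
    Finset.card_univ, Fintype.card_perm, Fintype.card_fin, ← Nat.cast_smul_eq_nsmul ℚ, smul_smul,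
    inv_mul_cancel₀ (Nat.cast_ne_zero.2 t.factorial_ne_zero), one_smul]

/-- The map `g^{⊗ n} ⊗ Λ^t g → g^{⊗ (n + t)}` given by antisymmetrization. -/
def ceToTensor (t n : ℕ) : CESp n g →ₗ[ℚ] TPow (n + t) g :=
  TensorPower.mulEquiv.toLinearMap ∘ₗ LinearMap.lTensor _ (antisym t)

/-- The projection `g^{⊗ (n + t)} → g^{⊗ n} ⊗ Λ^t g`. -/
def tensorToCE (t n : ℕ) : TPow (n + t) g →ₗ[ℚ] CESp n g :=
  LinearMap.lTensor _ (toExterior t) ∘ₗ TensorPower.mulEquiv.symm.toLinearMap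

lemma mulEquiv_tprod {n t : ℕ} (v : Fin n → g) (u : Fin t → g) :
    TensorPower.mulEquiv (PiTensorProduct.tprod ℚ v ⊗ₜ[ℚ] PiTensorProduct.tprod ℚ u) =
      PiTensorProduct.tprod ℚ (Fin.append v u) :=
  TensorPower.tprod_mul_tprod ℚ v u

lemma ceToTensor_tprod {t n : ℕ} (v : Fin n → g) (u : Fin t → g) :
    ceToTensor t n (PiTensorProduct.tprod ℚ v ⊗ₜ ExteriorAlgebra.ιMulti ℚ t u) =
      (t.factorial : ℚ)⁻¹ • ∑ σ : Equiv.Perm (Fin t), Equiv.Perm.sign σ •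
        PiTensorProduct.tprod ℚ (Fin.append v (fun i => u (σ i))) := by
  rw [ceToTensor, LinearMap.comp_apply, LinearMap.lTensor_tmul, antisym_ιMulti,
    TensorProduct.tmul_smul, map_smul, TensorProduct.tmul_sum, map_sum]
  congr 1
  refine Finset.sum_congr rfl fun σ _ => ?_
  rw [Units.smul_def, ← Int.cast_smul_eq_zsmul ℚ, TensorProduct.tmul_smul, map_smul,
    Int.cast_smul_eq_zsmul, ← Units.smul_def]
  congr 1
  exact mulEquiv_tprod _ _

lemma tensorToCE_tprod {t n : ℕ} (v : Fin n → g) (u : Fin t → g) :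
    tensorToCE t n (PiTensorProduct.tprod ℚ (Fin.append v u)) =
      PiTensorProduct.tprod ℚ v ⊗ₜ ExteriorAlgebra.ιMulti ℚ t u := by
  rw [tensorToCE, ← mulEquiv_tprod]
  simp [toExterior_tprod]

lemma tensorToCE_map (t n : ℕ) (h : g →ₗ⁅ℚ⁆ g') (z : TPow (n + t) g) :
    tensorToCE t n (tpMap (n + t) h z) = ceMap n h (tensorToCE t n z) := by
  have : tensorToCE t n ∘ₗ tpMap (n + t) h = ceMap n h ∘ₗ tensorToCE t n := by
    refine PiTensorProduct.ext (MultilinearMap.ext fun w => ?_)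
    obtain ⟨v, u, rfl⟩ : ∃ v u, w = Fin.append v u := ⟨_, _, (Fin.append_castAdd_natAdd).symm⟩
    have h1 : (fun i => h (Fin.append v u i)) = Fin.append (fun i => h (v i)) (fun i => h (u i)) := by
      funext i
      refine Fin.addCases (fun i => ?_) (fun i => ?_) i <;> simp
    simp only [LinearMap.compMultilinearMap_apply, LinearMap.comp_apply, tpMap_tprod, h1,
      tensorToCE_tprod, ceMap_tmul, ExteriorAlgebra.map_apply_ιMulti]
    rfl
  exact LinearMap.congr_fun this z

end Antisymmetrization

/-! ### Antisymmetrization and projection on multilinear parts -/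

section Membership

open Finset

variable {A : Type} [DecidableEq A] {g : Type} [LieRing g] [LieAlgebra ℚ g]

lemma IsPart.append {n t : ℕ} {B : Fin n → Finset A} {C : Fin t → Finset A} {S T : Finset A}
    (hB : IsPart B S) (hC : IsPart C T) (h : Disjoint S T) : IsPart (Fin.append B C) (S ∪ T) := by
  rw [isPart_iff] at hB hC ⊢
  rw [Finset.disjoint_left] at h
  refine ⟨fun a => ?_, fun i j a => ?_⟩
  · rw [mem_union, hB.1 a, hC.1 a]
    constructor
    · rintro (⟨i, hi⟩ | ⟨i, hi⟩)
      · exact ⟨Fin.castAdd t i, by simpa using hi⟩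
      · exact ⟨Fin.natAdd n i, by simpa using hi⟩
    · rintro ⟨i, hi⟩
      induction i using Fin.addCases with
      | left i => exact Or.inl ⟨i, by simpa using hi⟩
      | right i => exact Or.inr ⟨i, by simpa using hi⟩
  · induction i using Fin.addCases <;> induction j using Fin.addCases <;>
      simp only [Fin.append_left, Fin.append_right]
    · exact fun h1 h2 => by rw [hB.2 _ _ a h1 h2]
    · exact fun h1 h2 => absurd ((hC.1 a).2 ⟨_, h2⟩) (h ((hB.1 a).2 ⟨_, h1⟩))
    · exact fun h1 h2 => absurd ((hC.1 a).2 ⟨_, h1⟩) (h ((hB.1 a).2 ⟨_, h2⟩))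
    · exact fun h1 h2 => by rw [hC.2 _ _ a h1 h2]

lemma IsPart.perm {t : ℕ} {C : Fin t → Finset A} {T : Finset A} (hC : IsPart C T)
    (σ : Equiv.Perm (Fin t)) : IsPart (fun i => C (σ i)) T := by
  rw [isPart_iff] at hC ⊢
  refine ⟨fun a => (hC.1 a).trans ⟨fun ⟨i, hi⟩ => ⟨σ.symm i, by simpa using hi⟩,
    fun ⟨i, hi⟩ => ⟨σ i, hi⟩⟩, fun i j a h1 h2 => σ.injective (hC.2 _ _ a h1 h2)⟩

/-- Induction principle for `ceSub`. -/
lemma ceSub_induction {t n : ℕ} {S : Finset A} {P : CESp n (FreeLieAlgebra ℚ A) → Prop}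
    (h0 : P 0) (ha : ∀ a b, P a → P b → P (a + b)) (hs : ∀ (r : ℚ) a, P a → P (r • a))
    (ht : ∀ (S₁ S₂ : Finset A) (B : Fin n → Finset A) (C : Fin t → Finset A)
      (w : Fin n → FreeLieAlgebra ℚ A) (u : Fin t → FreeLieAlgebra ℚ A),
      Disjoint S₁ S₂ → S₁ ∪ S₂ = S → IsPart B S₁ → IsPart C S₂ → (∀ i, w i ∈ lieOp (B i)) →
      (∀ i, u i ∈ lieOp (C i)) → P (PiTensorProduct.tprod ℚ w ⊗ₜ ExteriorAlgebra.ιMulti ℚ t u))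
    {k : CESp n (FreeLieAlgebra ℚ A)} (hk : k ∈ ceSub t n S) : P k := by
  induction hk using Submodule.span_induction with
  | zero => exact h0
  | add a b _ _ h h' => exact ha a b h h'
  | smul r a _ h => exact hs r a h
  | mem k hk =>
    obtain ⟨S₁, S₂, hd, hu, z, hz, ω, hω, rfl⟩ := hk
    induction hz using Submodule.span_induction with
    | zero => simpa using h0
    | add a b _ _ h h' => rw [TensorProduct.add_tmul]; exact ha _ _ h h'
    | smul r a _ h => rw [← TensorProduct.smul_tmul']; exact hs r _ h
    | mem z hz =>
      obtain ⟨B, hB, w, hw, rfl⟩ := hz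
      induction hω using Submodule.span_induction with
      | zero => simpa using h0
      | add a b _ _ h h' => rw [TensorProduct.tmul_add]; exact ha _ _ h h'
      | smul r a _ h => rw [TensorProduct.tmul_smul]; exact hs r _ h
      | mem ω hω =>
        obtain ⟨C, hC, u, hu', rfl⟩ := hω
        exact ht S₁ S₂ B C w u hd hu hB hC hw hu'

lemma ceToTensor_mem {t n : ℕ} {S : Finset A} {k : CESp n (FreeLieAlgebra ℚ A)}
    (hk : k ∈ ceSub t n S) : ceToTensor t n k ∈ catLieSub (n + t) S := by
  refine ceSub_induction (P := fun k => ceToTensor t n k ∈ catLieSub (n + t) S) (by simp)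
    (fun a b ha hb => by rw [map_add]; exact add_mem ha hb)
    (fun r a ha => by rw [map_smul]; exact Submodule.smul_mem _ r ha) ?_ hk
  rintro S₁ S₂ B C w u hd rfl hB hC hw hu
  rw [ceToTensor_tprod]
  refine Submodule.smul_mem _ _ (sum_mem fun σ _ => ?_)
  rw [Units.smul_def, ← Int.cast_smul_eq_zsmul ℚ]
  refine Submodule.smul_mem _ _
    (Submodule.subset_span ⟨_, hB.append (hC.perm σ) hd, _, fun i => ?_, rfl⟩)
  refine Fin.addCases (fun i => ?_) (fun i => ?_) i
  · simpa using hw i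
  · simpa using hu (σ i)

lemma tensorToCE_mem {t n : ℕ} {S : Finset A} {z : TPow (n + t) (FreeLieAlgebra ℚ A)}
    (hz : z ∈ catLieSub (n + t) S) : tensorToCE t n z ∈ ceSub t n S := by
  induction hz using Submodule.span_induction with
  | zero => simp
  | add a b _ _ ha hb => rw [map_add]; exact add_mem ha hb
  | smul r a _ ha => rw [map_smul]; exact Submodule.smul_mem _ r ha
  | mem z hz =>
    obtain ⟨B, hB, w, hw, rfl⟩ := hz
    have hS : (Finset.univ.biUnion fun i : Fin n => B (Fin.castAdd t i)) ∪
        (Finset.univ.biUnion fun i : Fin t => B (Fin.natAdd n i)) = S := by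
      ext a
      rw [hB.mem, mem_union, mem_biUnion, mem_biUnion]
      constructor
      · rintro (⟨i, _, hi⟩ | ⟨i, _, hi⟩) <;> exact ⟨_, hi⟩
      · rintro ⟨i, hi⟩
        induction i using Fin.addCases with
        | left i => exact Or.inl ⟨i, mem_univ _, hi⟩
        | right i => exact Or.inr ⟨i, mem_univ _, hi⟩
    have hd : Disjoint (Finset.univ.biUnion fun i : Fin n => B (Fin.castAdd t i))
        (Finset.univ.biUnion fun i : Fin t => B (Fin.natAdd n i)) := by
      simp only [disjoint_biUnion_left, disjoint_biUnion_right]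
      intro i _ j _
      refine hB.disj _ _ fun h => ?_
      have := congrArg Fin.val h
      simp at this
      omega
    have hw' : w = Fin.append (fun i => w (Fin.castAdd t i)) (fun i => w (Fin.natAdd n i)) :=
      (Fin.append_castAdd_natAdd).symm
    rw [hw', tensorToCE_tprod, ← hS]
    refine tmul_mem_ceSub hd
      (Submodule.subset_span ⟨_, ⟨fun i j hij => ?_, rfl⟩, _, fun i => hw _, rfl⟩)
      (Submodule.subset_span ⟨_, ⟨fun i j hij => ?_, rfl⟩, _, fun i => hw _, rfl⟩)
    · exact hB.disj _ _ fun h => hij (Fin.castAdd_injective _ _ h)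
    · exact hB.disj _ _ fun h => hij (Fin.natAdd_injective _ _ h)

/-- This is the splitting which exhibits the degree t term as a retract. It is restricted to degree
t since antisymmetrization is zero on the other degrees of Λ. -/
lemma tensorToCE_ceToTensor {t n : ℕ} {S : Finset A} {k : CESp n (FreeLieAlgebra ℚ A)}
    (hk : k ∈ ceSub t n S) : tensorToCE t n (ceToTensor t n k) = k := by
  refine ceSub_induction (P := fun k => tensorToCE t n (ceToTensor t n k) = k) (by simp)
    (fun a b ha hb => by rw [map_add, map_add, ha, hb])
    (fun r a ha => by rw [map_smul, map_smul, ha]) ?_ hk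
  intro S₁ S₂ B C w u _ _ _ _ _ _
  have : tensorToCE t n (ceToTensor t n (PiTensorProduct.tprod ℚ w ⊗ₜ[ℚ]
      ExteriorAlgebra.ιMulti ℚ t u)) = PiTensorProduct.tprod ℚ w ⊗ₜ[ℚ] toExterior t
        (antisym t (ExteriorAlgebra.ιMulti ℚ t u)) := by
    simp [tensorToCE, ceToTensor]
  rw [this, toExterior_antisym]

lemma ceToTensor_map {t n : ℕ} (h : FreeLieAlgebra ℚ A →ₗ⁅ℚ⁆ g) {S : Finset A}
    {k : CESp n (FreeLieAlgebra ℚ A)} (hk : k ∈ ceSub t n S) :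
    ceToTensor t n (ceMap n h k) = tpMap (n + t) h (ceToTensor t n k) := by
  refine ceSub_induction
    (P := fun k => ceToTensor t n (ceMap n h k) = tpMap (n + t) h (ceToTensor t n k)) (by simp)
    (fun a b ha hb => by simp only [map_add, ha, hb])
    (fun r a ha => by simp only [map_smul, ha]) ?_ hk
  intro S₁ S₂ B C w u _ _ _ _ _ _
  rw [ceMap_tmul, tpMap_tprod, ExteriorAlgebra.map_apply_ιMulti, ceToTensor_tprod, ceToTensor_tprod,
    map_smul, map_sum]
  congr 1
  refine sum_congr rfl fun σ _ => ?_
  rw [Units.smul_def, Units.smul_def, map_zsmul, tpMap_tprod]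
  congr 2
  funext i
  refine Fin.addCases (fun i => ?_) (fun i => ?_) i <;> simp

end Membership

/-! ### Projectivity -/

section Projectivity

/-- The pointwise cokernel of a morphism of right modules. -/
def rightCoker {X Y : RightMod} (e : X ⟶ Y) : RightMod where
  obj :=
    { obj := fun m => ModuleCat.of ℚ (Y.obj.obj m ⧸ LinearMap.range (e.hom.app m).hom)
      map := fun {m k} φ => ModuleCat.ofHom (Submodule.mapQ _ _ (Y.obj.map φ).hom (by
        rintro _ ⟨x, rfl⟩
        exact ⟨X.obj.map φ x, ConcreteCategory.congr_hom (e.hom.naturality φ) x⟩))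
      map_id := fun m => by
        refine ModuleCat.hom_ext (Submodule.linearMap_qext _ (LinearMap.ext fun y => ?_))
        exact congrArg (Submodule.Quotient.mk) (ConcreteCategory.congr_hom (Y.obj.map_id m) y)
      map_comp := fun φ ψ => by
        refine ModuleCat.hom_ext (Submodule.linearMap_qext _ (LinearMap.ext fun y => ?_))
        exact congrArg (Submodule.Quotient.mk)
          (ConcreteCategory.congr_hom (Y.obj.map_comp φ ψ) y) }
  property := ⟨fun {_ _ φ ψ} => by
    refine ModuleCat.hom_ext (Submodule.linearMap_qext _ (LinearMap.ext fun y => ?_))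
    have := Y.property
    exact congrArg (Submodule.Quotient.mk)
      (ConcreteCategory.congr_hom (Y.obj.map_add (f := φ) (g := ψ)) y)⟩

/-- The projection on the pointwise cokernel. -/
def rightCokerπ {X Y : RightMod} (e : X ⟶ Y) : Y ⟶ rightCoker e :=
  ⟨{ app := fun _ => ModuleCat.ofHom (Submodule.mkQ _)
     naturality := fun _ _ _ => rfl }⟩

/-- The pointwise cokernel is again additive, so it is a right module; the projection on it composes
to zero with e, hence is zero. -/
lemma rightMod_surjective_of_epi {X Y : RightMod} (e : X ⟶ Y) [Epi e] (m : CatLieᵒᵖ) :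
    Function.Surjective (e.hom.app m).hom := by
  have h : rightCokerπ e = 0 := by
    rw [← cancel_epi e, Limits.comp_zero]
    apply ObjectProperty.hom_ext
    refine NatTrans.ext (funext fun m => ModuleCat.hom_ext (LinearMap.ext fun x => ?_))
    exact (Submodule.Quotient.mk_eq_zero _).2 ⟨x, rfl⟩
  intro y
  have h1 : (rightCokerπ e).hom.app m y = 0 := by rw [h]; rfl
  exact (Submodule.Quotient.mk_eq_zero _).1 h1

/-- By the Yoneda lemma a morphism from a representable is determined by the image of the identity,
and this image lifts along e because epimorphisms are pointwise surjective. -/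
lemma projective_catLie_right (n : ℕ) : Projective (catLieData.toRight n) where
  factors {E X} f e _ := by
    obtain ⟨x, hx⟩ := rightMod_surjective_of_epi e (Opposite.op ⟨n⟩)
      (f.hom.app (Opposite.op ⟨n⟩) (idCL n))
    have := E.property
    -- The lift sends φ to the action of φ on the chosen preimage x. It is additive because E is an
    -- additive functor, and additive maps between rational vector spaces are linear.
    let F : ∀ m : CatLieᵒᵖ, CL m.unop.arity n →+ E.obj.obj m := fun m =>
      { toFun := fun φ => E.obj.map (Quiver.Hom.op (X := m.unop) (Y := ⟨n⟩) φ) x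
        map_zero' := ConcreteCategory.congr_hom (E.obj.map_zero (Opposite.op ⟨n⟩) m) x
        map_add' := fun φ ψ => ConcreteCategory.congr_hom (E.obj.map_add
          (f := Quiver.Hom.op (X := m.unop) (Y := ⟨n⟩) φ)
          (g := Quiver.Hom.op (X := m.unop) (Y := ⟨n⟩) ψ)) x }
    refine ⟨⟨{ app := fun m => ModuleCat.ofHom (F m).toRatLinearMap
               naturality := fun m k φ => ModuleCat.hom_ext (LinearMap.ext fun ψ => ?_) }⟩, ?_⟩
    · exact ConcreteCategory.congr_hom (E.obj.map_comp
        (Quiver.Hom.op (X := m.unop) (Y := ⟨n⟩) ψ) φ) x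
    · apply ObjectProperty.hom_ext
      refine NatTrans.ext (funext fun m => ModuleCat.hom_ext (LinearMap.ext fun φ => ?_))
      have h1 := ConcreteCategory.congr_hom (e.hom.naturality
        (Quiver.Hom.op (X := m.unop) (Y := ⟨n⟩) φ)) x
      have h2 := ConcreteCategory.congr_hom (f.hom.naturality
        (Quiver.Hom.op (X := m.unop) (Y := ⟨n⟩) φ)) (idCL n)
      have h3 : compCL φ (idCL n) = φ := Subtype.ext (act_idCL _ _)
      have h4 : f.hom.app m (compCL φ (idCL n)) =
        X.obj.map (Quiver.Hom.op (X := m.unop) (Y := ⟨n⟩) φ)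
          (f.hom.app (Opposite.op ⟨n⟩) (idCL n)) := h2
      rw [h3, ← hx] at h4
      exact h1.trans h4.symm

/-- The components of the inclusion of `𝐂𝐚𝐭𝔏𝔦𝔢 ⊙ Λ^t 𝔏𝔦𝔢` in a representable right module. -/
def ceToCL (t m n : ℕ) : CET t m n →ₗ[ℚ] CL m (n + t) :=
  (ceToTensor t n).restrict fun _ h => ceToTensor_mem h

/-- The components of the projection of a representable right module on `𝐂𝐚𝐭𝔏𝔦𝔢 ⊙ Λ^t 𝔏𝔦𝔢`. -/
def clToCE (t m n : ℕ) : CL m (n + t) →ₗ[ℚ] CET t m n :=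
  (tensorToCE t n).restrict fun _ h => tensorToCE_mem h

lemma ceToCL_right (t n : ℕ) {k m : ℕ} (φ : CL k m) (ξ : CET t m n) :
    ceToCL t k n (ceRight φ ξ) = compCL φ (ceToCL t m n ξ) := by
  refine Subtype.ext ?_
  have : ceToTensor t n ∘ₗ ceAct ξ = act (g := FreeLieAlgebra ℚ (Fin k)) (ceToCL t m n ξ) := by
    refine PiTensorProduct.ext (MultilinearMap.ext fun v => ?_)
    rw [LinearMap.compMultilinearMap_apply, LinearMap.compMultilinearMap_apply,
      LinearMap.comp_apply, act_tprod, ceAct_tprod, ceToTensor_map _ ξ.2]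
    rfl
  exact LinearMap.congr_fun this φ.1

lemma clToCE_right (t n : ℕ) {k m : ℕ} (φ : CL k m) (ψ : CL m (n + t)) :
    clToCE t k n (compCL φ ψ) = ceRight φ (clToCE t m n ψ) := by
  refine Subtype.ext ?_
  have : tensorToCE t n ∘ₗ act (g := FreeLieAlgebra ℚ (Fin k)) ψ = ceAct (clToCE t m n ψ) := by
    refine PiTensorProduct.ext (MultilinearMap.ext fun v => ?_)
    rw [LinearMap.compMultilinearMap_apply, LinearMap.compMultilinearMap_apply,
      LinearMap.comp_apply, act_tprod, ceAct_tprod, tensorToCE_map]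
    rfl
  exact LinearMap.congr_fun this φ.1

/-- The inclusion of `𝐂𝐚𝐭𝔏𝔦𝔢 ⊙ Λ^t 𝔏𝔦𝔢` in a representable right module. -/
def ceToRepr (t n : ℕ) : (ceData t).toRight n ⟶ catLieData.toRight (n + t) :=
  ⟨{ app := fun m => ModuleCat.ofHom (ceToCL t m.unop.arity n)
     naturality := fun _ _ φ => ModuleCat.hom_ext (LinearMap.ext fun ξ =>
      ceToCL_right t n φ.unop ξ) }⟩

/-- The projection of a representable right module on `𝐂𝐚𝐭𝔏𝔦𝔢 ⊙ Λ^t 𝔏𝔦𝔢`. -/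
def reprToCE (t n : ℕ) : catLieData.toRight (n + t) ⟶ (ceData t).toRight n :=
  ⟨{ app := fun m => ModuleCat.ofHom (clToCE t m.unop.arity n)
     naturality := fun _ _ φ => ModuleCat.hom_ext (LinearMap.ext fun ψ =>
      clToCE_right t n φ.unop ψ) }⟩

lemma ceToRepr_reprToCE (t n : ℕ) : ceToRepr t n ≫ reprToCE t n = 𝟙 _ := by
  apply ObjectProperty.hom_ext
  refine NatTrans.ext (funext fun m => ModuleCat.hom_ext (LinearMap.ext fun ξ => Subtype.ext ?_))
  exact tensorToCE_ceToTensor (ξ : CET t m.unop.arity n).2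

/-- A retract of a projective object is projective. -/
lemma projective_ceData_right (t n : ℕ) : Projective ((ceData t).toRight n) := by
  have := projective_catLie_right (n + t)
  refine ⟨fun {E X} f e _ => ⟨ceToRepr t n ≫ Projective.factorThru (reprToCE t n ≫ f) e, ?_⟩⟩
  rw [Category.assoc, Projective.factorThru_comp, ← Category.assoc, ceToRepr_reprToCE,
    Category.id_comp]

lemma projective_ceLie (t : ℕ) (n : CatLie) : Projective (Bimod.right (CELie.X t) n) :=
  projective_ceData_right t n.arity

end Projectivity

end LiePROP

end


theorem theoremB :
    CategoryTheory.IsIso LiePROP.ceZero ∧ CategoryTheory.IsIso LiePROP.ceOne ∧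
    LiePROP.CELie.d 1 0 ≫ LiePROP.ceZero = LiePROP.ceOne ≫ LiePROP.muTilde ∧
    LiePROP.piHom ≫ LiePROP.muOne = LiePROP.muTilde ∧
    (∃ f : LiePROP.CELie ⟶ LiePROP.CLie,
      (f.f 0 = LiePROP.ceZero ∧ f.f 1 = LiePROP.ceOne ≫ LiePROP.piHom) ∧
      (∀ f' : LiePROP.CELie ⟶ LiePROP.CLie,
        f'.f 0 = LiePROP.ceZero → f'.f 1 = LiePROP.ceOne ≫ LiePROP.piHom → f' = f) ∧
      (∀ (t : ℕ) (m n : LiePROP.CatLie),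
        Function.Surjective ((LiePROP.evalBimod m n).map (f.f t)).hom) ∧
      (∀ m n : LiePROP.CatLie,
        QuasiIso (((LiePROP.evalBimod m n).mapHomologicalComplex (ComplexShape.down ℕ)).map f))) ∧
    (∀ (t : ℕ) (n : LiePROP.CatLie),
      CategoryTheory.Projective (LiePROP.Bimod.right (LiePROP.CELie.X t) n)) :=
  ⟨LiePROP.isIso_ceZero, LiePROP.isIso_ceOne, LiePROP.ceLie_d_comp_ceZero, LiePROP.piHom_comp_muOne,
    ⟨LiePROP.comparison, ⟨rfl, rfl⟩, fun f' h0 h1 => LiePROP.comparison_unique f' _ h0 h1,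
      LiePROP.comparison_surjective, LiePROP.comparison_quasiIso⟩, LiePROP.projective_ceLie⟩
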